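/- **Lemma 3.4.** Let $d\in\mathbb N$, $1<p<\infty$, and let $\theta\in C_c^\infty(\mathbb R^{d+1};\mathbb R^{d+1})$ satisfy $\theta=\mathrm{Id}$ in $B(0,1)$ and $\theta=0$ outside $B(0,2)$ (open balls). There is a constant $C$ depending only on $d$, $p$ and $\theta$ such that the following holds. Let $(N,h)$ be an oriented smooth $(d+1)$-dimensional Riemannian manifold and let $\varepsilon\in(0,1)$. Let $(U,\varphi)$ be an $\varepsilon$-isometric chart on $N$, that is, $\frac1{1+\varepsilon}|v|^2<h_y(v,v)<(1+\varepsilon)|v|^2$ for all $y\in\varphi(U)$ and $v\neq0$, where $h_y$ is the metric pushed forward by $\varphi$, and the Christoffel symbols of $h$ in this chart satisfy $|\Gamma_{ij}^k|\le\varepsilon$. Let $r>0$ with $B(0,2r)\subset\varphi(U)$ and set $\varphi^{(r)}:=r\,\theta(\varphi/r)$ in $U$, $\varphi^{(r)}:=0$ in $N\setminus U$. Let $Q\subset\mathbb R^d$ be an open and bounded cube. A map $w$ from $Q$ to a smooth manifold $X$ has the colocal weak derivative $dw$, where $dw_x:\mathbb R^d\to T_{w(x)}X$ is linear for $x \in Q$,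 if for every $f\in C^1_c(X)$ the function $f\circ w$ is weakly differentiable on $Q$ with weak derivative $df_{w(x)}\circ dw_x$ for a.e. $x \in Q$. Let $u\in\mathrm{Imm}_p(Q;N)$. This means that $u:Q\to N$ has a colocal weak derivative $du$ with $|du|_{e_d,h}\in L^p(Q)$ and $\operatorname{rank}du_x=d$ for a.e. $x$, and that the oriented unit normal $\nu_u:Q\to TN$ has a colocal weak derivative $d\nu_u$ whose norm with respect to the Euclidean metric and the Sasaki metric of $TN$ belongs to $L^p(Q)$. Here, if $\operatorname{rank}du_x=d$, then $\nu_u(x)\in T_{u(x)}N$ is the unit vector orthogonal to $du_x(\mathbb R^d)$ such that $(du_x(v_1),\dots,du_x(v_d),\nu_u(x))$ is a positively oriented basis of $T_{u(x)}N$ whenever $(v_1,\dots,v_d)$ is a positively oriented basis of $\mathbb R^d$; otherwise $\nu_u(x)=0$. The Sasaki norm is $|\xi|_\sigma^2=|d\pi_N(\xi)|_h^2+|K_{TN}(\xi)|_h^2$, where $\pi_N:TN\to N$ is the bundle projection and $K_{TN}:TTN\to TN$ is the connector of the Levi-Civita connection. All norms of linear maps are Frobenius norms, and $e_d$ is the Euclidean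 metric on $\mathbb R^d$. Set $$\tilde n(x):=D\varphi^{(r)}(u(x))(\nu_u(x)),\qquad F:=u^{-1}(\varphi^{-1}(B(0,r))),\qquad E_b(u):=\int_Q|K_{TN}\circ d(\nu_u)_x|_{e_d,h}^p\,dx .$$ Then $\tilde n\in W^{1,p}(Q;\mathbb R^{d+1})$ and $$\int_Q|D\tilde n|^p\,dx\le C\left(\frac1{r^p}\int_{Q\setminus F}|du|_{e_d,h}^p\,dx+\int_Q|du|_{e_d,h}^p\,dx+E_b(u)\right).$$ -/

import Mathlib

open MeasureTheory Set Bundle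
open scoped Manifold ContDiff ENNReal NNReal Topology

universe u

/-! ## Weak derivatives on open subsets of Euclidean space -/

/-- `g` is a weak (distributional) derivative of `f` on the open set `Q ⊆ ℝᵈ`: both are locally
integrable on `Q` and `∫_Q (∂_v η) f = - ∫_Q η (g v)` for all test functions `η ∈ C_c^∞(Q)` and all
directions `v`. -/
def HasWeakDeriv {d : ℕ} {F : Type*} [NormedAddCommGroup F] [NormedSpace ℝ F]
    (Q : Set (EuclideanSpace ℝ (Fin d))) (f : EuclideanSpace ℝ (Fin d) → F)
    (g : EuclideanSpace ℝ (Fin d) → EuclideanSpace ℝ (Fin d) →L[ℝ] F) : Prop :=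
  LocallyIntegrableOn f Q volume ∧ LocallyIntegrableOn g Q volume ∧
    ∀ η : EuclideanSpace ℝ (Fin d) → ℝ, ContDiff ℝ ∞ η → HasCompactSupport η → tsupport η ⊆ Q →
      ∀ v : EuclideanSpace ℝ (Fin d),
        ∫ x in Q, fderiv ℝ η x v • f x = - ∫ x in Q, η x • g x v

/-- Open bounded cubes in `ℝᵈ` (of side length `ℓ`, not necessarily parallel to the axes). -/
def IsOpenCube {d : ℕ} (Q : Set (EuclideanSpace ℝ (Fin d))) : Prop :=
  ∃ (b : OrthonormalBasis (Fin d) ℝ (EuclideanSpace ℝ (Fin d))) (c : EuclideanSpace ℝ (Fin d))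
    (ℓ : ℝ), 0 < ℓ ∧ Q = {x | ∀ i, |inner ℝ (b i) (x - c)| < ℓ / 2}

/-- The Frobenius norm `(∑ᵢ |L eᵢ|²)^(1/2)` of a linear map `L` from Euclidean `ℝᵈ` to a space with
norm `nrm`, where `(eᵢ)` is the standard basis. -/
noncomputable def frobeniusNorm {d : ℕ} {W : Type*} (nrm : W → ℝ)
    (L : EuclideanSpace ℝ (Fin d) → W) : ℝ :=
  √(∑ i, nrm (L (EuclideanSpace.single i 1)) ^ 2)

/-! ## Colocally weakly differentiable maps -/

/-- `du` is a colocal weak derivative on the open set `Q ⊆ ℝᵈ` of the map `u` with values in the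
manifold `N`: for every `f ∈ C_c^1(N)`, the function `f ∘ u` is weakly differentiable on `Q`, with
weak derivative `x ↦ df_{u(x)} ∘ du_x`. (Only the values of `u` and `du` on `Q` matter.) -/
def IsColocalWeakDeriv {d : ℕ} {E : Type*} [NormedAddCommGroup E] [NormedSpace ℝ E]
    {H : Type*} [TopologicalSpace H] (I : ModelWithCorners ℝ E H)
    {N : Type*} [TopologicalSpace N] [ChartedSpace H N]
    (Q : Set (EuclideanSpace ℝ (Fin d))) (u : EuclideanSpace ℝ (Fin d) → N)
    (du : ∀ x, EuclideanSpace ℝ (Fin d) →L[ℝ] TangentSpace I (u x)) : Prop :=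
  ∀ f : N → ℝ, ContMDiff I 𝓘(ℝ, ℝ) 1 f → HasCompactSupport f →
    HasWeakDeriv Q (fun x => f (u x))
      (fun x => ContinuousLinearMap.comp
        (show TangentSpace I (u x) →L[ℝ] ℝ from mfderiv I 𝓘(ℝ, ℝ) f (u x)) (du x))

/-! ## Orientations -/

/-- The family `v` is a basis of `V` that is positively oriented with respect to `o`. -/
def IsPositiveFrame {n : ℕ} {V : Type*} [AddCommGroup V] [Module ℝ V]
    (o : Orientation ℝ V (Fin n)) (v : Fin n → V) : Prop :=
  ∃ B : Module.Basis (Fin n) ℝ V, ⇑B = v ∧ B.orientation = o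

/-- The standard orientation of `ℝᵈ`. -/
noncomputable def stdOrientation (d : ℕ) : Orientation ℝ (EuclideanSpace ℝ (Fin d)) (Fin d) :=
  (EuclideanSpace.basisFun (Fin d) ℝ).toBasis.orientation

section Manifold

variable {d : ℕ} {N : Type u} [TopologicalSpace N]
  [ChartedSpace (EuclideanSpace ℝ (Fin (d + 1))) N]

variable (d N) in
/-- An orientation of the `(d + 1)`-dimensional manifold `N`: an orientation of every tangent space
such that every point lies in the domain of a chart all of whose coordinate frames are positive. -/
structure ManifoldOrientation where
  /-- The orientation of each tangent space. -/
  at_ : ∀ q : N, Orientation ℝ (TangentSpace (𝓡 (d + 1)) q) (Fin (d + 1))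
  exists_chart : ∀ q : N, ∃ φ ∈ IsManifold.maximalAtlas (𝓡 (d + 1)) ∞ N, q ∈ φ.source ∧
    ∀ q' ∈ φ.source, ∃ B : Module.Basis (Fin (d + 1)) ℝ (TangentSpace (𝓡 (d + 1)) q'),
      (∀ i, mfderiv (𝓡 (d + 1)) 𝓘(ℝ, EuclideanSpace ℝ (Fin (d + 1))) φ q' (B i)
        = EuclideanSpace.single i (1 : ℝ)) ∧ B.orientation = at_ q'

variable [RiemannianBundle (fun q : N => TangentSpace (𝓡 (d + 1)) q)]

/-- The Frobenius norm `|L|_{e_d, h}` of a linear map `L : ℝᵈ → T_qN`, with respect to the Euclidean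
metric on `ℝᵈ` and the Riemannian metric `h` on `T_qN`. -/
noncomputable def derivNorm {q : N}
    (L : EuclideanSpace ℝ (Fin d) →L[ℝ] TangentSpace (𝓡 (d + 1)) q) : ℝ :=
  frobeniusNorm (fun t : TangentSpace (𝓡 (d + 1)) q => ‖t‖) L

/-! ## Metric and Christoffel symbols in a chart, the connector, the Sasaki norm -/

/-- The metric of `N` pushed forward by the chart `φ`:
`h_y(v, w) = (d(φ⁻¹)_y v, d(φ⁻¹)_y w)_h` for `y` in the image of `φ`. -/
noncomputable def chartMetric (φ : OpenPartialHomeomorph N (EuclideanSpace ℝ (Fin (d + 1))))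
    (y v w : EuclideanSpace ℝ (Fin (d + 1))) : ℝ :=
  (inner ℝ
    (show TangentSpace (𝓡 (d + 1)) (φ.symm y) from
      mfderiv 𝓘(ℝ, EuclideanSpace ℝ (Fin (d + 1))) (𝓡 (d + 1)) φ.symm y v)
    (show TangentSpace (𝓡 (d + 1)) (φ.symm y) from
      mfderiv 𝓘(ℝ, EuclideanSpace ℝ (Fin (d + 1))) (𝓡 (d + 1)) φ.symm y w) : ℝ)

/-- The Gram matrix `(h_ij(y))` of the metric in the chart `φ`. -/
noncomputable def chartGram (φ : OpenPartialHomeomorph N (EuclideanSpace ℝ (Fin (d + 1))))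
    (y : EuclideanSpace ℝ (Fin (d + 1))) : Matrix (Fin (d + 1)) (Fin (d + 1)) ℝ :=
  Matrix.of fun i j => chartMetric φ y (EuclideanSpace.single i 1) (EuclideanSpace.single j 1)

/-- The partial derivative `∂_i h_jl` at `y` of the metric coefficients in the chart `φ`. -/
noncomputable def chartGramDeriv (φ : OpenPartialHomeomorph N (EuclideanSpace ℝ (Fin (d + 1))))
    (y : EuclideanSpace ℝ (Fin (d + 1))) (i j l : Fin (d + 1)) : ℝ :=
  fderiv ℝ (fun z => chartGram φ z j l) y (EuclideanSpace.single i 1)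

/-- The Christoffel symbol `Γ_{ij}^k = ½ ∑_l h^{kl} (∂_i h_jl + ∂_j h_il - ∂_l h_ij)` of the
Levi-Civita connection in the chart `φ`, at the point with coordinates `y`. -/
noncomputable def christoffel (φ : OpenPartialHomeomorph N (EuclideanSpace ℝ (Fin (d + 1))))
    (y : EuclideanSpace ℝ (Fin (d + 1))) (i j k : Fin (d + 1)) : ℝ :=
  (1 / 2) * ∑ l, (chartGram φ y)⁻¹ k l *
    (chartGramDeriv φ y i j l + chartGramDeriv φ y j i l - chartGramDeriv φ y l i j)

variable [IsManifold (𝓡 (d + 1)) ∞ N]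

/-- The differential of the bundle projection `TN → N`. -/
noncomputable def dProj (e : TangentBundle (𝓡 (d + 1)) N) (ξ : TangentSpace (𝓡 (d + 1)).tangent e) :
    TangentSpace (𝓡 (d + 1)) e.proj :=
  mfderiv (𝓡 (d + 1)).tangent (𝓡 (d + 1))
    (fun e' : TangentBundle (𝓡 (d + 1)) N => e'.proj) e ξ

/-- The connector `K_TN : T_{(q,v)}TN → T_qN`, computed in the chart `φ` around `q`. If `(y, w)` are
the coordinates on `TN` induced by `φ` (so `w(q', v') = dφ_{q'} v'`) and
`ξ = ∑ Y_i ∂/∂y_i + ∑ W_i ∂/∂w_i`, then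
`K_TN ξ = ∑_k (W_k + ∑_{i,j} w_j Y_i Γ_{ij}^k) ∂/∂y_k`. -/
noncomputable def connectorIn (φ : OpenPartialHomeomorph N (EuclideanSpace ℝ (Fin (d + 1))))
    (e : TangentBundle (𝓡 (d + 1)) N) (ξ : TangentSpace (𝓡 (d + 1)).tangent e) :
    TangentSpace (𝓡 (d + 1)) e.proj :=
  let w : TangentBundle (𝓡 (d + 1)) N → EuclideanSpace ℝ (Fin (d + 1)) := fun e' =>
    mfderiv (𝓡 (d + 1)) 𝓘(ℝ, EuclideanSpace ℝ (Fin (d + 1))) φ e'.proj e'.snd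
  let Y : EuclideanSpace ℝ (Fin (d + 1)) :=
    mfderiv (𝓡 (d + 1)) 𝓘(ℝ, EuclideanSpace ℝ (Fin (d + 1))) φ e.proj (dProj e ξ)
  let W : EuclideanSpace ℝ (Fin (d + 1)) :=
    mfderiv (𝓡 (d + 1)).tangent 𝓘(ℝ, EuclideanSpace ℝ (Fin (d + 1))) w e ξ
  mfderiv 𝓘(ℝ, EuclideanSpace ℝ (Fin (d + 1))) (𝓡 (d + 1)) φ.symm (φ e.proj)
    (WithLp.toLp 2 fun k => W k + ∑ i, ∑ j, w e j * Y i * christoffel φ (φ e.proj) i j k)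

/-- The connector `K_TN` of the Levi-Civita connection of `N`. It does not depend on the chart used
to compute it; we take the preferred chart at the base point. -/
noncomputable def connector (e : TangentBundle (𝓡 (d + 1)) N)
    (ξ : TangentSpace (𝓡 (d + 1)).tangent e) : TangentSpace (𝓡 (d + 1)) e.proj :=
  connectorIn (chartAt (EuclideanSpace ℝ (Fin (d + 1))) e.proj) e ξ

/-- The norm `(|dπ ξ|² + |K_TN ξ|²)^(1/2)` of the Sasaki metric on `TN`. -/
noncomputable def sasakiNorm (e : TangentBundle (𝓡 (d + 1)) N)
    (ξ : TangentSpace (𝓡 (d + 1)).tangent e) : ℝ :=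
  √(‖dProj e ξ‖ ^ 2 + ‖connector e ξ‖ ^ 2)

/-! ## Sobolev immersions -/

/-- `n` is the oriented unit normal of the linear map `L : ℝᵈ → T_qN`: if `L` has rank `d`, then `n`
is the unit vector orthogonal to the image of `L` that completes the image of any positively
oriented basis of `ℝᵈ` to a positively oriented basis of `T_qN`; otherwise `n = 0`. -/
def IsOrientedUnitNormal (o : ManifoldOrientation d N) {q : N}
    (L : EuclideanSpace ℝ (Fin d) →L[ℝ] TangentSpace (𝓡 (d + 1)) q)
    (n : TangentSpace (𝓡 (d + 1)) q) : Prop :=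
  (Module.finrank ℝ (LinearMap.range L.toLinearMap) = d →
    ‖n‖ = 1 ∧ (∀ v, inner ℝ n (L v) = (0 : ℝ)) ∧
      ∀ b : Fin d → EuclideanSpace ℝ (Fin d), IsPositiveFrame (stdOrientation d) b →
        IsPositiveFrame (o.at_ q) (Fin.snoc (fun i => L (b i)) n)) ∧
  (Module.finrank ℝ (LinearMap.range L.toLinearMap) < d → n = 0)

/-- `u ∈ Imm_p(Q; N)`, with `du` the colocal weak derivative of `u`, `ν` the oriented unit normal
`ν_u` of `u` along `du`, and `dν` the colocal weak derivative of `ν_u`, regarded as a map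
`Q → TN`, `x ↦ (u x, ν x)`: the map `u` belongs to the homogeneous Sobolev space
`Ẇ^{1,p}(Q; N)`, its derivative has rank `d` almost everywhere, and `ν_u` belongs to
`Ẇ^{1,p}(Q; TN)`, where `TN` carries the Sasaki metric. -/
structure IsSobolevImmersion (p : ℝ) (o : ManifoldOrientation d N)
    (Q : Set (EuclideanSpace ℝ (Fin d))) (u : EuclideanSpace ℝ (Fin d) → N)
    (du : ∀ x, EuclideanSpace ℝ (Fin d) →L[ℝ] TangentSpace (𝓡 (d + 1)) (u x))
    (ν : ∀ x, TangentSpace (𝓡 (d + 1)) (u x))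
    (dν : ∀ x, EuclideanSpace ℝ (Fin d) →L[ℝ]
      TangentSpace (𝓡 (d + 1)).tangent (⟨u x, ν x⟩ : TangentBundle (𝓡 (d + 1)) N)) : Prop where
  deriv_map : IsColocalWeakDeriv (𝓡 (d + 1)) Q u du
  memLp_map : MemLp (fun x => derivNorm (du x)) (ENNReal.ofReal p)
    (volume.restrict Q)
  rank_eq : ∀ᵐ x ∂(volume.restrict Q), Module.finrank ℝ (LinearMap.range (du x).toLinearMap) = d
  normal : ∀ x ∈ Q, IsOrientedUnitNormal o (du x) (ν x)
  deriv_normal : IsColocalWeakDeriv (𝓡 (d + 1)).tangent Q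
    (fun x => (⟨u x, ν x⟩ : TangentBundle (𝓡 (d + 1)) N)) dν
  memLp_normal : MemLp (fun x => frobeniusNorm (sasakiNorm ⟨u x, ν x⟩) (dν x)) (ENNReal.ofReal p)
    (volume.restrict Q)

/-- The bending energy `E_b(u) = ∫_Q |K_TN ∘ d(ν_u)_x|^p dx`. -/
noncomputable def bendingEnergy (p : ℝ) (Q : Set (EuclideanSpace ℝ (Fin d)))
    (u : EuclideanSpace ℝ (Fin d) → N) (ν : ∀ x, TangentSpace (𝓡 (d + 1)) (u x))
    (dν : ∀ x, EuclideanSpace ℝ (Fin d) →L[ℝ]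
      TangentSpace (𝓡 (d + 1)).tangent (⟨u x, ν x⟩ : TangentBundle (𝓡 (d + 1)) N)) : ℝ≥0∞ :=
  ∫⁻ x in Q, ENNReal.ofReal
    (frobeniusNorm (fun ξ => ‖connector (⟨u x, ν x⟩ : TangentBundle (𝓡 (d + 1)) N) ξ‖) (dν x) ^ p)

/-! ## Almost isometric charts and their extensions -/

/-- The chart `φ` of the smooth structure of `N` is `ε`-isometric: in `φ(U)` the metric satisfies
`(1 + ε)⁻¹ e < h < (1 + ε) e` as quadratic forms, with `e` the Euclidean metric, and all Christoffel
symbols are bounded by `ε`. -/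
structure IsAlmostIsometricChart (ε : ℝ)
    (φ : OpenPartialHomeomorph N (EuclideanSpace ℝ (Fin (d + 1)))) : Prop where
  mem_atlas : φ ∈ IsManifold.maximalAtlas (𝓡 (d + 1)) ∞ N
  lower : ∀ y ∈ φ.target, ∀ v, v ≠ 0 → 1 / (1 + ε) * ‖v‖ ^ 2 < chartMetric φ y v v
  upper : ∀ y ∈ φ.target, ∀ v, v ≠ 0 → chartMetric φ y v v < (1 + ε) * ‖v‖ ^ 2
  christoffel_le : ∀ y ∈ φ.target, ∀ i j k, |christoffel φ y i j k| ≤ ε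

end Manifold

/-- A cut-off of the identity: `θ ∈ C_c^∞(ℝⁿ; ℝⁿ)`, `θ = Id` in `B(0, 1)` and `θ = 0` outside
`B(0, 2)`. -/
structure IsIdentityCutoff {n : ℕ} (θ : EuclideanSpace ℝ (Fin n) → EuclideanSpace ℝ (Fin n)) :
    Prop where
  contDiff : ContDiff ℝ ∞ θ
  hasCompactSupport : HasCompactSupport θ
  eq_self : ∀ y ∈ Metric.ball (0 : EuclideanSpace ℝ (Fin n)) 1, θ y = y
  eq_zero : ∀ y ∉ Metric.ball (0 : EuclideanSpace ℝ (Fin n)) 2, θ y = 0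

open Classical in
/-- The extension `φ^{(r)}` of the chart `(U, φ)` by `θ`: `φ^{(r)} = r θ(φ / r)` in `U` and
`φ^{(r)} = 0` in `N \ U`. -/
noncomputable def extendChart {n : ℕ} {N : Type u} [TopologicalSpace N]
    (θ : EuclideanSpace ℝ (Fin n) → EuclideanSpace ℝ (Fin n))
    (φ : OpenPartialHomeomorph N (EuclideanSpace ℝ (Fin n))) (r : ℝ) (q : N) :
    EuclideanSpace ℝ (Fin n) :=
  if q ∈ φ.source then r • θ (r⁻¹ • φ q) else 0

/-- The coordinate normal `ñ(x) = Dφ^{(r)}(u(x))(ν(x))`. -/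
noncomputable def coordNormal {d : ℕ} {N : Type u} [TopologicalSpace N]
    [ChartedSpace (EuclideanSpace ℝ (Fin (d + 1))) N]
    (θ : EuclideanSpace ℝ (Fin (d + 1)) → EuclideanSpace ℝ (Fin (d + 1)))
    (φ : OpenPartialHomeomorph N (EuclideanSpace ℝ (Fin (d + 1)))) (r : ℝ)
    (u : EuclideanSpace ℝ (Fin d) → N) (ν : ∀ x, TangentSpace (𝓡 (d + 1)) (u x))
    (x : EuclideanSpace ℝ (Fin d)) : EuclideanSpace ℝ (Fin (d + 1)) :=
  mfderiv (𝓡 (d + 1)) 𝓘(ℝ, EuclideanSpace ℝ (Fin (d + 1))) (extendChart θ φ r) (u x) (ν x)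

set_option linter.unusedSectionVars false
set_option synthInstance.maxHeartbeats 400000

/-! ## Weak derivatives -/

section WeakDeriv

variable {d : ℕ} {F : Type*} [NormedAddCommGroup F] [NormedSpace ℝ F]
  {Q : Set (EuclideanSpace ℝ (Fin d))}

/-! In the coordinates `(y, w) = (φ(q), dφ_q v)` of the tangent bundle the coordinate normal is
`Dθ(y/r) w`, evaluated at `(u, ν)`. If `Y` and `W` are the horizontal and vertical coordinates of
`dν v`, the chain rule gives `r⁻¹ D²θ(y/r)(Y, w) + Dθ(y/r) W`. Since `θ` is the identity on the unit
ball, `D²θ` vanishes there, so the term with `r⁻¹` lives only off `F`. The almost isometric metric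
bounds `|w|` by `√2` and `|Y|` by `√2 |du v|`, and the definition of the connector gives `W = dφ(K
dν v) - Γ(Y, w)`, with bounded `Γ`. This yields the pointwise bound
`norm_coordNormalDeriv_apply_le`; raising it to the power `p` and integrating gives the estimate.

Four points need care. The connector is defined through the preferred chart, so it must be shown to
be chart independent: `christoffelForm_transition`, `connector_eq_connectorIn`. That `Y` is the
coordinate expression of `du v` is not part of the hypotheses; it follows almost everywhere from
uniqueness of weak derivatives (`ae_bundleVelocity_fst_eq`).

Colocal derivatives can be tested only with compactly supported functions. The function `Dθ(y/r) w`
is not compactly supported in `w`, which a fibre cut-off repairs because `|w| ≤ 2`. In `y` its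
support may reach the sphere of radius `2r`, which need not lie in the image of `φ`. Hence the weak
derivative is computed for radii `s < r` (`hasWeakDeriv_normalCoord`), and `s` tends to `r` by
dominated convergence (`HasWeakDeriv.of_tendsto`).

For the same reason the extended chart could be irregular at points of the boundary of the chart
domain. `mfderiv_extendChart_of_notMem` shows that its derivative is zero there, because `Dθ` is
small near the sphere of radius `2` while `dφ` stays bounded. -/

lemma MeasureTheory.LocallyIntegrableOn.integrable_smul_of_tsupport_subset
    {f : EuclideanSpace ℝ (Fin d) → F} (hf : LocallyIntegrableOn f Q volume)
    {η : EuclideanSpace ℝ (Fin d) → ℝ} (hη : Continuous η) (hc : HasCompactSupport η)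
    (hs : tsupport η ⊆ Q) : Integrable (fun x => η x • f x) volume := by
  have h1 : IntegrableOn (fun x => η x • f x) (tsupport η) volume :=
    (hf.integrableOn_compact_subset hs hc).continuousOn_smul hη.continuousOn hc
  rw [integrableOn_iff_integrable_of_support_subset] at h1
  · exact h1
  · intro x hx
    apply subset_tsupport η
    intro h0
    exact hx (by simp [h0])

lemma HasWeakDeriv.congr {f f' : EuclideanSpace ℝ (Fin d) → F}
    {g g' : EuclideanSpace ℝ (Fin d) → EuclideanSpace ℝ (Fin d) →L[ℝ] F}
    (hQ : MeasurableSet Q) (h : HasWeakDeriv Q f g)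
    (hf : ∀ x ∈ Q, f x = f' x) (hg : ∀ x ∈ Q, g x = g' x) : HasWeakDeriv Q f' g' := by
  obtain ⟨h1, h2, h3⟩ := h
  have e1 : f =ᵐ[volume.restrict Q] f' := (ae_restrict_iff' hQ).2 (ae_of_all _ hf)
  have e2 : g =ᵐ[volume.restrict Q] g' := (ae_restrict_iff' hQ).2 (ae_of_all _ hg)
  refine ⟨?_, ?_, ?_⟩
  · intro x hx
    obtain ⟨s, hs, hi⟩ := h1 x hx
    refine ⟨s ∩ Q, Filter.inter_mem hs self_mem_nhdsWithin, ?_⟩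
    exact (hi.mono_set inter_subset_left).congr (ae_restrict_of_ae_restrict_of_subset inter_subset_right e1)
  · intro x hx
    obtain ⟨s, hs, hi⟩ := h2 x hx
    refine ⟨s ∩ Q, Filter.inter_mem hs self_mem_nhdsWithin, ?_⟩
    exact (hi.mono_set inter_subset_left).congr (ae_restrict_of_ae_restrict_of_subset inter_subset_right e2)
  · intro η he hc hs v
    rw [← setIntegral_congr_fun hQ (f := fun x => fderiv ℝ η x v • f x)
        (fun x hx => by simp [hf x hx]), h3 η he hc hs v,
      setIntegral_congr_fun hQ (g := fun x => η x • g' x v) (fun x hx => by simp [hg x hx])]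

lemma HasWeakDeriv.smul_const [CompleteSpace F] {f : EuclideanSpace ℝ (Fin d) → ℝ}
    {g : EuclideanSpace ℝ (Fin d) → EuclideanSpace ℝ (Fin d) →L[ℝ] ℝ}
    (h : HasWeakDeriv Q f g) (c : F) :
    HasWeakDeriv Q (fun x => f x • c) (fun x => (g x).smulRight c) := by
  obtain ⟨h1, h2, h3⟩ := h
  refine ⟨?_, ?_, ?_⟩
  · intro x hx
    obtain ⟨s, hs, hi⟩ := h1 x hx
    exact ⟨s, hs, hi.smul_const c⟩
  · intro x hx
    obtain ⟨s, hs, hi⟩ := h2 x hx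
    exact ⟨s, hs, ((ContinuousLinearMap.smulRightL ℝ (EuclideanSpace ℝ (Fin d)) F).flip c).integrable_comp hi⟩
  · intro η he hc hs v
    have := h3 η he hc hs v
    simp only [ContinuousLinearMap.smulRight_apply, smul_eq_mul, smul_smul] at this ⊢
    rw [integral_smul_const, integral_smul_const, this, neg_smul]

lemma HasWeakDeriv.sum [CompleteSpace F] {ι : Type*} (s : Finset ι) {f : ι → EuclideanSpace ℝ (Fin d) → F}
    {g : ι → EuclideanSpace ℝ (Fin d) → EuclideanSpace ℝ (Fin d) →L[ℝ] F}
    (h : ∀ i ∈ s, HasWeakDeriv Q (f i) (g i)) :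
    HasWeakDeriv Q (fun x => ∑ i ∈ s, f i x) (fun x => ∑ i ∈ s, g i x) := by
  have key : ∀ {G : Type _} [NormedAddCommGroup G] (f : ι → EuclideanSpace ℝ (Fin d) → G),
      (∀ i ∈ s, LocallyIntegrableOn (f i) Q volume) →
      LocallyIntegrableOn (fun x => ∑ i ∈ s, f i x) Q volume := by
    intro G _ f hf
    classical
    induction s using Finset.induction_on with
    | empty => simpa using locallyIntegrableOn_zero
    | insert a s ha ih =>
      simp only [Finset.sum_insert ha]
      exact (hf a (by simp)).add (ih (fun i hi => h i (by simp [hi]))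
        (fun i hi => hf i (by simp [hi])))
  refine ⟨key f fun i hi => (h i hi).1, key g fun i hi => (h i hi).2.1, ?_⟩
  intro η he hc hs v
  simp only [Finset.smul_sum, sum_apply]
  rw [integral_finsetSum, integral_finsetSum, ← Finset.sum_neg_distrib]
  · exact Finset.sum_congr rfl fun i hi => (h i hi).2.2 η he hc hs v
  · intro i hi
    have := (h i hi).2.1.integrable_smul_of_tsupport_subset he.continuous hc hs
    have h2 := ((ContinuousLinearMap.apply ℝ F v).integrable_comp this).integrableOn (s := Q)
    simpa [IntegrableOn] using h2
  · intro i hi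
    refine ((h i hi).1.integrable_smul_of_tsupport_subset (η := fun x => fderiv ℝ η x v) ?_ ?_ ?_).integrableOn
    · exact (he.continuous_fderiv (by simp)).clm_apply continuous_const
    · exact hc.fderiv_apply ℝ v
    · exact (tsupport_fderiv_apply_subset ℝ v).trans hs

/-- A Euclidean-valued function is weakly differentiable if its components are. -/
lemma hasWeakDeriv_euclidean {n : ℕ} {f : EuclideanSpace ℝ (Fin d) → EuclideanSpace ℝ (Fin n)}
    {g : EuclideanSpace ℝ (Fin d) → EuclideanSpace ℝ (Fin d) →L[ℝ] EuclideanSpace ℝ (Fin n)}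
    (h : ∀ k, HasWeakDeriv Q (fun x => f x k) (fun x => (EuclideanSpace.proj k).comp (g x))) :
    HasWeakDeriv Q f g := by
  have := HasWeakDeriv.sum Finset.univ (fun k _ => (h k).smul_const (EuclideanSpace.single k (1 : ℝ)))
  convert this using 1
  · ext x k
    simp [Finset.sum_apply, Pi.single_apply]
  · ext x v k
    simp [Finset.sum_apply, Pi.single_apply]

/-- The fundamental lemma of the calculus of variations, applied to the difference. Integrals over
`Q` and over the whole space agree because the test functions are supported in `Q`. -/
lemma HasWeakDeriv.ae_eq [CompleteSpace F] {f : EuclideanSpace ℝ (Fin d) → F}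
    {g g' : EuclideanSpace ℝ (Fin d) → EuclideanSpace ℝ (Fin d) →L[ℝ] F}
    (hQ : IsOpen Q) (h : HasWeakDeriv Q f g) (h' : HasWeakDeriv Q f g') :
    ∀ᵐ x ∂(volume.restrict Q), g x = g' x := by
  rw [ae_restrict_iff' hQ.measurableSet]
  have := hQ.ae_eq_zero_of_integral_contDiff_smul_eq_zero (μ := volume) (h.2.1.sub h'.2.1) ?_
  · filter_upwards [this] with x hx hxQ
    exact sub_eq_zero.1 (hx hxQ)
  intro η he hc hs
  have i1 := h.2.1.integrable_smul_of_tsupport_subset he.continuous hc hs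
  have i2 := h'.2.1.integrable_smul_of_tsupport_subset he.continuous hc hs
  have e1 : (fun x => η x • (g - g') x) = fun x => η x • g x - η x • g' x := by
    ext x v; simp [smul_sub]
  rw [e1, integral_sub i1 i2]
  ext v
  have e : ∀ {k : EuclideanSpace ℝ (Fin d) → EuclideanSpace ℝ (Fin d) →L[ℝ] F},
      Integrable (fun x => η x • k x) → (∫ x, η x • k x) v = ∫ x in Q, η x • k x v := by
    intro k hk
    rw [ContinuousLinearMap.integral_apply hk, setIntegral_eq_integral_of_forall_compl_eq_zero]
    · simp
    · intro x hx
      rw [image_eq_zero_of_notMem_tsupport (fun h => hx (hs h))]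
      simp
  rw [sub_apply, e i1, e i2, zero_apply, sub_eq_zero,
    ← neg_inj, ← h.2.2 η he hc hs v, ← h'.2.2 η he hc hs v]

/-- Weak derivatives pass to dominated pointwise limits. -/
lemma HasWeakDeriv.of_tendsto {f : EuclideanSpace ℝ (Fin d) → F}
    {g : EuclideanSpace ℝ (Fin d) → EuclideanSpace ℝ (Fin d) →L[ℝ] F}
    {fs : ℕ → EuclideanSpace ℝ (Fin d) → F}
    {gs : ℕ → EuclideanSpace ℝ (Fin d) → EuclideanSpace ℝ (Fin d) →L[ℝ] F}
    (h : ∀ n, HasWeakDeriv Q (fs n) (gs n))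
    (hm : ∀ n, AEStronglyMeasurable (fs n) (volume.restrict Q))
    (hm' : ∀ n, AEStronglyMeasurable (gs n) (volume.restrict Q))
    {B b : EuclideanSpace ℝ (Fin d) → ℝ} (hB : IntegrableOn B Q) (hb : IntegrableOn b Q)
    (hfB : ∀ n, ∀ᵐ x ∂(volume.restrict Q), ‖fs n x‖ ≤ B x)
    (hgb : ∀ n, ∀ᵐ x ∂(volume.restrict Q), ‖gs n x‖ ≤ b x)
    (hf : ∀ᵐ x ∂(volume.restrict Q), Filter.Tendsto (fun n => fs n x) Filter.atTop (𝓝 (f x)))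
    (hg : ∀ᵐ x ∂(volume.restrict Q), Filter.Tendsto (fun n => gs n x) Filter.atTop (𝓝 (g x))) :
    HasWeakDeriv Q f g := by
  have mf := aestronglyMeasurable_of_tendsto_ae _ hm hf
  have mg := aestronglyMeasurable_of_tendsto_ae _ hm' hg
  have If : IntegrableOn f Q := by
    refine hB.mono' mf ?_
    filter_upwards [hf, ae_all_iff.2 hfB] with x h1 h2
    exact le_of_tendsto h1.norm (Filter.Eventually.of_forall h2)
  have Ig : IntegrableOn g Q := by
    refine hb.mono' mg ?_
    filter_upwards [hg, ae_all_iff.2 hgb] with x h1 h2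
    exact le_of_tendsto h1.norm (Filter.Eventually.of_forall h2)
  refine ⟨If.locallyIntegrableOn, Ig.locallyIntegrableOn, ?_⟩
  intro η he hc hs v
  have cη : Continuous (fun x => fderiv ℝ η x v) :=
    (he.continuous_fderiv (by simp)).clm_apply continuous_const
  obtain ⟨C1, hC1⟩ := (hc.fderiv_apply ℝ v).exists_bound_of_continuous cη
  obtain ⟨C2, hC2⟩ := hc.exists_bound_of_continuous he.continuous
  have t1 : Filter.Tendsto (fun n => ∫ x in Q, fderiv ℝ η x v • fs n x) Filter.atTop
      (𝓝 (∫ x in Q, fderiv ℝ η x v • f x)) := by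
    refine tendsto_integral_of_dominated_convergence (fun x => C1 * B x) (fun n => ?_) (hB.const_mul C1) ?_ ?_
    · exact cη.aestronglyMeasurable.smul (hm n)
    · intro n
      filter_upwards [hfB n] with x hx
      rw [norm_smul]
      exact mul_le_mul (hC1 x) hx (norm_nonneg _) ((norm_nonneg _).trans (hC1 x))
    · filter_upwards [hf] with x hx using hx.const_smul _
  have t2 : Filter.Tendsto (fun n => ∫ x in Q, η x • gs n x v) Filter.atTop
      (𝓝 (∫ x in Q, η x • g x v)) := by
    refine tendsto_integral_of_dominated_convergence (fun x => C2 * (b x * ‖v‖)) (fun n => ?_)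
      ((hb.mul_const _).const_mul C2) ?_ ?_
    · exact he.continuous.aestronglyMeasurable.smul
        ((ContinuousLinearMap.apply ℝ F v).continuous.comp_aestronglyMeasurable (hm' n))
    · intro n
      filter_upwards [hgb n] with x hx
      rw [norm_smul]
      refine mul_le_mul (hC2 x) ?_ (norm_nonneg _) ((norm_nonneg _).trans (hC2 x))
      exact ((gs n x).le_opNorm v).trans (by gcongr)
    · filter_upwards [hg] with x hx
      exact (((ContinuousLinearMap.apply ℝ F v).continuous.tendsto _).comp hx).const_smul _
  refine tendsto_nhds_unique t1 ?_
  simp only [fun n => (h n).2.2 η he hc hs v]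
  exact t2.neg

lemma IsOpenCube.isOpen (h : IsOpenCube Q) : IsOpen Q := by
  obtain ⟨b, c, l, -, rfl⟩ := h
  rw [Set.ofPred_forall]
  refine isOpen_iInter_of_finite fun i => ?_
  exact isOpen_lt (by fun_prop) continuous_const

lemma IsOpenCube.isBounded (h : IsOpenCube Q) : Bornology.IsBounded Q := by
  obtain ⟨b, c, l, -, rfl⟩ := h
  refine (Metric.isBounded_closedBall (x := c) (r := √(d * (l / 2) ^ 2))).subset ?_
  intro x hx
  rw [mem_closedBall_iff_norm]
  apply Real.le_sqrt_of_sq_le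
  rw [← b.sum_sq_inner_right]
  have : ∀ i ∈ Finset.univ, inner ℝ (b i) (x - c) ^ 2 ≤ (l / 2) ^ 2 := by
    intro i _
    rw [← sq_abs]
    have := (hx i).le
    gcongr
  simpa using Finset.sum_le_card_nsmul _ _ _ this

lemma IsOpenCube.volume_lt_top (h : IsOpenCube Q) : volume Q < ⊤ :=
  h.isBounded.measure_lt_top

end WeakDeriv

/-! ## Frobenius norms -/

section Frobenius

variable {d : ℕ} {W : Type*}

lemma frobeniusNorm_eq (nrm : W → ℝ) (L : EuclideanSpace ℝ (Fin d) → W) :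
    frobeniusNorm nrm L
      = ‖(WithLp.toLp 2 fun i => nrm (L (EuclideanSpace.single i 1)) : EuclideanSpace ℝ (Fin d))‖ := by
  simp [frobeniusNorm, EuclideanSpace.norm_eq]

lemma frobeniusNorm_nonneg (nrm : W → ℝ) (L : EuclideanSpace ℝ (Fin d) → W) :
    0 ≤ frobeniusNorm nrm L := Real.sqrt_nonneg _

/-- Comparison of Frobenius norms from a comparison of columns. -/
lemma frobeniusNorm_le_of_forall {W₁ W₂ W₃ : Type*} {n₁ : W₁ → ℝ} {n₂ : W₂ → ℝ} {n₃ : W₃ → ℝ}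
    {L₁ : EuclideanSpace ℝ (Fin d) → W₁} {L₂ : EuclideanSpace ℝ (Fin d) → W₂}
    {L₃ : EuclideanSpace ℝ (Fin d) → W₃} {a b : ℝ} (ha : 0 ≤ a) (hb : 0 ≤ b)
    (h₁ : ∀ w, 0 ≤ n₁ w)
    (h : ∀ i, n₁ (L₁ (EuclideanSpace.single i 1)) ≤
      a * n₂ (L₂ (EuclideanSpace.single i 1)) + b * n₃ (L₃ (EuclideanSpace.single i 1))) :
    frobeniusNorm n₁ L₁ ≤ a * frobeniusNorm n₂ L₂ + b * frobeniusNorm n₃ L₃ := by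
  rw [frobeniusNorm_eq n₂, frobeniusNorm_eq n₃]
  set x₂ : EuclideanSpace ℝ (Fin d) := WithLp.toLp 2 fun i => n₂ (L₂ (EuclideanSpace.single i 1))
  set x₃ : EuclideanSpace ℝ (Fin d) := WithLp.toLp 2 fun i => n₃ (L₃ (EuclideanSpace.single i 1))
  calc frobeniusNorm n₁ L₁ ≤ ‖a • x₂ + b • x₃‖ := by
        rw [EuclideanSpace.norm_eq, frobeniusNorm]
        refine Real.sqrt_le_sqrt (Finset.sum_le_sum fun i _ => ?_)
        have := h₁ (L₁ (EuclideanSpace.single i 1))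
        rw [Real.norm_eq_abs, sq_abs]
        exact pow_le_pow_left₀ this (h i) 2
    _ ≤ _ := by
        refine (norm_add_le _ _).trans ?_
        rw [norm_smul, norm_smul, Real.norm_of_nonneg ha, Real.norm_of_nonneg hb]

/-- Cauchy–Schwarz on the expansion of a vector in the standard basis. It turns the Frobenius
estimates into bounds for the norm used by `MemLp` and by the dominated convergence. -/
lemma opNorm_le_frobeniusNorm {F : Type*} [NormedAddCommGroup F] [NormedSpace ℝ F]
    (L : EuclideanSpace ℝ (Fin d) →L[ℝ] F) : ‖L‖ ≤ frobeniusNorm (fun t : F => ‖t‖) L := by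
  refine L.opNorm_le_bound (frobeniusNorm_nonneg _ _) fun v => ?_
  have hv : v = ∑ i, v i • EuclideanSpace.single i (1 : ℝ) := by
    ext k; simp [Finset.sum_apply, Pi.single_apply]
  calc ‖L v‖ = ‖∑ i, v i • L (EuclideanSpace.single i (1 : ℝ))‖ := by
        conv_lhs => rw [hv]
        simp
    _ ≤ ∑ i, |v i| * ‖L (EuclideanSpace.single i (1 : ℝ))‖ := by
        refine (norm_sum_le _ _).trans (le_of_eq ?_)
        simp [norm_smul]
    _ ≤ √(∑ i, |v i| ^ 2) * √(∑ i, ‖L (EuclideanSpace.single i (1 : ℝ))‖ ^ 2) :=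
        Real.sum_mul_le_sqrt_mul_sqrt _ _ _
    _ = _ := by
        rw [mul_comm, EuclideanSpace.norm_eq]
        rfl

end Frobenius

/-! ## Charts and the coordinates they induce on the tangent bundle -/

section Charts

variable {E : Type*} [NormedAddCommGroup E] [NormedSpace ℝ E]
  {N : Type u} [TopologicalSpace N] [ChartedSpace E N] [IsManifold 𝓘(ℝ, E) ∞ N]
  {φ ψ : OpenPartialHomeomorph N E}

lemma OpenPartialHomeomorph.mdifferentiable_of_mem_maximalAtlas
    (h : φ ∈ IsManifold.maximalAtlas 𝓘(ℝ, E) ∞ N) : φ.MDifferentiable 𝓘(ℝ, E) 𝓘(ℝ, E) :=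
  ⟨(contMDiffOn_of_mem_maximalAtlas h).mdifferentiableOn (by simp),
    (contMDiffOn_symm_of_mem_maximalAtlas h).mdifferentiableOn (by simp)⟩

lemma mfderiv_symm_mfderiv (h : φ ∈ IsManifold.maximalAtlas 𝓘(ℝ, E) ∞ N) {q : N}
    (hq : q ∈ φ.source) (v : TangentSpace 𝓘(ℝ, E) q) :
    (show E from mfderiv 𝓘(ℝ, E) 𝓘(ℝ, E) φ.symm (φ q) (mfderiv 𝓘(ℝ, E) 𝓘(ℝ, E) φ q v)) = v :=
  congrArg (fun L => L v)
    ((OpenPartialHomeomorph.mdifferentiable_of_mem_maximalAtlas h).symm_comp_deriv hq)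

lemma mfderiv_mfderiv_symm (h : φ ∈ IsManifold.maximalAtlas 𝓘(ℝ, E) ∞ N) {q : N}
    (hq : q ∈ φ.source) (v : E) :
    (show E from mfderiv 𝓘(ℝ, E) 𝓘(ℝ, E) φ q (mfderiv 𝓘(ℝ, E) 𝓘(ℝ, E) φ.symm (φ q) v)) = v := by
  have h1 := (OpenPartialHomeomorph.mdifferentiable_of_mem_maximalAtlas h).comp_symm_deriv
    (φ.map_source hq)
  have h2 := congrArg (fun L => L v) h1
  rw [φ.left_inv hq] at h2
  exact h2

/-- The fibre coordinates `w(q, v) = dφ_q v` on the tangent bundle. -/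
noncomputable def fiberCoord (φ : OpenPartialHomeomorph N E) (e : TangentBundle 𝓘(ℝ, E) N) : E :=
  mfderiv 𝓘(ℝ, E) 𝓘(ℝ, E) φ e.proj e.snd

/-- The coordinates `(φ(q), dφ_q v)` on the tangent bundle. -/
noncomputable def bundleCoord (φ : OpenPartialHomeomorph N E) (e : TangentBundle 𝓘(ℝ, E) N) :
    E × E :=
  (φ e.proj, fiberCoord φ e)

lemma contMDiffOn_fiberCoord (h : φ ∈ IsManifold.maximalAtlas 𝓘(ℝ, E) ∞ N) :
    ContMDiffOn 𝓘(ℝ, E).tangent 𝓘(ℝ, E) ∞ (fiberCoord φ)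
      (TotalSpace.proj ⁻¹' φ.source) := by
  have h1 := (contMDiffOn_of_mem_maximalAtlas h).contMDiffOn_tangentMapWithin (m := ∞)
    (by simp) φ.open_source.uniqueMDiffOn
  have h2 := (contMDiff_snd_tangentBundle_modelSpace E 𝓘(ℝ, E) (n := ∞)).comp_contMDiffOn h1
  refine h2.congr fun e he => ?_
  simp only [fiberCoord, Function.comp, tangentMapWithin]
  rw [mfderivWithin_of_isOpen φ.open_source he]

lemma contMDiffOn_chart_comp_proj (h : φ ∈ IsManifold.maximalAtlas 𝓘(ℝ, E) ∞ N) :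
    ContMDiffOn 𝓘(ℝ, E).tangent 𝓘(ℝ, E) ∞
      (fun e : TangentBundle 𝓘(ℝ, E) N => φ e.proj) (TotalSpace.proj ⁻¹' φ.source) :=
  (contMDiffOn_of_mem_maximalAtlas h).comp
    (contMDiff_proj (TangentSpace 𝓘(ℝ, E) : N → Type _)).contMDiffOn (fun _ he => he)

lemma contMDiffOn_bundleCoord (h : φ ∈ IsManifold.maximalAtlas 𝓘(ℝ, E) ∞ N) :
    ContMDiffOn 𝓘(ℝ, E).tangent 𝓘(ℝ, E × E) ∞ (bundleCoord φ)
      (TotalSpace.proj ⁻¹' φ.source) :=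
  (contMDiffOn_chart_comp_proj h).prodMk_space (contMDiffOn_fiberCoord h)

lemma isOpen_proj_preimage (φ : OpenPartialHomeomorph N E) :
    IsOpen ((TotalSpace.proj : TangentBundle 𝓘(ℝ, E) N → N) ⁻¹' φ.source) :=
  φ.open_source.preimage (FiberBundle.continuous_proj E (TangentSpace 𝓘(ℝ, E) : N → Type _))

/-- The inverse of `bundleCoord φ`. -/
noncomputable def bundleCoordSymm (φ : OpenPartialHomeomorph N E) (z : E × E) :
    TangentBundle 𝓘(ℝ, E) N :=
  ⟨φ.symm z.1, mfderiv 𝓘(ℝ, E) 𝓘(ℝ, E) φ.symm z.1 z.2⟩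

/-- Continuity of the inverse coordinates is enough: it serves only to show that images of compact
sets are compact in the tangent bundle. -/
lemma continuousOn_bundleCoordSymm (h : φ ∈ IsManifold.maximalAtlas 𝓘(ℝ, E) ∞ N) :
    ContinuousOn (bundleCoordSymm φ) (φ.target ×ˢ univ) := by
  have h1 := (contMDiffOn_symm_of_mem_maximalAtlas h).continuousOn_tangentMapWithin
    (by simp) φ.open_target.uniqueMDiffOn
  have h2 : Continuous ((tangentBundleModelSpaceHomeomorph 𝓘(ℝ, E)).symm) :=
    Homeomorph.continuous _
  have h3 : ContinuousOn (tangentMapWithin 𝓘(ℝ, E) 𝓘(ℝ, E) φ.symm φ.target ∘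
      (tangentBundleModelSpaceHomeomorph 𝓘(ℝ, E)).symm) (φ.target ×ˢ univ) :=
    h1.comp h2.continuousOn (fun z hz => hz.1)
  refine h3.congr fun z hz => ?_
  simp only [Function.comp, tangentMapWithin, bundleCoordSymm,
    tangentBundleModelSpaceHomeomorph_coe_symm, TotalSpace.toProd, Equiv.coe_fn_symm_mk]
  rw [mfderivWithin_of_isOpen φ.open_target hz.1]
  rfl

lemma bundleCoordSymm_bundleCoord (h : φ ∈ IsManifold.maximalAtlas 𝓘(ℝ, E) ∞ N)
    {e : TangentBundle 𝓘(ℝ, E) N} (he : e.proj ∈ φ.source) :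
    bundleCoordSymm φ (bundleCoord φ e) = e := by
  obtain ⟨q, v⟩ := e
  have := mfderiv_symm_mfderiv h he v
  simp only [bundleCoordSymm, bundleCoord, fiberCoord] at this ⊢
  -- The two base points are equal only propositionally, so the equality of pairs is proved for a
  -- variable base point and then specialised.
  have key : ∀ (q' : N) (v' : TangentSpace 𝓘(ℝ, E) q'), q' = q → (show E from v') = v →
      (⟨q', v'⟩ : TangentBundle 𝓘(ℝ, E) N) = ⟨q, v⟩ := by
    rintro q' v' rfl rfl
    rfl
  exact key _ _ (φ.left_inv he) this

/-- Points over different base points are separated in `N`, points of one fibre in a trivialization.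
The Hausdorff property makes compact sets closed, which controls the supports of functions extended
by zero. -/
instance tangentBundle_t2Space [T2Space N] : T2Space (TangentBundle 𝓘(ℝ, E) N) := by
  have hc : Continuous (TotalSpace.proj : TangentBundle 𝓘(ℝ, E) N → N) :=
    FiberBundle.continuous_proj E (TangentSpace 𝓘(ℝ, E) : N → Type _)
  refine ⟨fun e e' hne => ?_⟩
  by_cases hp : e.proj = e'.proj
  · set t := trivializationAt E (TangentSpace 𝓘(ℝ, E) : N → Type _) e.proj
    have he : e ∈ t.source := by
      rw [t.mem_source]
      exact FiberBundle.mem_baseSet_trivializationAt' _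
    have he' : e' ∈ t.source := by
      rw [t.mem_source, ← hp]
      exact FiberBundle.mem_baseSet_trivializationAt' _
    have hne' : t e ≠ t e' := fun h => hne (t.injOn he he' h)
    obtain ⟨U, V, hU, hV, h1, h2, h3⟩ := t2_separation hne'
    refine ⟨t.source ∩ t ⁻¹' U, t.source ∩ t ⁻¹' V, ?_, ?_, ⟨he, h1⟩, ⟨he', h2⟩, ?_⟩
    · exact t.continuousOn.isOpen_inter_preimage t.open_source hU
    · exact t.continuousOn.isOpen_inter_preimage t.open_source hV
    · exact (h3.preimage t).mono inter_subset_right inter_subset_right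
  · obtain ⟨U, V, hU, hV, h1, h2, h3⟩ := t2_separation hp
    exact ⟨_, _, hU.preimage hc, hV.preimage hc, h1, h2, h3.preimage _⟩

open Classical in
/-- The function `G ∘ φ`, extended by zero. -/
noncomputable def chartExtension {F : Type*} [Zero F] (φ : OpenPartialHomeomorph N E) (G : E → F)
    (q : N) : F :=
  if q ∈ φ.source then G (φ q) else 0

open Classical in
/-- The function `G(φ(q), dφ_q v)` on the tangent bundle, extended by zero. -/
noncomputable def bundleExtension {F : Type*} [Zero F] (φ : OpenPartialHomeomorph N E)
    (G : E × E → F) (e : TangentBundle 𝓘(ℝ, E) N) : F :=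
  if e.proj ∈ φ.source then G (bundleCoord φ e) else 0

/-! ### Extension by zero of functions supported in a chart. -/

section Extension

variable [T2Space N] {F : Type*} [NormedAddCommGroup F] [NormedSpace ℝ F]

lemma isCompact_symm_image {K : Set E} (hK : IsCompact K) (hs : K ⊆ φ.target) :
    IsCompact (φ.symm '' K) :=
  hK.image_of_continuousOn (φ.symm.continuousOn.mono hs)

lemma support_chartExtension_subset (G : E → F) :
    Function.support (chartExtension φ G) ⊆ φ.symm '' tsupport G := by
  intro q hq
  by_cases h : q ∈ φ.source
  · refine ⟨φ q, subset_tsupport G ?_, φ.left_inv h⟩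
    simpa [chartExtension, h] using hq
  · simp [chartExtension, h] at hq

lemma tsupport_chartExtension_subset {G : E → F} (hc : HasCompactSupport G)
    (hs : tsupport G ⊆ φ.target) :
    tsupport (chartExtension φ G) ⊆ φ.symm '' tsupport G :=
  closure_minimal (support_chartExtension_subset G) (isCompact_symm_image hc hs).isClosed

lemma hasCompactSupport_chartExtension {G : E → F} (hc : HasCompactSupport G)
    (hs : tsupport G ⊆ φ.target) : HasCompactSupport (chartExtension φ G) :=
  (isCompact_symm_image hc hs).of_isClosed_subset (isClosed_tsupport _)
    (tsupport_chartExtension_subset hc hs)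

/-- Smoothness has to be checked only at points of the closed support. These lie in the chart
domain, where the extension is locally `G ∘ φ`. -/
lemma contMDiff_chartExtension (h : φ ∈ IsManifold.maximalAtlas 𝓘(ℝ, E) ∞ N) {G : E → F}
    (hG : ContDiff ℝ 1 G) (hc : HasCompactSupport G) (hs : tsupport G ⊆ φ.target) :
    ContMDiff 𝓘(ℝ, E) 𝓘(ℝ, F) 1 (chartExtension φ G) := by
  refine contMDiff_of_tsupport fun q hq => ?_
  obtain ⟨y, hy, rfl⟩ := tsupport_chartExtension_subset hc hs hq
  have hq' := φ.map_target (hs hy)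
  have h1 : ContMDiffAt 𝓘(ℝ, E) 𝓘(ℝ, F) 1 (G ∘ φ) (φ.symm y) :=
    hG.contMDiff.contMDiffAt.comp _ ((contMDiffAt_of_mem_maximalAtlas h hq').of_le (by simp))
  refine h1.congr_of_eventuallyEq ?_
  filter_upwards [φ.open_source.mem_nhds hq'] with q hq
  simp [chartExtension, hq]

lemma mfderiv_chartExtension (h : φ ∈ IsManifold.maximalAtlas 𝓘(ℝ, E) ∞ N) {G : E → F}
    {q : N} (hq : q ∈ φ.source) (hG : DifferentiableAt ℝ G (φ q)) (v : TangentSpace 𝓘(ℝ, E) q) :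
    (show F from mfderiv 𝓘(ℝ, E) 𝓘(ℝ, F) (chartExtension φ G) q v)
      = fderiv ℝ G (φ q) (mfderiv 𝓘(ℝ, E) 𝓘(ℝ, E) φ q v) := by
  have e : chartExtension φ G =ᶠ[𝓝 q] G ∘ φ := by
    filter_upwards [φ.open_source.mem_nhds hq] with q hq
    simp [chartExtension, hq]
  have h1 : HasMFDerivAt 𝓘(ℝ, E) 𝓘(ℝ, F) (G ∘ φ) q
      ((fderiv ℝ G (φ q)).comp (mfderiv 𝓘(ℝ, E) 𝓘(ℝ, E) φ q)) :=
    hG.hasFDerivAt.hasMFDerivAt.comp q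
      ((OpenPartialHomeomorph.mdifferentiable_of_mem_maximalAtlas h).mdifferentiableAt
        hq).hasMFDerivAt
  rw [e.mfderiv_eq, h1.mfderiv]
  rfl

lemma isCompact_bundleCoordSymm_image (h : φ ∈ IsManifold.maximalAtlas 𝓘(ℝ, E) ∞ N)
    {K : Set (E × E)} (hK : IsCompact K) (hs : K ⊆ φ.target ×ˢ univ) :
    IsCompact (bundleCoordSymm φ '' K) :=
  hK.image_of_continuousOn ((continuousOn_bundleCoordSymm h).mono hs)

lemma tsupport_bundleExtension_subset (h : φ ∈ IsManifold.maximalAtlas 𝓘(ℝ, E) ∞ N)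
    {G : E × E → F} (hc : HasCompactSupport G) (hs : tsupport G ⊆ φ.target ×ˢ univ) :
    tsupport (bundleExtension φ G) ⊆ bundleCoordSymm φ '' tsupport G := by
  refine closure_minimal ?_ (isCompact_bundleCoordSymm_image h hc hs).isClosed
  intro e he
  by_cases hq : e.proj ∈ φ.source
  · refine ⟨bundleCoord φ e, subset_tsupport G ?_, bundleCoordSymm_bundleCoord h hq⟩
    simpa [bundleExtension, hq] using he
  · simp [bundleExtension, hq] at he

lemma hasCompactSupport_bundleExtension (h : φ ∈ IsManifold.maximalAtlas 𝓘(ℝ, E) ∞ N)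
    {G : E × E → F} (hc : HasCompactSupport G) (hs : tsupport G ⊆ φ.target ×ˢ univ) :
    HasCompactSupport (bundleExtension φ G) :=
  (isCompact_bundleCoordSymm_image h hc hs).of_isClosed_subset (isClosed_tsupport _)
    (tsupport_bundleExtension_subset h hc hs)

lemma contMDiff_bundleExtension (h : φ ∈ IsManifold.maximalAtlas 𝓘(ℝ, E) ∞ N) {G : E × E → F}
    (hG : ContDiff ℝ 1 G) (hc : HasCompactSupport G) (hs : tsupport G ⊆ φ.target ×ˢ univ) :
    ContMDiff 𝓘(ℝ, E).tangent 𝓘(ℝ, F) 1 (bundleExtension φ G) := by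
  refine contMDiff_of_tsupport fun e he => ?_
  obtain ⟨z, hz, rfl⟩ := tsupport_bundleExtension_subset h hc hs he
  have hq' : (bundleCoordSymm φ z).proj ∈ φ.source := φ.map_target (hs hz).1
  have h2 := (isOpen_proj_preimage φ).mem_nhds hq'
  have h1 : ContMDiffAt 𝓘(ℝ, E).tangent 𝓘(ℝ, F) 1 (G ∘ bundleCoord φ) (bundleCoordSymm φ z) :=
    hG.contMDiff.contMDiffAt.comp _
      (((contMDiffOn_bundleCoord h).contMDiffAt h2).of_le (by simp))
  refine h1.congr_of_eventuallyEq ?_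
  filter_upwards [h2] with e he
  have : e.proj ∈ φ.source := he
  simp [bundleExtension, this]

end Extension

/-! ### Horizontal and vertical coordinates of the double tangent bundle. -/

section Derivatives

/-- The horizontal coordinates `dφ(dπ ξ)` of `ξ ∈ TTN`. -/
noncomputable def baseVelocity (φ : OpenPartialHomeomorph N E) (e : TangentBundle 𝓘(ℝ, E) N) :
    TangentSpace 𝓘(ℝ, E).tangent e →L[ℝ] E :=
  (show TangentSpace 𝓘(ℝ, E) e.proj →L[ℝ] E from mfderiv 𝓘(ℝ, E) 𝓘(ℝ, E) φ e.proj).comp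
    (mfderiv 𝓘(ℝ, E).tangent 𝓘(ℝ, E) (fun e' : TangentBundle 𝓘(ℝ, E) N => e'.proj) e)

/-- The vertical coordinates of `ξ ∈ TTN`: the derivative of `fiberCoord φ`. -/
noncomputable def fiberVelocity (φ : OpenPartialHomeomorph N E) (e : TangentBundle 𝓘(ℝ, E) N) :
    TangentSpace 𝓘(ℝ, E).tangent e →L[ℝ] E :=
  mfderiv 𝓘(ℝ, E).tangent 𝓘(ℝ, E) (fiberCoord φ) e

lemma hasMFDerivAt_chart_comp_proj (h : φ ∈ IsManifold.maximalAtlas 𝓘(ℝ, E) ∞ N)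
    {e : TangentBundle 𝓘(ℝ, E) N} (he : e.proj ∈ φ.source) :
    HasMFDerivAt 𝓘(ℝ, E).tangent 𝓘(ℝ, E) (fun e' : TangentBundle 𝓘(ℝ, E) N => φ e'.proj) e
      (baseVelocity φ e) := by
  have h1 := ((OpenPartialHomeomorph.mdifferentiable_of_mem_maximalAtlas h).mdifferentiableAt
        he).hasMFDerivAt
  have h2 : MDifferentiableAt 𝓘(ℝ, E).tangent 𝓘(ℝ, E)
      (fun e' : TangentBundle 𝓘(ℝ, E) N => e'.proj) e :=
    (contMDiff_proj (n := ∞) (TangentSpace 𝓘(ℝ, E) : N → Type _)).mdifferentiableAt (by simp)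
  exact h1.comp e h2.hasMFDerivAt

lemma hasMFDerivAt_fiberCoord (h : φ ∈ IsManifold.maximalAtlas 𝓘(ℝ, E) ∞ N)
    {e : TangentBundle 𝓘(ℝ, E) N} (he : e.proj ∈ φ.source) :
    HasMFDerivAt 𝓘(ℝ, E).tangent 𝓘(ℝ, E) (fiberCoord φ) e (fiberVelocity φ e) :=
  (((contMDiffOn_fiberCoord h).contMDiffAt
    ((isOpen_proj_preimage φ).mem_nhds he)).mdifferentiableAt (by simp)).hasMFDerivAt

lemma hasMFDerivAt_bundleCoord (h : φ ∈ IsManifold.maximalAtlas 𝓘(ℝ, E) ∞ N)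
    {e : TangentBundle 𝓘(ℝ, E) N} (he : e.proj ∈ φ.source) :
    HasMFDerivAt 𝓘(ℝ, E).tangent 𝓘(ℝ, E × E) (bundleCoord φ) e
      ((baseVelocity φ e).prod (fiberVelocity φ e)) :=
  let h1 := hasMFDerivAt_chart_comp_proj h he
  let h2 := hasMFDerivAt_fiberCoord h he
  ⟨h1.1.prodMk h2.1, h1.2.prodMk h2.2⟩

lemma mfderiv_bundleExtension {F : Type*} [NormedAddCommGroup F] [NormedSpace ℝ F]
    (h : φ ∈ IsManifold.maximalAtlas 𝓘(ℝ, E) ∞ N) {G : E × E → F}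
    {e : TangentBundle 𝓘(ℝ, E) N} (he : e.proj ∈ φ.source)
    (hG : DifferentiableAt ℝ G (bundleCoord φ e)) (ξ : TangentSpace 𝓘(ℝ, E).tangent e) :
    (show F from mfderiv 𝓘(ℝ, E).tangent 𝓘(ℝ, F) (bundleExtension φ G) e ξ)
      = fderiv ℝ G (bundleCoord φ e) (baseVelocity φ e ξ, fiberVelocity φ e ξ) := by
  have e' : bundleExtension φ G =ᶠ[𝓝 e] G ∘ bundleCoord φ := by
    filter_upwards [(isOpen_proj_preimage φ).mem_nhds he] with e he
    have : e.proj ∈ φ.source := he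
    simp [bundleExtension, this]
  have h1 := hG.hasFDerivAt.hasMFDerivAt.comp e (hasMFDerivAt_bundleCoord h he)
  rw [e'.mfderiv_eq, h1.mfderiv]
  rfl

end Derivatives

/-! ### Change of charts -/

section Change

variable (hφ : φ ∈ IsManifold.maximalAtlas 𝓘(ℝ, E) ∞ N)
  (hψ : ψ ∈ IsManifold.maximalAtlas 𝓘(ℝ, E) ∞ N)

include hφ hψ

lemma contDiffAt_transition {q : N} (hq : q ∈ φ.source) (hq' : q ∈ ψ.source) :
    ContDiffAt ℝ ∞ (φ ∘ ψ.symm) (ψ q) := by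
  rw [← contMDiffAt_iff_contDiffAt]
  have h1 := contMDiffAt_symm_of_mem_maximalAtlas hψ (ψ.map_source hq')
  have h2 : ContMDiffAt 𝓘(ℝ, E) 𝓘(ℝ, E) ∞ φ (ψ.symm (ψ q)) := by
    rw [ψ.left_inv hq']
    exact contMDiffAt_of_mem_maximalAtlas hφ hq
  exact h2.comp _ h1

lemma mfderiv_chart_eq_transition {q : N} (hq : q ∈ φ.source) (hq' : q ∈ ψ.source)
    (v : TangentSpace 𝓘(ℝ, E) q) :
    (show E from mfderiv 𝓘(ℝ, E) 𝓘(ℝ, E) φ q v) =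
      fderiv ℝ (φ ∘ ψ.symm) (ψ q) (mfderiv 𝓘(ℝ, E) 𝓘(ℝ, E) ψ q v) := by
  have e : (φ : N → E) =ᶠ[𝓝 q] (φ ∘ ψ.symm) ∘ ψ := by
    filter_upwards [ψ.open_source.mem_nhds hq'] with q hq
    simp [ψ.left_inv hq]
  have h1 := ((contDiffAt_transition hφ hψ hq hq').differentiableAt
    (by simp)).hasFDerivAt.hasMFDerivAt.comp q
      ((OpenPartialHomeomorph.mdifferentiable_of_mem_maximalAtlas hψ).mdifferentiableAt
        hq').hasMFDerivAt
  rw [e.mfderiv_eq, h1.mfderiv]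
  rfl

lemma mfderiv_symm_eq_transition {q : N} (hq : q ∈ φ.source) (hq' : q ∈ ψ.source) (v : E) :
    (show E from mfderiv 𝓘(ℝ, E) 𝓘(ℝ, E) φ.symm (φ q) (fderiv ℝ (φ ∘ ψ.symm) (ψ q) v)) =
      (show E from mfderiv 𝓘(ℝ, E) 𝓘(ℝ, E) ψ.symm (ψ q) v) := by
  have h1 := mfderiv_chart_eq_transition hφ hψ hq hq'
    (mfderiv 𝓘(ℝ, E) 𝓘(ℝ, E) ψ.symm (ψ q) v)
  have h2 := mfderiv_mfderiv_symm hψ hq' v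
  have h3 := mfderiv_symm_mfderiv hφ hq (mfderiv 𝓘(ℝ, E) 𝓘(ℝ, E) ψ.symm (ψ q) v)
  simp only at h1 h2 h3 ⊢
  rw [h2] at h1
  rw [← h1]
  exact h3

lemma baseVelocity_change {e : TangentBundle 𝓘(ℝ, E) N} (he : e.proj ∈ φ.source)
    (he' : e.proj ∈ ψ.source) (ξ : TangentSpace 𝓘(ℝ, E).tangent e) :
    baseVelocity φ e ξ = fderiv ℝ (φ ∘ ψ.symm) (ψ e.proj) (baseVelocity ψ e ξ) :=
  mfderiv_chart_eq_transition hφ hψ he he' _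

lemma fiberCoord_change {e : TangentBundle 𝓘(ℝ, E) N} (he : e.proj ∈ φ.source)
    (he' : e.proj ∈ ψ.source) :
    fiberCoord φ e = fderiv ℝ (φ ∘ ψ.symm) (ψ e.proj) (fiberCoord ψ e) :=
  mfderiv_chart_eq_transition hφ hψ he he' _

/-- Product rule for `w_φ = Dτ(y) w_ψ`, with `τ` the transition map. The second derivative of `τ` is
the defect that the Christoffel symbols compensate. -/
lemma fiberVelocity_change {e : TangentBundle 𝓘(ℝ, E) N} (he : e.proj ∈ φ.source)
    (he' : e.proj ∈ ψ.source) (ξ : TangentSpace 𝓘(ℝ, E).tangent e) :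
    fiberVelocity φ e ξ =
      fderiv ℝ (fderiv ℝ (φ ∘ ψ.symm)) (ψ e.proj) (baseVelocity ψ e ξ) (fiberCoord ψ e)
        + fderiv ℝ (φ ∘ ψ.symm) (ψ e.proj) (fiberVelocity ψ e ξ) := by
  set τ := φ ∘ ψ.symm with hτ
  have e1 : fiberCoord φ =ᶠ[𝓝 e] (fun z : E × E => fderiv ℝ τ z.1 z.2) ∘ bundleCoord ψ := by
    filter_upwards [(isOpen_proj_preimage φ).mem_nhds he, (isOpen_proj_preimage ψ).mem_nhds he']
      with e he he'
    exact fiberCoord_change hφ hψ he he'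
  have hd : DifferentiableAt ℝ (fderiv ℝ τ) (ψ e.proj) :=
    ((contDiffAt_transition hφ hψ he he').fderiv_right (m := 1) (by norm_cast)).differentiableAt
      one_ne_zero
  have h1 : HasFDerivAt (fun z : E × E => fderiv ℝ τ z.1 z.2) _ (bundleCoord ψ e) :=
    (HasFDerivAt.comp (bundleCoord ψ e) (g := fderiv ℝ τ) (f := Prod.fst) hd.hasFDerivAt
      hasFDerivAt_fst).clm_apply hasFDerivAt_snd
  have h2 := h1.hasMFDerivAt.comp e (hasMFDerivAt_bundleCoord hψ he')
  rw [fiberVelocity, e1.mfderiv_eq, h2.mfderiv, add_comm]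
  rfl

end Change

end Charts

/-! ## The metric and the connector in a chart -/

section GramForm

variable {E F ι : Type*} [NormedAddCommGroup E] [NormedSpace ℝ E] [NormedAddCommGroup F]
  [NormedSpace ℝ F] [Fintype ι]

/-- The linear combination of the vectors `L i j` with coefficients `G i j`. -/
noncomputable def doubleCombination (L : ι → ι → F) (G : ι → ι → ℝ) : F := ∑ i, ∑ j, G i j • L i j

lemma differentiableAt_doubleCombination (L : ι → ι → F) {G : E → ι → ι → ℝ} {y : E}
    (h : ∀ i j, DifferentiableAt ℝ (fun z => G z i j) y) :
    DifferentiableAt ℝ (fun z => doubleCombination L (G z)) y :=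
  DifferentiableAt.fun_sum fun i _ => DifferentiableAt.fun_sum fun j _ => (h i j).smul_const _

/-- The bilinear form with coefficients `G` with respect to the linear forms `l`. -/
noncomputable def gramForm (l : ι → E →L[ℝ] ℝ) (G : ι → ι → ℝ) : E →L[ℝ] E →L[ℝ] ℝ :=
  doubleCombination (fun i j => (l i).smulRight (l j)) G

lemma gramForm_apply (l : ι → E →L[ℝ] ℝ) (G : ι → ι → ℝ) (v w : E) :
    gramForm l G v w = ∑ i, ∑ j, G i j * (l i v * l j w) := by
  simp [gramForm, doubleCombination, sum_apply]

lemma differentiableAt_gramForm (l : ι → E →L[ℝ] ℝ) {G : E → ι → ι → ℝ} {y : E}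
    (h : ∀ i j, DifferentiableAt ℝ (fun z => G z i j) y) :
    DifferentiableAt ℝ (fun z => gramForm l (G z)) y :=
  differentiableAt_doubleCombination (F := E →L[ℝ] E →L[ℝ] ℝ) _ h

end GramForm

/-- The derivative of the pullback of a field of bilinear forms. -/
lemma fderiv_pullback_form {E : Type*} [NormedAddCommGroup E] [NormedSpace ℝ E]
    {A B : E → E →L[ℝ] E →L[ℝ] ℝ} {τ : E → E} {y : E} (hτ : ContDiffAt ℝ ∞ τ y)
    (hB : DifferentiableAt ℝ B (τ y)) (hA : DifferentiableAt ℝ A y)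
    (h : ∀ a b, (fun z => A z a b) =ᶠ[𝓝 y] fun z => B (τ z) (fderiv ℝ τ z a) (fderiv ℝ τ z b))
    (v a b : E) :
    fderiv ℝ A y v a b = fderiv ℝ B (τ y) (fderiv ℝ τ y v) (fderiv ℝ τ y a) (fderiv ℝ τ y b)
      + B (τ y) (fderiv ℝ (fderiv ℝ τ) y v a) (fderiv ℝ τ y b)
      + B (τ y) (fderiv ℝ τ y a) (fderiv ℝ (fderiv ℝ τ) y v b) := by
  have hτ1 : HasFDerivAt τ (fderiv ℝ τ y) y := (hτ.differentiableAt (by simp)).hasFDerivAt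
  have hτ2 : HasFDerivAt (fderiv ℝ τ) (fderiv ℝ (fderiv ℝ τ) y) y :=
    ((hτ.fderiv_right (m := 1) (by norm_cast)).differentiableAt one_ne_zero).hasFDerivAt
  have h1 := (hA.hasFDerivAt.clm_apply (hasFDerivAt_const a y)).clm_apply (hasFDerivAt_const b y)
  have hBτ : HasFDerivAt (fun z => B (τ z)) _ y := 
    HasFDerivAt.comp (g := B) (f := τ) y hB.hasFDerivAt hτ1
  have ha : HasFDerivAt (fun z => fderiv ℝ τ z a) _ y := hτ2.clm_apply (hasFDerivAt_const a y)
  have hb : HasFDerivAt (fun z => fderiv ℝ τ z b) _ y := hτ2.clm_apply (hasFDerivAt_const b y)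
  have hBa : HasFDerivAt (fun z => B (τ z) (fderiv ℝ τ z a)) _ y := hBτ.clm_apply ha
  have h2 : HasFDerivAt (fun z => B (τ z) (fderiv ℝ τ z a) (fderiv ℝ τ z b)) _ y :=
    hBa.clm_apply hb
  -- Both sides are derivatives of the same germ at `y`, so uniqueness of the derivative gives the
  -- Leibniz formula.
  have h3 := congrArg (fun L => L v) ((h1.congr_of_eventuallyEq (h a b).symm).unique h2)
  simp at h3
  rw [h3]
  ring

section Metric

variable {d : ℕ} {N : Type u} [TopologicalSpace N]
  [ChartedSpace (EuclideanSpace ℝ (Fin (d + 1))) N] [IsManifold (𝓡 (d + 1)) ∞ N]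
  [RiemannianBundle (fun q : N => TangentSpace (𝓡 (d + 1)) q)]
  {φ ψ : OpenPartialHomeomorph N (EuclideanSpace ℝ (Fin (d + 1)))}

/-- All tangent spaces are the model space as types, but their inner products depend on the base
point; an equality of base points therefore has to be substituted. -/
lemma inner_tangentSpace_congr {q q' : N} (h : q' = q) (v w : EuclideanSpace ℝ (Fin (d + 1))) :
    (inner ℝ (show TangentSpace (𝓡 (d + 1)) q' from v) (show TangentSpace (𝓡 (d + 1)) q' from w) : ℝ)
      = inner ℝ (show TangentSpace (𝓡 (d + 1)) q from v)
          (show TangentSpace (𝓡 (d + 1)) q from w) := by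
  subst h
  rfl

lemma chartMetric_eq {q : N} (hq : q ∈ φ.source) (v w : EuclideanSpace ℝ (Fin (d + 1))) :
    chartMetric φ (φ q) v w = inner ℝ
      (show TangentSpace (𝓡 (d + 1)) q from
        mfderiv 𝓘(ℝ, EuclideanSpace ℝ (Fin (d + 1))) (𝓡 (d + 1)) φ.symm (φ q) v)
      (show TangentSpace (𝓡 (d + 1)) q from
        mfderiv 𝓘(ℝ, EuclideanSpace ℝ (Fin (d + 1))) (𝓡 (d + 1)) φ.symm (φ q) w) :=
  inner_tangentSpace_congr (φ.left_inv hq) _ _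

lemma chartMetric_comm (y v w : EuclideanSpace ℝ (Fin (d + 1))) :
    chartMetric φ y v w = chartMetric φ y w v :=
  real_inner_comm _ _

lemma chartMetric_self_mfderiv (h : φ ∈ IsManifold.maximalAtlas (𝓡 (d + 1)) ∞ N) {q : N}
    (hq : q ∈ φ.source) (v : TangentSpace (𝓡 (d + 1)) q) :
    chartMetric φ (φ q) (mfderiv (𝓡 (d + 1)) 𝓘(ℝ, EuclideanSpace ℝ (Fin (d + 1))) φ q v)
      (mfderiv (𝓡 (d + 1)) 𝓘(ℝ, EuclideanSpace ℝ (Fin (d + 1))) φ q v) = ‖v‖ ^ 2 := by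
  have := mfderiv_symm_mfderiv h hq v
  simp only at this
  refine (chartMetric_eq hq _ _).trans ?_
  rw [this, ← real_inner_self_eq_norm_sq]

/-- The pushed forward metric as a continuous bilinear form. -/
noncomputable def chartForm (φ : OpenPartialHomeomorph N (EuclideanSpace ℝ (Fin (d + 1))))
    (y : EuclideanSpace ℝ (Fin (d + 1))) :
    EuclideanSpace ℝ (Fin (d + 1)) →L[ℝ] EuclideanSpace ℝ (Fin (d + 1)) →L[ℝ] ℝ :=
  gramForm (fun i => EuclideanSpace.proj i) (chartGram φ y)

lemma chartForm_eq_sum (y v w : EuclideanSpace ℝ (Fin (d + 1))) :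
    chartForm φ y v w = ∑ i, ∑ j, chartGram φ y i j * (v i * w j) :=
  gramForm_apply _ _ _ _

lemma sum_smul_single (v : EuclideanSpace ℝ (Fin (d + 1))) :
    v = ∑ i, v i • EuclideanSpace.single i (1 : ℝ) := by
  ext k
  simp [Finset.sum_apply, Pi.single_apply]

lemma chartForm_apply (y v w : EuclideanSpace ℝ (Fin (d + 1))) :
    chartForm φ y v w = chartMetric φ y v w := by
  have e : chartMetric φ y v w = ∑ i, ∑ j, v i * (w j * chartGram φ y i j) := by
    let L : EuclideanSpace ℝ (Fin (d + 1)) →L[ℝ] TangentSpace (𝓡 (d + 1)) (φ.symm y) :=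
      mfderiv 𝓘(ℝ, EuclideanSpace ℝ (Fin (d + 1))) (𝓡 (d + 1)) φ.symm y
    change inner ℝ (L v) (L w) = ∑ i, ∑ j, v i * (w j *
      inner ℝ (L (EuclideanSpace.single i 1)) (L (EuclideanSpace.single j 1)))
    conv_lhs => rw [sum_smul_single v, sum_smul_single w]
    simp only [map_sum, map_smul, sum_inner, inner_sum, real_inner_smul_left,
      real_inner_smul_right]
    rw [Finset.sum_comm]
    exact Finset.sum_congr rfl fun i _ => Finset.sum_congr rfl fun j _ => by ring
  rw [e, chartForm_eq_sum]
  refine Finset.sum_congr rfl fun i _ => Finset.sum_congr rfl fun j _ => ?_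
  ring

lemma chartMetric_eq_transition (hφ : φ ∈ IsManifold.maximalAtlas (𝓡 (d + 1)) ∞ N)
    (hψ : ψ ∈ IsManifold.maximalAtlas (𝓡 (d + 1)) ∞ N) {q : N} (hq : q ∈ φ.source)
    (hq' : q ∈ ψ.source) (a b : EuclideanSpace ℝ (Fin (d + 1))) :
    chartMetric ψ (ψ q) a b = chartMetric φ (φ q) (fderiv ℝ (φ ∘ ψ.symm) (ψ q) a)
      (fderiv ℝ (φ ∘ ψ.symm) (ψ q) b) := by
  rw [chartMetric_eq hq, chartMetric_eq hq']
  have h1 := mfderiv_symm_eq_transition hφ hψ hq hq' a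
  have h2 := mfderiv_symm_eq_transition hφ hψ hq hq' b
  simp only at h1 h2
  rw [h1, h2]

lemma eq_zero_of_chartMetric_self (h : φ ∈ IsManifold.maximalAtlas (𝓡 (d + 1)) ∞ N)
    {y : EuclideanSpace ℝ (Fin (d + 1))} (hy : y ∈ φ.target) {v : EuclideanSpace ℝ (Fin (d + 1))}
    (hv : chartMetric φ y v v = 0) : v = 0 := by
  obtain ⟨q, hq, rfl⟩ : ∃ q ∈ φ.source, φ q = y := ⟨φ.symm y, φ.map_target hy, φ.right_inv hy⟩
  rw [chartMetric_eq hq, inner_self_eq_zero] at hv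
  have := mfderiv_mfderiv_symm h hq v
  simp only at this hv
  rw [← this, hv]
  exact map_zero _

/-- A vector in the kernel of the Gram matrix would have length zero, hence vanish. -/
lemma chartGram_mul_inv (h : φ ∈ IsManifold.maximalAtlas (𝓡 (d + 1)) ∞ N)
    {y : EuclideanSpace ℝ (Fin (d + 1))} (hy : y ∈ φ.target) :
    chartGram φ y * (chartGram φ y)⁻¹ = 1 := by
  apply Matrix.mul_nonsing_inv
  rw [isUnit_iff_ne_zero]
  intro h0
  obtain ⟨v, hv, hv0⟩ := Matrix.exists_mulVec_eq_zero_iff.2 h0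
  apply hv
  have h1 : chartMetric φ y (WithLp.toLp 2 v) (WithLp.toLp 2 v) = 0 := by
    rw [← chartForm_apply]
    simp only [chartForm_eq_sum]
    have : ∀ i, ∑ j, chartGram φ y i j * (v i * v j) = v i * (Matrix.mulVec (chartGram φ y) v) i := by
      intro i
      simp only [Matrix.mulVec, dotProduct, Finset.mul_sum]
      exact Finset.sum_congr rfl fun j _ => by ring
    simp [this, hv0]
  have := eq_zero_of_chartMetric_self h hy h1
  simpa using congrArg (WithLp.ofLp) this

/-! ### Differentiability of the metric coefficients, the Koszul formula and chart independence of
the connector. -/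

section Smooth

variable [IsContMDiffRiemannianBundle (𝓡 (d + 1)) ∞ (EuclideanSpace ℝ (Fin (d + 1)))
        (fun q : N => TangentSpace (𝓡 (d + 1)) q)]

/-- The tangent map of `φ.symm` carries a constant field to a smooth section over the chart, and the
metric is smooth on pairs of smooth sections. -/
lemma differentiableAt_chartMetric (h : φ ∈ IsManifold.maximalAtlas (𝓡 (d + 1)) ∞ N)
    {y : EuclideanSpace ℝ (Fin (d + 1))} (hy : y ∈ φ.target)
    (a b : EuclideanSpace ℝ (Fin (d + 1))) :
    DifferentiableAt ℝ (fun z => chartMetric φ z a b) y := by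
  have key : ∀ a : EuclideanSpace ℝ (Fin (d + 1)),
      ContMDiffOn 𝓘(ℝ, EuclideanSpace ℝ (Fin (d + 1))) (𝓡 (d + 1)).tangent ∞
        (fun z => (⟨φ.symm z, mfderiv 𝓘(ℝ, EuclideanSpace ℝ (Fin (d + 1))) (𝓡 (d + 1)) φ.symm z a⟩ :
          TangentBundle (𝓡 (d + 1)) N)) φ.target := by
    intro a
    have h1 := (contMDiffOn_symm_of_mem_maximalAtlas h).contMDiffOn_tangentMapWithin (m := ∞)
      (by simp) φ.open_target.uniqueMDiffOn
    have h2 : ContMDiffOn 𝓘(ℝ, EuclideanSpace ℝ (Fin (d + 1)))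
        𝓘(ℝ, EuclideanSpace ℝ (Fin (d + 1))).tangent ∞
        (fun z => (⟨z, a⟩ : TangentBundle 𝓘(ℝ, EuclideanSpace ℝ (Fin (d + 1)))
          (EuclideanSpace ℝ (Fin (d + 1))))) φ.target := by
      intro z _
      exact contMDiffWithinAt_vectorSpace_iff_contDiffWithinAt.2 contDiffWithinAt_const
    refine (h1.comp h2 (fun z hz => hz)).congr fun z hz => ?_
    simp only [Function.comp, tangentMapWithin]
    rw [mfderivWithin_of_isOpen φ.open_target hz]
  have h3 := (key a).inner_bundle (key b) (n := ∞)
    (E := (fun q : N => TangentSpace (𝓡 (d + 1)) q))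
  have h4 := (h3.contMDiffAt (φ.open_target.mem_nhds hy)).contDiffAt
  exact h4.differentiableAt (by simp)

lemma differentiableAt_chartForm (h : φ ∈ IsManifold.maximalAtlas (𝓡 (d + 1)) ∞ N)
    {y : EuclideanSpace ℝ (Fin (d + 1))} (hy : y ∈ φ.target) :
    DifferentiableAt ℝ (chartForm φ) y := by
  have : ∀ i j, DifferentiableAt ℝ (fun z => chartGram φ z i j) y := fun i j =>
    differentiableAt_chartMetric h hy _ _
  exact differentiableAt_gramForm _ this

lemma fderiv_chartForm_apply (h : φ ∈ IsManifold.maximalAtlas (𝓡 (d + 1)) ∞ N)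
    {y : EuclideanSpace ℝ (Fin (d + 1))} (hy : y ∈ φ.target)
    (v a b : EuclideanSpace ℝ (Fin (d + 1))) :
    fderiv ℝ (chartForm φ) y v a b
      = ∑ i, ∑ j, ∑ l, v i * (a j * (b l * chartGramDeriv φ y i j l)) := by
  have h1 : ∀ i j l, fderiv ℝ (chartForm φ) y (EuclideanSpace.single i 1)
      (EuclideanSpace.single j 1) (EuclideanSpace.single l 1) = chartGramDeriv φ y i j l := by
    intro i j l
    have h2 := ((differentiableAt_chartForm h hy).hasFDerivAt.clm_apply
      (hasFDerivAt_const (EuclideanSpace.single j (1 : ℝ)) y)).clm_apply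
      (hasFDerivAt_const (EuclideanSpace.single l (1 : ℝ)) y)
    have h3 : (fun z => chartGram φ z j l) = fun z => chartForm φ z
        (EuclideanSpace.single j (1 : ℝ)) (EuclideanSpace.single l (1 : ℝ)) := by
      ext z
      rw [chartForm_apply]
      rfl
    rw [chartGramDeriv, h3, h2.fderiv]
    simp
  conv_lhs => rw [sum_smul_single v, sum_smul_single a, sum_smul_single b]
  simp only [map_sum, map_smul, sum_apply, smul_apply, smul_eq_mul,
    Finset.mul_sum, h1]
  rw [Finset.sum_comm]
  have : ∀ j, ∑ l, ∑ i, b l * (a j * (v i * chartGramDeriv φ y i j l))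
      = ∑ i, ∑ l, v i * (a j * (b l * chartGramDeriv φ y i j l)) := by
    intro j
    rw [Finset.sum_comm]
    exact Finset.sum_congr rfl fun i _ => Finset.sum_congr rfl fun l _ => by ring
  simp only [this]
  exact Finset.sum_comm

/-- The bilinear map `Γ(Y, w)^k = ∑ Γ_{ij}^k Y_i w_j` given by the Christoffel symbols. -/
noncomputable def christoffelForm (φ : OpenPartialHomeomorph N (EuclideanSpace ℝ (Fin (d + 1))))
    (y Y w : EuclideanSpace ℝ (Fin (d + 1))) : EuclideanSpace ℝ (Fin (d + 1)) :=
  WithLp.toLp 2 fun k => ∑ i, ∑ j, w j * Y i * christoffel φ y i j k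

/-- The Koszul formula in a chart. -/
lemma chartForm_christoffelForm (h : φ ∈ IsManifold.maximalAtlas (𝓡 (d + 1)) ∞ N)
    {y : EuclideanSpace ℝ (Fin (d + 1))} (hy : y ∈ φ.target)
    (Y w Z : EuclideanSpace ℝ (Fin (d + 1))) :
    chartForm φ y (christoffelForm φ y Y w) Z = (1 / 2) *
      (fderiv ℝ (chartForm φ) y Y w Z + fderiv ℝ (chartForm φ) y w Y Z
        - fderiv ℝ (chartForm φ) y Z Y w) := by
  have hsym : ∀ k m, chartGram φ y k m = chartGram φ y m k := fun k m => chartMetric_comm _ _ _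
  -- Lowering the upper index of the Christoffel symbol cancels the inverse Gram matrix; what
  -- remains after this is a reordering of sums.
  have hΓ : ∀ i j m, ∑ k, chartGram φ y m k * christoffel φ y i j k = (1 / 2) *
      (chartGramDeriv φ y i j m + chartGramDeriv φ y j i m - chartGramDeriv φ y m i j) := by
    intro i j m
    set D : Fin (d + 1) → ℝ := fun l =>
      chartGramDeriv φ y i j l + chartGramDeriv φ y j i l - chartGramDeriv φ y l i j
    have e1 : ∀ k, christoffel φ y i j k
        = (1 / 2) * (Matrix.mulVec (chartGram φ y)⁻¹ D) k := fun k => rfl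
    have e2 : ∑ k, chartGram φ y m k * christoffel φ y i j k
        = (1 / 2) * (Matrix.mulVec (chartGram φ y) (Matrix.mulVec (chartGram φ y)⁻¹ D)) m := by
      simp only [e1]
      rw [Matrix.mulVec, dotProduct, Finset.mul_sum]
      exact Finset.sum_congr rfl fun k _ => by ring
    rw [e2, Matrix.mulVec_mulVec, chartGram_mul_inv h hy, Matrix.one_mulVec]
  have e0 : chartForm φ y (christoffelForm φ y Y w) Z = ∑ i, ∑ j, ∑ m, Y i * (w j * (Z m *
      ∑ k, chartGram φ y m k * christoffel φ y i j k)) := by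
    simp only [chartForm_eq_sum,
      christoffelForm, Finset.mul_sum, Finset.sum_mul]
    rw [Finset.sum_comm]
    have : ∀ m k, ∑ i, ∑ j, chartGram φ y k m * (w j * Y i * christoffel φ y i j k * Z m)
        = ∑ i, ∑ j, Y i * (w j * (Z m * (chartGram φ y m k * christoffel φ y i j k))) := by
      intro m k
      rw [hsym k m]
      exact Finset.sum_congr rfl fun i _ => Finset.sum_congr rfl fun j _ => by ring
    simp only [this]
    have h2 : ∀ m, ∑ k, ∑ i, ∑ j, Y i * (w j * (Z m * (chartGram φ y m k * christoffel φ y i j k)))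
        = ∑ i, ∑ j, ∑ k, Y i * (w j * (Z m * (chartGram φ y m k * christoffel φ y i j k))) := by
      intro m
      rw [Finset.sum_comm]
      exact Finset.sum_congr rfl fun i _ => Finset.sum_comm
    simp only [h2]
    rw [Finset.sum_comm]
    exact Finset.sum_congr rfl fun i _ => Finset.sum_comm
  rw [e0]
  simp only [hΓ]
  rw [fderiv_chartForm_apply h hy, fderiv_chartForm_apply h hy w, fderiv_chartForm_apply h hy Z]
  rw [Finset.sum_comm (f := fun i j => ∑ l, w i * (Y j * (Z l * chartGramDeriv φ y i j l)))]
  have e3 : ∑ i, ∑ j, ∑ l, Z i * (Y j * (w l * chartGramDeriv φ y i j l))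
      = ∑ i, ∑ j, ∑ l, Z l * (Y i * (w j * chartGramDeriv φ y l i j)) := by
    rw [Finset.sum_comm]
    exact Finset.sum_congr rfl fun i _ => Finset.sum_comm
  rw [e3, ← Finset.sum_add_distrib, ← Finset.sum_sub_distrib, Finset.mul_sum]
  refine Finset.sum_congr rfl fun i _ => ?_
  rw [← Finset.sum_add_distrib, ← Finset.sum_sub_distrib, Finset.mul_sum]
  refine Finset.sum_congr rfl fun j _ => ?_
  rw [← Finset.sum_add_distrib, ← Finset.sum_sub_distrib, Finset.mul_sum]
  refine Finset.sum_congr rfl fun m _ => ?_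
  ring

lemma chartForm_comm (y v w : EuclideanSpace ℝ (Fin (d + 1))) :
    chartForm φ y v w = chartForm φ y w v := by
  rw [chartForm_apply, chartForm_apply, chartMetric_comm]

/-- The transformation law of the Christoffel symbols. -/
lemma christoffelForm_transition (hφ : φ ∈ IsManifold.maximalAtlas (𝓡 (d + 1)) ∞ N)
    (hψ : ψ ∈ IsManifold.maximalAtlas (𝓡 (d + 1)) ∞ N) {q : N} (hq : q ∈ φ.source)
    (hq' : q ∈ ψ.source) (Y w : EuclideanSpace ℝ (Fin (d + 1))) :
    fderiv ℝ (fderiv ℝ (φ ∘ ψ.symm)) (ψ q) Y w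
      + christoffelForm φ (φ q) (fderiv ℝ (φ ∘ ψ.symm) (ψ q) Y) (fderiv ℝ (φ ∘ ψ.symm) (ψ q) w)
      = fderiv ℝ (φ ∘ ψ.symm) (ψ q) (christoffelForm ψ (ψ q) Y w) := by
  set τ := φ ∘ ψ.symm with hτ
  have hτq : τ (ψ q) = φ q := by simp [hτ, ψ.left_inv hq']
  have hcd : ContDiffAt ℝ ∞ τ (ψ q) := contDiffAt_transition hφ hψ hq hq'
  have hsymm : ∀ a b, fderiv ℝ (fderiv ℝ τ) (ψ q) a b = fderiv ℝ (fderiv ℝ τ) (ψ q) b a := by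
    intro a b
    exact (hcd.isSymmSndFDerivAt (by rw [minSmoothness_of_isRCLikeNormedField]; norm_cast)).eq a b
  have hform : ∀ a b, (fun z => chartForm ψ z a b) =ᶠ[𝓝 (ψ q)]
      fun z => chartForm φ (τ z) (fderiv ℝ τ z a) (fderiv ℝ τ z b) := by
    intro a b
    have : ψ.target ∩ ψ.symm ⁻¹' φ.source ∈ 𝓝 (ψ q) :=
      (ψ.symm.isOpen_inter_preimage φ.open_source).mem_nhds
        ⟨ψ.map_source hq', by simpa [ψ.left_inv hq'] using hq⟩
    filter_upwards [this] with z hz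
    have := chartMetric_eq_transition hφ hψ hz.2 (ψ.map_target hz.1) a b
    rw [ψ.right_inv hz.1] at this
    rw [chartForm_apply, chartForm_apply, this]
    rfl
  -- The metric in `ψ` is the pullback by `τ` of the metric in `φ`; differentiating this identity
  -- produces two terms with `D²τ`.
  have hder : ∀ v a b, fderiv ℝ (chartForm ψ) (ψ q) v a b =
      fderiv ℝ (chartForm φ) (φ q) (fderiv ℝ τ (ψ q) v) (fderiv ℝ τ (ψ q) a) (fderiv ℝ τ (ψ q) b)
      + chartForm φ (φ q) (fderiv ℝ (fderiv ℝ τ) (ψ q) v a) (fderiv ℝ τ (ψ q) b)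
      + chartForm φ (φ q) (fderiv ℝ τ (ψ q) a) (fderiv ℝ (fderiv ℝ τ) (ψ q) v b) := by
    intro v a b
    rw [← hτq]
    exact fderiv_pullback_form hcd (hτq ▸ differentiableAt_chartForm hφ (φ.map_source hq))
      (differentiableAt_chartForm hψ (ψ.map_source hq')) hform v a b
  set L := fderiv ℝ τ (ψ q) with hL
  set B := fderiv ℝ (fderiv ℝ τ) (ψ q) with hBdef
  have hsurj : ∀ x, ∃ Z, L Z = x := by
    intro x
    have h1 := mfderiv_chart_eq_transition hφ hψ hq hq'
      (mfderiv 𝓘(ℝ, EuclideanSpace ℝ (Fin (d + 1))) (𝓡 (d + 1)) φ.symm (φ q) x)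
    have h2 := mfderiv_mfderiv_symm hφ hq x
    exact ⟨_, h1.symm.trans h2⟩
  -- Insert `hder` into the Koszul formula for `ψ`. By symmetry of `D²τ` and of the metric, four of
  -- the six second-order terms cancel, and the other two add up to twice the pairing of `D²τ(Y, w)`
  -- with `L Z`. As `L` is onto, `Z` can then be chosen so that the vector is paired with itself.
  have hmain : ∀ Z, chartForm φ (φ q) (B Y w + christoffelForm φ (φ q) (L Y) (L w)
      - L (christoffelForm ψ (ψ q) Y w)) (L Z) = 0 := by
    intro Z
    have h1 : chartForm φ (φ q) (L (christoffelForm ψ (ψ q) Y w)) (L Z)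
        = chartForm ψ (ψ q) (christoffelForm ψ (ψ q) Y w) Z := by
      rw [chartForm_apply, chartForm_apply]
      exact (chartMetric_eq_transition hφ hψ hq hq' _ _).symm
    rw [map_sub, map_add, sub_apply, add_apply, h1,
      chartForm_christoffelForm hφ (φ.map_source hq),
      chartForm_christoffelForm hψ (ψ.map_source hq'), hder, hder, hder, hsymm w Y, hsymm Z Y,
      hsymm Z w, chartForm_comm _ (L w) (B Y Z), chartForm_comm _ (L Y) (B w Z)]
    ring
  obtain ⟨Z, hZ⟩ := hsurj (B Y w + christoffelForm φ (φ q) (L Y) (L w)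
      - L (christoffelForm ψ (ψ q) Y w))
  have h0 := hmain Z
  rw [hZ, chartForm_apply] at h0
  exact sub_eq_zero.1 (eq_zero_of_chartMetric_self hφ (φ.map_source hq) h0)

lemma connectorIn_eq (e : TangentBundle (𝓡 (d + 1)) N) (ξ : TangentSpace (𝓡 (d + 1)).tangent e) :
    connectorIn φ e ξ = (show TangentSpace (𝓡 (d + 1)) e.proj from
      mfderiv 𝓘(ℝ, EuclideanSpace ℝ (Fin (d + 1))) (𝓡 (d + 1)) φ.symm (φ e.proj)
        (fiberVelocity φ e ξ
          + christoffelForm φ (φ e.proj) (baseVelocity φ e ξ) (fiberCoord φ e))) := rfl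

/-- The connector can be computed in any chart. -/
lemma connector_eq_connectorIn (hφ : φ ∈ IsManifold.maximalAtlas (𝓡 (d + 1)) ∞ N)
    {e : TangentBundle (𝓡 (d + 1)) N} (he : e.proj ∈ φ.source)
    (ξ : TangentSpace (𝓡 (d + 1)).tangent e) : connector e ξ = connectorIn φ e ξ := by
  set ψ := chartAt (EuclideanSpace ℝ (Fin (d + 1))) e.proj with hψdef
  have hψ : ψ ∈ IsManifold.maximalAtlas (𝓡 (d + 1)) ∞ N := IsManifold.chart_mem_maximalAtlas _
  have he' : e.proj ∈ ψ.source := mem_chart_source _ _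
  -- The second derivative of the transition map from the Christoffel law is exactly the one in
  -- `fiberVelocity_change`, so `W + Γ(Y, w)` transforms as a tangent vector.
  have h1 := mfderiv_symm_eq_transition hφ hψ he he' (fiberVelocity ψ e ξ
    + christoffelForm ψ (ψ e.proj) (baseVelocity ψ e ξ) (fiberCoord ψ e))
  rw [map_add, ← christoffelForm_transition hφ hψ he he', ← baseVelocity_change hφ hψ he he',
    ← fiberCoord_change hφ hψ he he', ← add_assoc, add_comm (fderiv ℝ (φ ∘ ψ.symm) (ψ e.proj) _),
    ← fiberVelocity_change hφ hψ he he'] at h1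
  exact h1.symm

/-- The vertical coordinates in terms of the connector. -/
lemma fiberVelocity_eq (hφ : φ ∈ IsManifold.maximalAtlas (𝓡 (d + 1)) ∞ N)
    {e : TangentBundle (𝓡 (d + 1)) N} (he : e.proj ∈ φ.source)
    (ξ : TangentSpace (𝓡 (d + 1)).tangent e) :
    fiberVelocity φ e ξ =
      (show EuclideanSpace ℝ (Fin (d + 1)) from
        mfderiv (𝓡 (d + 1)) 𝓘(ℝ, EuclideanSpace ℝ (Fin (d + 1))) φ e.proj (connector e ξ))
      - christoffelForm φ (φ e.proj) (baseVelocity φ e ξ) (fiberCoord φ e) := by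
  rw [connector_eq_connectorIn hφ he, connectorIn_eq, eq_sub_iff_add_eq]
  exact (mfderiv_mfderiv_symm hφ he _).symm

end Smooth

/-! ### Almost isometric charts -/

/-- The lower metric bound reads `|w|² < (1 + ε) h(w, w)`, and `1 + ε < 2`. -/
lemma norm_mfderiv_le_of_isAlmostIsometricChart {ε : ℝ} (hε : 0 < ε) (hε1 : ε < 1)
    (h : IsAlmostIsometricChart ε φ) {q : N} (hq : q ∈ φ.source)
    (v : TangentSpace (𝓡 (d + 1)) q) :
    ‖(show EuclideanSpace ℝ (Fin (d + 1)) from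
      mfderiv (𝓡 (d + 1)) 𝓘(ℝ, EuclideanSpace ℝ (Fin (d + 1))) φ q v)‖ ≤ √2 * ‖v‖ := by
  set w : EuclideanSpace ℝ (Fin (d + 1)) :=
    mfderiv (𝓡 (d + 1)) 𝓘(ℝ, EuclideanSpace ℝ (Fin (d + 1))) φ q v with hw
  change ‖w‖ ≤ _
  by_cases h0 : w = 0
  · rw [h0, norm_zero]
    positivity
  have h1 := h.lower (φ q) (φ.map_source hq) w h0
  have h2 : chartMetric φ (φ q) w w = ‖v‖ ^ 2 := chartMetric_self_mfderiv h.mem_atlas hq v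
  rw [h2, one_div, inv_mul_lt_iff₀ (by linarith)] at h1
  refine (pow_le_pow_iff_left₀ (norm_nonneg _) (by positivity) two_ne_zero).1 ?_
  rw [mul_pow, Real.sq_sqrt (by norm_num)]
  nlinarith [sq_nonneg ‖v‖]

/-- Each of the `d + 1` components is a sum of `(d + 1)²` terms whose coefficients are at most `ε <
1` in absolute value. -/
lemma norm_christoffelForm_le {ε : ℝ} (hε1 : ε < 1) (h : IsAlmostIsometricChart ε φ)
    {y : EuclideanSpace ℝ (Fin (d + 1))} (hy : y ∈ φ.target)
    (Y w : EuclideanSpace ℝ (Fin (d + 1))) :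
    ‖christoffelForm φ y Y w‖ ≤ (d + 1) ^ 3 * (‖Y‖ * ‖w‖) := by
  have hk : ∀ k, |christoffelForm φ y Y w k| ≤ (d + 1) ^ 2 * (‖Y‖ * ‖w‖) := by
    intro k
    calc |christoffelForm φ y Y w k| = |∑ i, ∑ j, w j * Y i * christoffel φ y i j k| := rfl
      _ ≤ ∑ i : Fin (d + 1), ∑ j : Fin (d + 1), ‖Y‖ * ‖w‖ := by
          refine (Finset.abs_sum_le_sum_abs _ _).trans (Finset.sum_le_sum fun i _ => ?_)
          refine (Finset.abs_sum_le_sum_abs _ _).trans (Finset.sum_le_sum fun j _ => ?_)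
          rw [abs_mul, abs_mul]
          have h1 : |christoffel φ y i j k| ≤ 1 := (h.christoffel_le y hy i j k).trans hε1.le
          have h2 : |w j| ≤ ‖w‖ := PiLp.norm_apply_le w j
          have h3 : |Y i| ≤ ‖Y‖ := PiLp.norm_apply_le Y i
          calc |w j| * |Y i| * |christoffel φ y i j k| ≤ ‖w‖ * ‖Y‖ * 1 := by gcongr
            _ = ‖Y‖ * ‖w‖ := by ring
      _ = (d + 1) ^ 2 * (‖Y‖ * ‖w‖) := by
          simp
          ring
  calc ‖christoffelForm φ y Y w‖
      ≤ ∑ k, ‖christoffelForm φ y Y w k • EuclideanSpace.single k (1 : ℝ)‖ := by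
        conv_lhs => rw [sum_smul_single (christoffelForm φ y Y w)]
        exact norm_sum_le _ _
    _ ≤ ∑ k : Fin (d + 1), (d + 1) ^ 2 * (‖Y‖ * ‖w‖) := by
        refine Finset.sum_le_sum fun k _ => ?_
        simpa [norm_smul] using hk k
    _ = _ := by
        simp
        ring

end Metric

/-! ## Colocal weak derivatives in a chart -/

section Colocal

variable {E : Type*} [NormedAddCommGroup E] [NormedSpace ℝ E]
  {N : Type u} [TopologicalSpace N] [T2Space N] [ChartedSpace E N] [IsManifold 𝓘(ℝ, E) ∞ N]
  {φ : OpenPartialHomeomorph N E} {d m : ℕ} {Q : Set (EuclideanSpace ℝ (Fin d))}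
  {u : EuclideanSpace ℝ (Fin d) → N}
  {du : ∀ x, EuclideanSpace ℝ (Fin d) →L[ℝ] TangentSpace 𝓘(ℝ, E) (u x)}
  {ν : ∀ x, TangentSpace 𝓘(ℝ, E) (u x)}
  {dν : ∀ x, EuclideanSpace ℝ (Fin d) →L[ℝ]
      TangentSpace 𝓘(ℝ, E).tangent (⟨u x, ν x⟩ : TangentBundle 𝓘(ℝ, E) N)}

/-- The derivative of `u` in the chart `φ`. -/
noncomputable def chartVelocity (φ : OpenPartialHomeomorph N E)
    (du : ∀ x, EuclideanSpace ℝ (Fin d) →L[ℝ] TangentSpace 𝓘(ℝ, E) (u x))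
    (x : EuclideanSpace ℝ (Fin d)) : EuclideanSpace ℝ (Fin d) →L[ℝ] E :=
  (show TangentSpace 𝓘(ℝ, E) (u x) →L[ℝ] E from mfderiv 𝓘(ℝ, E) 𝓘(ℝ, E) φ (u x)).comp (du x)

/-- The derivative of `(u, ν)` in the coordinates of the tangent bundle induced by `φ`. -/
noncomputable def bundleVelocity (φ : OpenPartialHomeomorph N E)
    (dν : ∀ x, EuclideanSpace ℝ (Fin d) →L[ℝ]
      TangentSpace 𝓘(ℝ, E).tangent (⟨u x, ν x⟩ : TangentBundle 𝓘(ℝ, E) N))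
    (x : EuclideanSpace ℝ (Fin d)) : EuclideanSpace ℝ (Fin d) →L[ℝ] E × E :=
  ((baseVelocity φ ⟨u x, ν x⟩).comp (dν x)).prod ((fiberVelocity φ ⟨u x, ν x⟩).comp (dν x))

open Classical in
-- The definition of a colocal derivative tests real-valued functions only, so the components of `G`
-- are treated one at a time.
lemma IsColocalWeakDeriv.hasWeakDeriv_chartExtension (hQ : MeasurableSet Q)
    (hu : IsColocalWeakDeriv 𝓘(ℝ, E) Q u du) (h : φ ∈ IsManifold.maximalAtlas 𝓘(ℝ, E) ∞ N)
    {G : E → EuclideanSpace ℝ (Fin m)} (hG : ContDiff ℝ 1 G) (hc : HasCompactSupport G)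
    (hs : tsupport G ⊆ φ.target) :
    HasWeakDeriv Q (fun x => chartExtension φ G (u x))
      (fun x => if u x ∈ φ.source then (fderiv ℝ G (φ (u x))).comp (chartVelocity φ du x)
        else 0) := by
  refine hasWeakDeriv_euclidean fun k => ?_
  set g : E → ℝ := fun y => G y k with hgdef
  have hg : ContDiff ℝ 1 g := (EuclideanSpace.proj (𝕜 := ℝ) k).contDiff.comp hG
  have hgs : tsupport g ⊆ tsupport G := by
    refine closure_mono fun y hy h0 => hy ?_
    simp [hgdef, h0]
  have hgc : HasCompactSupport g := hc.of_isClosed_subset (isClosed_tsupport _) hgs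
  refine (hu (chartExtension φ g) (contMDiff_chartExtension h hg hgc (hgs.trans hs))
    (hasCompactSupport_chartExtension hgc (hgs.trans hs))).congr hQ ?_ ?_
  · intro x _
    by_cases hx : u x ∈ φ.source <;> simp [chartExtension, hx, hgdef]
  · intro x _
    ext v
    by_cases hx : u x ∈ φ.source
    · have hd : DifferentiableAt ℝ G (φ (u x)) := hG.differentiable one_ne_zero _
      have e1 := mfderiv_chartExtension h hx (hg.differentiable one_ne_zero (φ (u x))) (du x v)
      have e2 : fderiv ℝ g (φ (u x)) = (EuclideanSpace.proj (𝕜 := ℝ) k).comp (fderiv ℝ G (φ (u x))) :=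
        ((EuclideanSpace.proj (𝕜 := ℝ) k).hasFDerivAt.comp _ hd.hasFDerivAt).fderiv
      rw [e2] at e1
      rw [if_pos hx]
      exact e1
    -- Outside the chart domain, including its boundary, the point is off the closed support; the
    -- extension is zero in a neighbourhood and so is its derivative.
    · have e1 : chartExtension φ g =ᶠ[𝓝 (u x)] fun _ => (0 : ℝ) := by
        refine notMem_tsupport_iff_eventuallyEq.1 fun ht => hx ?_
        obtain ⟨y, hy, hyu⟩ := tsupport_chartExtension_subset hgc (hgs.trans hs) ht
        rw [← hyu]
        exact φ.map_target (hs (hgs hy))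
      have e2 := e1.mfderiv_eq (I := 𝓘(ℝ, E)) (I' := 𝓘(ℝ, ℝ))
      rw [mfderiv_const] at e2
      rw [if_neg hx]
      exact congrArg (fun L => L (du x v)) e2

open Classical in
lemma IsColocalWeakDeriv.hasWeakDeriv_bundleExtension (hQ : MeasurableSet Q)
    (hν : IsColocalWeakDeriv 𝓘(ℝ, E).tangent Q
      (fun x => (⟨u x, ν x⟩ : TangentBundle 𝓘(ℝ, E) N)) dν)
    (h : φ ∈ IsManifold.maximalAtlas 𝓘(ℝ, E) ∞ N)
    {G : E × E → EuclideanSpace ℝ (Fin m)} (hG : ContDiff ℝ 1 G) (hc : HasCompactSupport G)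
    (hs : tsupport G ⊆ φ.target ×ˢ univ) :
    HasWeakDeriv Q (fun x => bundleExtension φ G ⟨u x, ν x⟩)
      (fun x => if u x ∈ φ.source then
        (fderiv ℝ G (bundleCoord φ ⟨u x, ν x⟩)).comp (bundleVelocity φ dν x) else 0) := by
  refine hasWeakDeriv_euclidean fun k => ?_
  set g : E × E → ℝ := fun y => G y k with hgdef
  have hg : ContDiff ℝ 1 g := (EuclideanSpace.proj (𝕜 := ℝ) k).contDiff.comp hG
  have hgs : tsupport g ⊆ tsupport G := by
    refine closure_mono fun y hy h0 => hy ?_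
    simp [hgdef, h0]
  have hgc : HasCompactSupport g := hc.of_isClosed_subset (isClosed_tsupport _) hgs
  refine (hν (bundleExtension φ g) (contMDiff_bundleExtension h hg hgc (hgs.trans hs))
    (hasCompactSupport_bundleExtension h hgc (hgs.trans hs))).congr hQ ?_ ?_
  · intro x _
    by_cases hx : u x ∈ φ.source <;> simp [bundleExtension, hx, hgdef]
  · intro x _
    ext v
    set e : TangentBundle 𝓘(ℝ, E) N := ⟨u x, ν x⟩ with he
    by_cases hx : u x ∈ φ.source
    · have hd : DifferentiableAt ℝ G (bundleCoord φ e) := hG.differentiable one_ne_zero _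
      have e1 := mfderiv_bundleExtension h (e := e) hx (hg.differentiable one_ne_zero _) (dν x v)
      have e2 : fderiv ℝ g (bundleCoord φ e)
          = (EuclideanSpace.proj (𝕜 := ℝ) k).comp (fderiv ℝ G (bundleCoord φ e)) :=
        ((EuclideanSpace.proj (𝕜 := ℝ) k).hasFDerivAt.comp _ hd.hasFDerivAt).fderiv
      rw [e2] at e1
      rw [if_pos hx]
      exact e1
    · have e1 : bundleExtension φ g =ᶠ[𝓝 e] fun _ => (0 : ℝ) := by
        refine notMem_tsupport_iff_eventuallyEq.1 fun ht => hx ?_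
        obtain ⟨y, hy, hyu⟩ := tsupport_bundleExtension_subset h hgc (hgs.trans hs) ht
        have : e.proj ∈ φ.source := by
          rw [← hyu]
          exact φ.map_target (hs (hgs hy)).1
        exact this
      have e2 := e1.mfderiv_eq (I := 𝓘(ℝ, E).tangent) (I' := 𝓘(ℝ, ℝ))
      rw [mfderiv_const] at e2
      rw [if_neg hx]
      exact congrArg (fun L => L (dν x v)) e2

end Colocal

/-! ### Compatibility of the derivatives of `u` and of `(u, ν)`. -/

section Projection

variable {n d : ℕ}
  {N : Type u} [TopologicalSpace N] [T2Space N] [ChartedSpace (EuclideanSpace ℝ (Fin n)) N]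
  [IsManifold (𝓡 n) ∞ N]
  {φ : OpenPartialHomeomorph N (EuclideanSpace ℝ (Fin n))} {Q : Set (EuclideanSpace ℝ (Fin d))}
  {u : EuclideanSpace ℝ (Fin d) → N}
  {du : ∀ x, EuclideanSpace ℝ (Fin d) →L[ℝ] TangentSpace (𝓡 n) (u x)}
  {ν : ∀ x, TangentSpace (𝓡 n) (u x)}
  {dν : ∀ x, EuclideanSpace ℝ (Fin d) →L[ℝ]
      TangentSpace (𝓡 n).tangent (⟨u x, ν x⟩ : TangentBundle (𝓡 n) N)}

/-- A smooth cut-off function which is `1` in a ball of radius `3` and `0` outside a ball of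
radius `4`. -/
noncomputable def fiberCutoff (n : ℕ) : ContDiffBump (0 : EuclideanSpace ℝ (Fin n)) where
  rIn := 3
  rOut := 4
  rIn_pos := by norm_num
  rIn_lt_rOut := by norm_num

/-- The fibre coordinates of the normals stay in the ball of radius `2`. The cut-off is constant
near them, so it changes neither values nor derivatives there. -/
lemma fiberCutoff_eventuallyEq {w : EuclideanSpace ℝ (Fin n)} (hw : ‖w‖ ≤ 2) :
    (fiberCutoff n : EuclideanSpace ℝ (Fin n) → ℝ) =ᶠ[𝓝 w] fun _ => 1 :=
  (fiberCutoff n).eventuallyEq_one_of_mem_ball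
    (by rw [mem_ball_zero_iff]; exact lt_of_le_of_lt hw (by norm_num [fiberCutoff]))

lemma hasCompactSupport_prod_of_subset {E F : Type*} [NormedAddCommGroup E] [NormedAddCommGroup F]
    {G : E × E → F} {K L : Set E} (hK : IsCompact K) (hL : IsCompact L)
    (h : ∀ z, G z ≠ 0 → z.1 ∈ K ∧ z.2 ∈ L) :
    HasCompactSupport G ∧ tsupport G ⊆ K ×ˢ univ := by
  have hsub : tsupport G ⊆ K ×ˢ L := closure_minimal (fun z hz => h z hz) (hK.prod hL).isClosed
  exact ⟨(hK.prod hL).of_isClosed_subset (isClosed_tsupport _) hsub,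
    hsub.trans (prod_mono_right (subset_univ _))⟩

/-- The horizontal part of the derivative of `(u, ν)` is the derivative of `u`. -/
lemma ae_bundleVelocity_fst_eq (hQ : IsOpen Q) (hu : IsColocalWeakDeriv (𝓡 n) Q u du)
    (hν : IsColocalWeakDeriv (𝓡 n).tangent Q (fun x => (⟨u x, ν x⟩ : TangentBundle (𝓡 n) N)) dν)
    (h : φ ∈ IsManifold.maximalAtlas (𝓡 n) ∞ N)
    (hw : ∀ x ∈ Q, u x ∈ φ.source → ‖fiberCoord φ (⟨u x, ν x⟩ : TangentBundle (𝓡 n) N)‖ ≤ 2)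
    {R : ℝ} (hR : 0 < R) (hRt : Metric.ball (0 : EuclideanSpace ℝ (Fin n)) R ⊆ φ.target) :
    ∀ᵐ x ∂(volume.restrict Q), u x ∈ φ.source → ‖φ (u x)‖ < R →
      ∀ v, (bundleVelocity φ dν x v).1 = chartVelocity φ du x v := by
  have key : ∀ ρ : ℝ, 0 < ρ → ρ < R → ∀ᵐ x ∂(volume.restrict Q), u x ∈ φ.source →
      ‖φ (u x)‖ < ρ → ∀ v, (bundleVelocity φ dν x v).1 = chartVelocity φ du x v := by
    intro ρ hρ hρR
    let χ : ContDiffBump (0 : EuclideanSpace ℝ (Fin n)) :=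
      ⟨ρ, (ρ + R) / 2, hρ, by linarith⟩
    let κ := fiberCutoff n
    have hχs : Metric.closedBall (0 : EuclideanSpace ℝ (Fin n)) ((ρ + R) / 2) ⊆ φ.target :=
      (Metric.closedBall_subset_ball (by linarith)).trans hRt
    -- Composing `G₁` with `u` and `G₂` with `(u, ν)` gives the same function on `Q`, so the two
    -- weak derivatives agree almost everywhere. Where `‖φ (u x)‖ < ρ`, the functions are locally
    -- the identity and the first projection, which exposes the two velocities.
    set G₁ : EuclideanSpace ℝ (Fin n) → EuclideanSpace ℝ (Fin n) := fun y => χ y • y with hG₁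
    set G₂ : EuclideanSpace ℝ (Fin n) × EuclideanSpace ℝ (Fin n) → EuclideanSpace ℝ (Fin n) :=
      fun z => κ z.2 • χ z.1 • z.1 with hG₂
    have c1 : ContDiff ℝ 1 G₁ := χ.contDiff.smul contDiff_id
    have c2 : ContDiff ℝ 1 G₂ :=
      (κ.contDiff.comp contDiff_snd).smul ((χ.contDiff.comp contDiff_fst).smul contDiff_fst)
    have s1 : tsupport G₁ ⊆ Metric.closedBall 0 ((ρ + R) / 2) := by
      refine (closure_mono ?_).trans χ.tsupport_eq.subset
      intro y hy h0
      exact hy (by simp [hG₁, h0])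
    have k1 : HasCompactSupport G₁ :=
      (isCompact_closedBall _ _).of_isClosed_subset (isClosed_tsupport _) s1
    obtain ⟨k2, s2⟩ : HasCompactSupport G₂ ∧
        tsupport G₂ ⊆ Metric.closedBall 0 ((ρ + R) / 2) ×ˢ univ := by
      refine hasCompactSupport_prod_of_subset (isCompact_closedBall 0 _) κ.hasCompactSupport ?_
      intro z hz
      refine ⟨χ.tsupport_eq ▸ subset_tsupport _ ?_, subset_tsupport _ ?_⟩
      · intro h0
        exact hz (by simp [hG₂, h0])
      · intro h0
        exact hz (by simp [hG₂, h0])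
    have w1 := hu.hasWeakDeriv_chartExtension hQ.measurableSet h c1 k1 (s1.trans hχs)
    have w2 := hν.hasWeakDeriv_bundleExtension hQ.measurableSet h c2 k2
      (s2.trans (prod_mono_left hχs))
    have w3 := w2.congr hQ.measurableSet (f' := fun x => chartExtension φ G₁ (u x)) (fun x hx => ?_)
      (fun _ _ => rfl)
    · filter_upwards [w1.ae_eq hQ w3, ae_restrict_mem hQ.measurableSet] with x hx hxQ hxs hxρ v
      simp only [if_pos hxs] at hx
      have hx' := congrArg (fun L => L v) hx
      have e1 : G₁ =ᶠ[𝓝 (φ (u x))] id := by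
        filter_upwards [χ.eventuallyEq_one_of_mem_ball (mem_ball_zero_iff.2 hxρ)] with y hy
        simp [hG₁, hy]
      have e2 : G₂ =ᶠ[𝓝 (bundleCoord φ ⟨u x, ν x⟩)] Prod.fst := by
        have t1 := (continuous_fst.tendsto (bundleCoord φ ⟨u x, ν x⟩)).eventually
          (χ.eventuallyEq_one_of_mem_ball (mem_ball_zero_iff.2 hxρ))
        have t2 := (continuous_snd.tendsto (bundleCoord φ ⟨u x, ν x⟩)).eventually
          (fiberCutoff_eventuallyEq (hw x hxQ hxs))
        filter_upwards [t1, t2] with z hz1 hz2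
        simp only [Pi.one_apply] at hz1
        simp [hG₂, hz1, κ, hz2]
      rw [e1.fderiv_eq, e2.fderiv_eq, fderiv_id, fderiv_fst] at hx'
      exact hx'.symm
    · by_cases hxs : u x ∈ φ.source
      · have : κ (fiberCoord φ ⟨u x, ν x⟩) = 1 := (fiberCutoff_eventuallyEq (hw x hx hxs)).eq_of_nhds
        simp [bundleExtension, chartExtension, hxs, hG₁, hG₂, bundleCoord, this]
      · simp [bundleExtension, chartExtension, hxs]
  -- The open ball of radius `R` is exhausted by countably many balls of smaller radius, so the
  -- exceptional sets remain null.
  have h2 : ∀ᵐ x ∂(volume.restrict Q), ∀ k : ℕ, u x ∈ φ.source →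
      ‖φ (u x)‖ < R * ((k + 1 : ℝ) / (k + 2)) →
      ∀ v, (bundleVelocity φ dν x v).1 = chartVelocity φ du x v := by
    refine ae_all_iff.2 fun k => key _ (by positivity) ?_
    refine mul_lt_of_lt_one_right hR ?_
    rw [div_lt_one (by positivity)]
    linarith
  filter_upwards [h2] with x hx hxs hxR
  have ht : Filter.Tendsto (fun k : ℕ => R * ((k + 1 : ℝ) / (k + 2))) Filter.atTop (𝓝 (R * 1)) := by
    refine Filter.Tendsto.const_mul _ ?_
    have := (tendsto_const_nhds (x := (1 : ℝ))).sub
      ((tendsto_one_div_add_atTop_nhds_zero_nat (𝕜 := ℝ)).comp (Filter.tendsto_add_atTop_nat 1))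
    rw [sub_zero] at this
    refine this.congr fun k => ?_
    simp only [Function.comp]
    push_cast
    field_simp
    ring
  rw [mul_one] at ht
  obtain ⟨k, hk⟩ := (ht.eventually (lt_mem_nhds hxR)).exists
  exact hx k hxs hk

end Projection

/-! ## Cut-offs of the identity -/

section Cutoff

variable {n : ℕ} {θ : EuclideanSpace ℝ (Fin n) → EuclideanSpace ℝ (Fin n)}

lemma exists_bound_norm_fderiv {E F : Type*} [NormedAddCommGroup E] [NormedSpace ℝ E]
    [NormedAddCommGroup F] [NormedSpace ℝ F] {f : E → F} (hf : ContDiff ℝ ∞ f)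
    (hc : HasCompactSupport f) : ∃ A : ℝ, ∀ z, ‖fderiv ℝ f z‖ ≤ A :=
  (hc.fderiv ℝ).exists_bound_of_continuous (hf.continuous_fderiv (by simp))

lemma exists_bound_fderiv {E F : Type*} [NormedAddCommGroup E] [NormedSpace ℝ E]
    [NormedAddCommGroup F] [NormedSpace ℝ F] {f : E → F} (hf : ContDiff ℝ ∞ f)
    (hc : HasCompactSupport f) :
    ∃ M : ℝ, 0 ≤ M ∧ (∀ z, ‖fderiv ℝ f z‖ ≤ M) ∧ ∀ z, ‖fderiv ℝ (fderiv ℝ f) z‖ ≤ M := by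
  have h1 : ContDiff ℝ ∞ (fderiv ℝ f) := hf.fderiv_right (by simp)
  obtain ⟨A, hA⟩ := exists_bound_norm_fderiv hf hc
  obtain ⟨B, hB⟩ := exists_bound_norm_fderiv h1 (hc.fderiv ℝ)
  exact ⟨max A B, ((norm_nonneg _).trans (hA 0)).trans (le_max_left _ _),
    fun z => (hA z).trans (le_max_left _ _), fun z => (hB z).trans (le_max_right _ _)⟩

/-- Off the closed ball the derivatives of `θ` vanish because `θ` is locally zero; continuity
extends this to the sphere of radius `2`. -/
lemma eq_zero_of_two_le_norm {F : Type*} [NormedAddCommGroup F] {f : EuclideanSpace ℝ (Fin n) → F}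
    (hf : Continuous f) (h : ∀ z, 2 < ‖z‖ → f z = 0) {z : EuclideanSpace ℝ (Fin n)}
    (hz : 2 ≤ ‖z‖) : f z = 0 := by
  have h1 : IsClosed {z | f z = 0} := isClosed_eq hf continuous_const
  have h2 : (Metric.closedBall (0 : EuclideanSpace ℝ (Fin n)) 2)ᶜ ⊆ {z | f z = 0} := by
    intro y hy
    exact h y (by simpa using hy)
  have h3 := closure_minimal h2 h1
  rw [closure_compl, interior_closedBall _ two_ne_zero] at h3
  exact h3 (by simpa using hz)

lemma IsIdentityCutoff.eventuallyEq_zero (hθ : IsIdentityCutoff θ)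
    {z : EuclideanSpace ℝ (Fin n)} (hz : 2 < ‖z‖) : θ =ᶠ[𝓝 z] fun _ => 0 := by
  have : (Metric.closedBall (0 : EuclideanSpace ℝ (Fin n)) 2)ᶜ ∈ 𝓝 z :=
    Metric.isClosed_closedBall.isOpen_compl.mem_nhds (by simpa using hz)
  filter_upwards [this] with y hy
  exact hθ.eq_zero y fun h => hy (Metric.ball_subset_closedBall h)

lemma IsIdentityCutoff.eventuallyEq_id (hθ : IsIdentityCutoff θ)
    {z : EuclideanSpace ℝ (Fin n)} (hz : ‖z‖ < 1) : θ =ᶠ[𝓝 z] id := by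
  filter_upwards [Metric.isOpen_ball.mem_nhds (mem_ball_zero_iff.2 hz)] with y hy
  exact hθ.eq_self y hy

lemma IsIdentityCutoff.contDiff_fderiv (hθ : IsIdentityCutoff θ) : ContDiff ℝ ∞ (fderiv ℝ θ) :=
  hθ.contDiff.fderiv_right (by simp)

lemma IsIdentityCutoff.contDiff_fderiv_fderiv (hθ : IsIdentityCutoff θ) :
    ContDiff ℝ ∞ (fderiv ℝ (fderiv ℝ θ)) :=
  hθ.contDiff_fderiv.fderiv_right (by simp)

lemma IsIdentityCutoff.fderiv_eq_zero (hθ : IsIdentityCutoff θ)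
    {z : EuclideanSpace ℝ (Fin n)} (hz : 2 ≤ ‖z‖) : fderiv ℝ θ z = 0 := by
  refine eq_zero_of_two_le_norm hθ.contDiff_fderiv.continuous (fun y hy => ?_) hz
  rw [(hθ.eventuallyEq_zero hy).fderiv_eq]
  simp

lemma IsIdentityCutoff.fderiv_fderiv_eq_zero (hθ : IsIdentityCutoff θ)
    {z : EuclideanSpace ℝ (Fin n)} (hz : 2 ≤ ‖z‖) : fderiv ℝ (fderiv ℝ θ) z = 0 := by
  refine eq_zero_of_two_le_norm hθ.contDiff_fderiv_fderiv.continuous (fun y hy => ?_) hz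
  rw [(hθ.eventuallyEq_zero hy).fderiv.fderiv_eq]
  simp

lemma IsIdentityCutoff.fderiv_fderiv_eq_zero_of_norm_lt_one (hθ : IsIdentityCutoff θ)
    {z : EuclideanSpace ℝ (Fin n)} (hz : ‖z‖ < 1) : fderiv ℝ (fderiv ℝ θ) z = 0 := by
  have : fderiv ℝ (id : EuclideanSpace ℝ (Fin n) → EuclideanSpace ℝ (Fin n))
      = fun _ => ContinuousLinearMap.id ℝ _ := funext fun _ => fderiv_id
  rw [(hθ.eventuallyEq_id hz).fderiv.fderiv_eq, this]
  exact fderiv_const_apply _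

lemma IsIdentityCutoff.exists_bound (hθ : IsIdentityCutoff θ) :
    ∃ M : ℝ, 0 ≤ M ∧ (∀ z, ‖fderiv ℝ θ z‖ ≤ M) ∧ ∀ z, ‖fderiv ℝ (fderiv ℝ θ) z‖ ≤ M := by
  exact exists_bound_fderiv hθ.contDiff hθ.hasCompactSupport

/-- The derivative of a cut-off of the identity is small near the sphere of radius `2`. -/
lemma IsIdentityCutoff.exists_norm_fderiv_le (hθ : IsIdentityCutoff θ) {η : ℝ} (hη : 0 < η) :
    ∃ δ : ℝ, 0 < δ ∧ δ < 2 ∧ ∀ z, 2 - δ ≤ ‖z‖ → ‖fderiv ℝ θ z‖ ≤ η := by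
  have huc := (hθ.hasCompactSupport.fderiv ℝ).uniformContinuous_of_continuous
    hθ.contDiff_fderiv.continuous
  obtain ⟨δ, hδ, h⟩ := Metric.uniformContinuous_iff.1 huc η hη
  -- Compare `z` with its radial projection to the sphere of radius `2`, where `Dθ = 0`. The half
  -- gives a strict inequality of distances, and the bound `1` keeps `z` away from the origin.
  refine ⟨min (δ / 2) 1, by positivity, by linarith [min_le_right (δ / 2) 1], fun z hz => ?_⟩
  by_cases h2 : 2 ≤ ‖z‖
  · rw [hθ.fderiv_eq_zero h2, norm_zero]
    exact hη.le
  · have hz0 : 0 < ‖z‖ := by linarith [min_le_right (δ / 2) 1]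
    have h3 : ‖(2 / ‖z‖) • z‖ = 2 := by
      rw [norm_smul, Real.norm_of_nonneg (by positivity)]
      field_simp
    have h4 : dist z ((2 / ‖z‖) • z) < δ := by
      have : z - (2 / ‖z‖) • z = (1 - 2 / ‖z‖) • z := by rw [sub_smul, one_smul]
      rw [dist_eq_norm, this, norm_smul, Real.norm_eq_abs]
      have h5 : |1 - 2 / ‖z‖| * ‖z‖ = |‖z‖ - 2| := by
        rw [← abs_of_pos hz0, ← abs_mul, abs_of_pos hz0]
        congr 1
        field_simp
      rw [h5, abs_lt]
      constructor <;> linarith [min_le_left (δ / 2) 1]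
    have h5 := h h4
    rw [hθ.fderiv_eq_zero h3.ge, dist_zero_right] at h5
    exact h5.le

/-- The map `(y, w) ↦ Dθ(y/s) w`. -/
noncomputable def normalCoord (θ : EuclideanSpace ℝ (Fin n) → EuclideanSpace ℝ (Fin n)) (s : ℝ)
    (z : EuclideanSpace ℝ (Fin n) × EuclideanSpace ℝ (Fin n)) : EuclideanSpace ℝ (Fin n) :=
  fderiv ℝ θ (s⁻¹ • z.1) z.2

/-- The derivative of `normalCoord`. -/
noncomputable def normalCoordDeriv (θ : EuclideanSpace ℝ (Fin n) → EuclideanSpace ℝ (Fin n))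
    (s : ℝ) (z : EuclideanSpace ℝ (Fin n) × EuclideanSpace ℝ (Fin n)) :
    EuclideanSpace ℝ (Fin n) × EuclideanSpace ℝ (Fin n) →L[ℝ] EuclideanSpace ℝ (Fin n) :=
  (s⁻¹ • (fderiv ℝ (fderiv ℝ θ) (s⁻¹ • z.1)).flip z.2).comp
      (ContinuousLinearMap.fst ℝ (EuclideanSpace ℝ (Fin n)) (EuclideanSpace ℝ (Fin n)))
    + (fderiv ℝ θ (s⁻¹ • z.1)).comp
      (ContinuousLinearMap.snd ℝ (EuclideanSpace ℝ (Fin n)) (EuclideanSpace ℝ (Fin n)))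

lemma normalCoordDeriv_apply (s : ℝ) (z v : EuclideanSpace ℝ (Fin n) × EuclideanSpace ℝ (Fin n)) :
    normalCoordDeriv θ s z v =
      s⁻¹ • fderiv ℝ (fderiv ℝ θ) (s⁻¹ • z.1) v.1 z.2 + fderiv ℝ θ (s⁻¹ • z.1) v.2 := rfl

lemma IsIdentityCutoff.contDiff_normalCoord (hθ : IsIdentityCutoff θ) (s : ℝ) :
    ContDiff ℝ ∞ (normalCoord θ s) :=
  (hθ.contDiff_fderiv.comp (contDiff_fst.const_smul s⁻¹)).clm_apply contDiff_snd

lemma IsIdentityCutoff.fderiv_normalCoord (hθ : IsIdentityCutoff θ) (s : ℝ)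
    (z : EuclideanSpace ℝ (Fin n) × EuclideanSpace ℝ (Fin n)) :
    fderiv ℝ (normalCoord θ s) z = normalCoordDeriv θ s z := by
  have h1 : HasFDerivAt (fun z : EuclideanSpace ℝ (Fin n) × EuclideanSpace ℝ (Fin n) => s⁻¹ • z.1)
      (s⁻¹ • ContinuousLinearMap.fst ℝ _ _) z := hasFDerivAt_fst.const_smul s⁻¹
  have h2 : HasFDerivAt (fun z : EuclideanSpace ℝ (Fin n) × EuclideanSpace ℝ (Fin n) =>
      fderiv ℝ θ (s⁻¹ • z.1)) _ z :=
    HasFDerivAt.comp z (g := fderiv ℝ θ)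
      (hθ.contDiff_fderiv.differentiable (by simp) (s⁻¹ • z.1)).hasFDerivAt h1
  have h3 : HasFDerivAt (normalCoord θ s) _ z := h2.clm_apply hasFDerivAt_snd
  rw [h3.fderiv]
  ext v
  · simp [normalCoordDeriv_apply]
  · simp [normalCoordDeriv_apply]

lemma IsIdentityCutoff.tendsto_normalCoord (hθ : IsIdentityCutoff θ) {s : ℕ → ℝ} {r : ℝ}
    (hr : r ≠ 0) (hs : Filter.Tendsto s Filter.atTop (𝓝 r))
    (z : EuclideanSpace ℝ (Fin n) × EuclideanSpace ℝ (Fin n)) :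
    Filter.Tendsto (fun k => normalCoord θ (s k) z) Filter.atTop (𝓝 (normalCoord θ r z)) := by
  have h1 : Filter.Tendsto (fun k => (s k)⁻¹ • z.1) Filter.atTop (𝓝 (r⁻¹ • z.1)) :=
    (hs.inv₀ hr).smul_const _
  have h2 : Filter.Tendsto (fun k => fderiv ℝ θ ((s k)⁻¹ • z.1)) Filter.atTop
      (𝓝 (fderiv ℝ θ (r⁻¹ • z.1))) := (hθ.contDiff_fderiv.continuous.tendsto _).comp h1
  exact ((ContinuousLinearMap.apply ℝ (EuclideanSpace ℝ (Fin n)) z.2).continuous.tendsto _).comp h2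

lemma tendsto_bilinear_comp {E F : Type*} [NormedAddCommGroup E] [NormedSpace ℝ E]
    [NormedAddCommGroup F] [NormedSpace ℝ F] {c : ℕ → ℝ} {c₀ : ℝ} {B : ℕ → E →L[ℝ] E →L[ℝ] F}
    {B₀ : E →L[ℝ] E →L[ℝ] F} {A : ℕ → E →L[ℝ] F} {A₀ : E →L[ℝ] F}
    (hc : Filter.Tendsto c Filter.atTop (𝓝 c₀)) (hB : Filter.Tendsto B Filter.atTop (𝓝 B₀))
    (hA : Filter.Tendsto A Filter.atTop (𝓝 A₀)) (w : E) :
    Filter.Tendsto (fun k => (c k • (B k).flip w).comp (ContinuousLinearMap.fst ℝ E E)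
      + (A k).comp (ContinuousLinearMap.snd ℝ E E)) Filter.atTop
      (𝓝 ((c₀ • B₀.flip w).comp (ContinuousLinearMap.fst ℝ E E)
        + A₀.comp (ContinuousLinearMap.snd ℝ E E))) := by
  have h1 : Filter.Tendsto (fun k => (B k).flip w) Filter.atTop (𝓝 (B₀.flip w)) :=
    (((ContinuousLinearMap.apply ℝ (E →L[ℝ] F) w).comp
      (ContinuousLinearMap.flipₗᵢ ℝ E E F).toContinuousLinearEquiv.toContinuousLinearMap).continuous.tendsto
        B₀).comp hB
  have h2 := ((((ContinuousLinearMap.compL ℝ (E × E) E F).flip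
    (ContinuousLinearMap.fst ℝ E E)).continuous.tendsto _).comp (hc.smul h1))
  have h3 := ((((ContinuousLinearMap.compL ℝ (E × E) E F).flip
    (ContinuousLinearMap.snd ℝ E E)).continuous.tendsto _).comp hA)
  exact h2.add h3

lemma IsIdentityCutoff.tendsto_normalCoordDeriv (hθ : IsIdentityCutoff θ) {s : ℕ → ℝ} {r : ℝ}
    (hr : r ≠ 0) (hs : Filter.Tendsto s Filter.atTop (𝓝 r))
    (z : EuclideanSpace ℝ (Fin n) × EuclideanSpace ℝ (Fin n)) :
    Filter.Tendsto (fun k => normalCoordDeriv θ (s k) z) Filter.atTop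
      (𝓝 (normalCoordDeriv θ r z)) := by
  have h1 : Filter.Tendsto (fun k => (s k)⁻¹ • z.1) Filter.atTop (𝓝 (r⁻¹ • z.1)) :=
    (hs.inv₀ hr).smul_const _
  have h2 : Filter.Tendsto (fun k => fderiv ℝ θ ((s k)⁻¹ • z.1)) Filter.atTop
      (𝓝 (fderiv ℝ θ (r⁻¹ • z.1))) := (hθ.contDiff_fderiv.continuous.tendsto _).comp h1
  have h3 : Filter.Tendsto (fun k => fderiv ℝ (fderiv ℝ θ) ((s k)⁻¹ • z.1)) Filter.atTop
      (𝓝 (fderiv ℝ (fderiv ℝ θ) (r⁻¹ • z.1))) :=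
    (hθ.contDiff_fderiv_fderiv.continuous.tendsto _).comp h1
  exact tendsto_bilinear_comp (hs.inv₀ hr) h3 h2 z.2

lemma normalCoordDeriv_eq_zero (hθ : IsIdentityCutoff θ) {s : ℝ} (hs : 0 < s)
    {z : EuclideanSpace ℝ (Fin n) × EuclideanSpace ℝ (Fin n)} (hz : 2 * s ≤ ‖z.1‖) :
    normalCoordDeriv θ s z = 0 := by
  have h : 2 ≤ ‖s⁻¹ • z.1‖ := by
    rw [norm_smul, Real.norm_of_nonneg (by positivity), inv_mul_eq_div, le_div_iff₀ hs]
    exact hz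
  ext v <;> simp [normalCoordDeriv_apply, hθ.fderiv_eq_zero h, hθ.fderiv_fderiv_eq_zero h]

open Classical in
-- The indicator is present because `D²θ = 0` on the unit ball. It is the source of the restriction
-- to `Q \ F` in the term with `1 / r ^ p`.
lemma norm_normalCoordDeriv_le (hθ : IsIdentityCutoff θ) {M : ℝ}
    (hM : ∀ z, ‖fderiv ℝ θ z‖ ≤ M) (hM' : ∀ z, ‖fderiv ℝ (fderiv ℝ θ) z‖ ≤ M) {s : ℝ} (hs : 0 < s)
    (z v : EuclideanSpace ℝ (Fin n) × EuclideanSpace ℝ (Fin n)) :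
    ‖normalCoordDeriv θ s z v‖ ≤
      (if ‖z.1‖ < s then 0 else s⁻¹) * (M * (‖v.1‖ * ‖z.2‖)) + M * ‖v.2‖ := by
  rw [normalCoordDeriv_apply]
  refine (norm_add_le _ _).trans (add_le_add ?_ ?_)
  · split_ifs with h
    · have : ‖s⁻¹ • z.1‖ < 1 := by
        rw [norm_smul, Real.norm_of_nonneg (by positivity), inv_mul_eq_div, div_lt_one hs]
        exact h
      rw [hθ.fderiv_fderiv_eq_zero_of_norm_lt_one this]
      simp
    · rw [norm_smul, Real.norm_of_nonneg (by positivity)]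
      refine mul_le_mul_of_nonneg_left ?_ (by positivity)
      calc _ ≤ ‖fderiv ℝ (fderiv ℝ θ) (s⁻¹ • z.1) v.1‖ * ‖z.2‖ := ContinuousLinearMap.le_opNorm _ _
        _ ≤ ‖fderiv ℝ (fderiv ℝ θ) (s⁻¹ • z.1)‖ * ‖v.1‖ * ‖z.2‖ := by
            gcongr
            exact ContinuousLinearMap.le_opNorm _ _
        _ ≤ M * ‖v.1‖ * ‖z.2‖ := by
            gcongr
            exact hM' _
        _ = _ := by ring
  · exact (ContinuousLinearMap.le_opNorm _ _).trans (by gcongr; exact hM _)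

end Cutoff

/-! ## The extended chart -/

section ExtendChart

variable {n : ℕ} {N : Type u} [TopologicalSpace N] [ChartedSpace (EuclideanSpace ℝ (Fin n)) N]
  [IsManifold (𝓡 n) ∞ N]
  {θ : EuclideanSpace ℝ (Fin n) → EuclideanSpace ℝ (Fin n)}
  {φ : OpenPartialHomeomorph N (EuclideanSpace ℝ (Fin n))}

/-- The outer factor `s` cancels the inner `s⁻¹`; a power of `s⁻¹` appears only at the next
derivative. -/
lemma fderiv_smul_comp_inv_smul (hθ : IsIdentityCutoff θ) {s : ℝ} (hs : s ≠ 0)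
    (y v : EuclideanSpace ℝ (Fin n)) :
    fderiv ℝ (fun y => s • θ (s⁻¹ • y)) y v = fderiv ℝ θ (s⁻¹ • y) v := by
  have h1 : HasFDerivAt (fun y : EuclideanSpace ℝ (Fin n) => s⁻¹ • y)
      (s⁻¹ • ContinuousLinearMap.id ℝ _) y := (hasFDerivAt_id y).const_smul s⁻¹
  have h2 : HasFDerivAt (fun y => s • θ (s⁻¹ • y)) _ y :=
    (HasFDerivAt.comp y (g := θ)
      (hθ.contDiff.differentiable (by simp) (s⁻¹ • y)).hasFDerivAt h1).const_smul s
  rw [h2.fderiv]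
  simp [smul_smul, hs]

lemma contDiff_smul_comp_inv_smul (hθ : IsIdentityCutoff θ) (s : ℝ) :
    ContDiff ℝ ∞ (fun y => s • θ (s⁻¹ • y)) :=
  (hθ.contDiff.comp (contDiff_id.const_smul s⁻¹)).const_smul s

lemma mfderiv_extendChart [T2Space N] (hθ : IsIdentityCutoff θ)
    (h : φ ∈ IsManifold.maximalAtlas (𝓡 n) ∞ N) {s : ℝ} (hs : s ≠ 0) {q : N} (hq : q ∈ φ.source)
    (v : TangentSpace (𝓡 n) q) :
    (show EuclideanSpace ℝ (Fin n) from
      mfderiv (𝓡 n) 𝓘(ℝ, EuclideanSpace ℝ (Fin n)) (extendChart θ φ s) q v)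
      = normalCoord θ s (bundleCoord φ (⟨q, v⟩ : TangentBundle (𝓡 n) N)) := by
  have := mfderiv_chartExtension h hq (G := fun y => s • θ (s⁻¹ • y))
    ((contDiff_smul_comp_inv_smul hθ s).differentiable (by simp) _) v
  exact this.trans (fderiv_smul_comp_inv_smul hθ hs _ _)

end ExtendChart

/-! ## The coordinate normal -/

section CoordNormal

variable {d : ℕ} {N : Type u} [TopologicalSpace N] [T2Space N]
  [ChartedSpace (EuclideanSpace ℝ (Fin (d + 1))) N] [IsManifold (𝓡 (d + 1)) ∞ N]
  [RiemannianBundle (fun q : N => TangentSpace (𝓡 (d + 1)) q)]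
  [IsContMDiffRiemannianBundle (𝓡 (d + 1)) ∞ (EuclideanSpace ℝ (Fin (d + 1)))
        (fun q : N => TangentSpace (𝓡 (d + 1)) q)]
  {φ ψ : OpenPartialHomeomorph N (EuclideanSpace ℝ (Fin (d + 1)))}
  {θ : EuclideanSpace ℝ (Fin (d + 1)) → EuclideanSpace ℝ (Fin (d + 1))} {ε : ℝ}

lemma exists_chartMetric_le (hψ : ψ ∈ IsManifold.maximalAtlas (𝓡 (d + 1)) ∞ N)
    {z₀ : EuclideanSpace ℝ (Fin (d + 1))} (hz₀ : z₀ ∈ ψ.target) :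
    ∃ C : ℝ, 0 ≤ C ∧ ∀ᶠ z in 𝓝 z₀, ∀ a, chartMetric ψ z a a ≤ C * ‖a‖ ^ 2 := by
  have hc : ContinuousAt (fun z => ∑ i, ∑ j, |chartGram ψ z i j|) z₀ := by
    refine tendsto_finsetSum _ fun i _ => tendsto_finsetSum _ fun j _ => ?_
    exact (differentiableAt_chartMetric hψ hz₀ (EuclideanSpace.single i 1)
      (EuclideanSpace.single j 1)).continuousAt.abs
  have h0 : 0 ≤ ∑ i, ∑ j, |chartGram ψ z₀ i j| :=
    Finset.sum_nonneg fun i _ => Finset.sum_nonneg fun j _ => abs_nonneg _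
  refine ⟨∑ i, ∑ j, |chartGram ψ z₀ i j| + 1, by linarith, ?_⟩
  filter_upwards [hc.eventually (gt_mem_nhds (lt_add_one _))] with z hz a
  rw [← chartForm_apply, chartForm_eq_sum]
  calc ∑ i, ∑ j, chartGram ψ z i j * (a i * a j)
      ≤ ∑ i, ∑ j, |chartGram ψ z i j| * ‖a‖ ^ 2 := by
        refine Finset.sum_le_sum fun i _ => Finset.sum_le_sum fun j _ => ?_
        refine (le_abs_self _).trans ?_
        rw [abs_mul, abs_mul, sq]
        have h1 : |a i| ≤ ‖a‖ := PiLp.norm_apply_le a i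
        have h2 : |a j| ≤ ‖a‖ := PiLp.norm_apply_le a j
        gcongr
    _ = (∑ i, ∑ j, |chartGram ψ z i j|) * ‖a‖ ^ 2 := by simp only [Finset.sum_mul]
    _ ≤ _ := by gcongr

/-- Transition maps are isometries between the chart metrics, and the metric in `φ` dominates half
the Euclidean one. The resulting bound depends only on `C`, so it remains uniform up to the boundary
of the domain of `φ`. -/
lemma norm_fderiv_transition_le (hε : 0 < ε) (hε1 : ε < 1) (h : IsAlmostIsometricChart ε φ)
    (hψ : ψ ∈ IsManifold.maximalAtlas (𝓡 (d + 1)) ∞ N) {q : N} (hq : q ∈ φ.source)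
    (hq' : q ∈ ψ.source) {C : ℝ} {a : EuclideanSpace ℝ (Fin (d + 1))} (hC : 0 ≤ C)
    (ha : chartMetric ψ (ψ q) a a ≤ C * ‖a‖ ^ 2) :
    ‖fderiv ℝ (φ ∘ ψ.symm) (ψ q) a‖ ≤ √(2 * C) * ‖a‖ := by
  rw [chartMetric_eq_transition h.mem_atlas hψ hq hq'] at ha
  set b := fderiv ℝ (φ ∘ ψ.symm) (ψ q) a
  by_cases h0 : b = 0
  · rw [h0, norm_zero]
    positivity
  have h1 := h.lower (φ q) (φ.map_source hq) b h0
  rw [one_div, inv_mul_lt_iff₀ (by linarith)] at h1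
  refine (pow_le_pow_iff_left₀ (norm_nonneg _) (by positivity) two_ne_zero).1 ?_
  rw [mul_pow, Real.sq_sqrt (by positivity)]
  have h2 : 0 ≤ C * ‖a‖ ^ 2 := by positivity
  nlinarith

/-- The extension of a chart by a cut-off of the identity has vanishing derivative outside the
domain of the chart. -/
lemma mfderiv_extendChart_of_notMem (hθ : IsIdentityCutoff θ) (hε : 0 < ε) (hε1 : ε < 1)
    (h : IsAlmostIsometricChart ε φ) {r : ℝ} (hr : 0 < r)
    (hrt : Metric.ball (0 : EuclideanSpace ℝ (Fin (d + 1))) (2 * r) ⊆ φ.target) {q : N}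
    (hq : q ∉ φ.source) (v : TangentSpace (𝓡 (d + 1)) q) :
    (show EuclideanSpace ℝ (Fin (d + 1)) from
      mfderiv (𝓡 (d + 1)) 𝓘(ℝ, EuclideanSpace ℝ (Fin (d + 1))) (extendChart θ φ r) q v) = 0 := by
  -- At a point of non-differentiability `mfderiv` is zero by convention.
  by_cases hdiff : MDifferentiableAt (𝓡 (d + 1)) 𝓘(ℝ, EuclideanSpace ℝ (Fin (d + 1)))
    (extendChart θ φ r) q
  swap
  · rw [mfderiv_zero_of_not_mdifferentiableAt hdiff]
    rfl
  set ψ := chartAt (EuclideanSpace ℝ (Fin (d + 1))) q with hψdef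
  have hψ : ψ ∈ IsManifold.maximalAtlas (𝓡 (d + 1)) ∞ N := IsManifold.chart_mem_maximalAtlas _
  have hqψ : q ∈ ψ.source := mem_chart_source _ _
  set z₀ := ψ q with hz₀
  have hz₀t : z₀ ∈ ψ.target := ψ.map_source hqψ
  have hsymm : ψ.symm z₀ = q := ψ.left_inv hqψ
  set g : ℝ → EuclideanSpace ℝ (Fin (d + 1)) → EuclideanSpace ℝ (Fin (d + 1)) :=
    fun s => extendChart θ φ s ∘ ψ.symm with hg
  have hg0 : ∀ s, g s z₀ = 0 := by
    intro s
    simp [hg, hsymm, extendChart, hq]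
  have hlim : ∀ z, Filter.Tendsto (fun s => g s z) (𝓝[<] r) (𝓝 (g r z)) := by
    intro z
    simp only [hg, Function.comp, extendChart]
    split_ifs
    · have h1 : Filter.Tendsto (fun s : ℝ => s) (𝓝[<] r) (𝓝 r) := nhdsWithin_le_nhds
      exact h1.smul ((hθ.contDiff.continuous.tendsto _).comp ((h1.inv₀ hr.ne').smul_const _))
    · exact tendsto_const_nhds
  -- For `ρ < r` the closed coordinate ball of radius `2ρ` is compact in the chart domain, hence
  -- closed in the Hausdorff space `N`. Points outside the domain have a neighbourhood avoiding it.
  have hcls : ∀ ρ, ρ < r → IsClosed (φ.symm '' Metric.closedBall 0 (2 * ρ)) ∧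
      φ.symm '' Metric.closedBall 0 (2 * ρ) ⊆ φ.source := by
    intro ρ hρ
    have hsub : Metric.closedBall (0 : EuclideanSpace ℝ (Fin (d + 1))) (2 * ρ) ⊆ φ.target :=
      (Metric.closedBall_subset_ball (by linarith)).trans hrt
    refine ⟨(isCompact_symm_image (isCompact_closedBall _ _) hsub).isClosed, ?_⟩
    rintro _ ⟨y, hy, rfl⟩
    exact φ.map_target (hsub hy)
  -- In the chart `ψ`, the extensions `g s` with `s < r` are shown to be Lipschitz with a small
  -- constant `c` on a ball independent of `s`. The estimate passes to `g r` as `s` increases to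
  -- `r`.
  have hmain : HasFDerivAt (g r)
      (0 : EuclideanSpace ℝ (Fin (d + 1)) →L[ℝ] EuclideanSpace ℝ (Fin (d + 1))) z₀ := by
    obtain ⟨C, hC0, hC⟩ := exists_chartMetric_le hψ hz₀t
    refine HasFDerivAt.of_isLittleO (Asymptotics.isLittleO_iff.2 fun c hc => ?_)
    have hD : 0 < √(2 * C) + 1 := by positivity
    -- The factor `√(2 * C) + 1` bounds the transition map and is nonzero even if `C = 0`. The
    -- radius in the next line makes `‖φ‖ > (2 - δ) r` at nearby points of the chart domain, so that
    -- `Dθ(φ / s)` is small for every `s < r`.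
    obtain ⟨δ, hδ0, hδ2, hδ⟩ := hθ.exists_norm_fderiv_le (η := c / (√(2 * C) + 1)) (by positivity)
    obtain ⟨hcl, hcs⟩ := hcls ((1 - δ / 2) * r) (by nlinarith)
    have hfar : ∀ᶠ z in 𝓝 z₀, z ∈ ψ.target ∧
        ψ.symm z ∈ (φ.symm '' Metric.closedBall 0 (2 * ((1 - δ / 2) * r)))ᶜ := by
      have ht : ∀ᶠ z in 𝓝 z₀, z ∈ ψ.target := ψ.open_target.mem_nhds hz₀t
      refine ht.and ?_
      refine (ψ.symm.continuousAt hz₀t).eventually_mem (hcl.isOpen_compl.mem_nhds ?_)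
      rw [hsymm]
      exact fun hq' => hq (hcs hq')
    obtain ⟨ρ, hρ, hball⟩ := Metric.eventually_nhds_iff_ball.1 (hC.and hfar)
    have hder : ∀ s ∈ Ioo 0 r, ∀ z ∈ Metric.ball z₀ ρ, DifferentiableAt ℝ (g s) z ∧
        ‖fderiv ℝ (g s) z‖ ≤ c := by
      rintro s ⟨hs0, hsr⟩ z hz
      obtain ⟨hCz, hzt, hzf⟩ := hball z hz
      have hψz : ψ (ψ.symm z) = z := ψ.right_inv hzt
      by_cases hzs : ψ.symm z ∈ φ.source
      · have hcd := contDiffAt_transition h.mem_atlas hψ hzs (ψ.map_target hzt)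
        rw [hψz] at hcd
        have hτ := (hcd.differentiableAt (by simp)).hasFDerivAt
        have e1 : g s =ᶠ[𝓝 z] (fun y => s • θ (s⁻¹ • y)) ∘ (φ ∘ ψ.symm) := by
          have : ψ.target ∩ ψ.symm ⁻¹' φ.source ∈ 𝓝 z :=
            (ψ.symm.isOpen_inter_preimage φ.open_source).mem_nhds ⟨hzt, hzs⟩
          filter_upwards [this] with y hy
          have hy2 : ψ.symm y ∈ φ.source := hy.2
          simp [hg, extendChart, hy2]
        have h1 : HasFDerivAt ((fun y => s • θ (s⁻¹ • y)) ∘ (φ ∘ ψ.symm)) _ z :=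
          HasFDerivAt.comp z (((contDiff_smul_comp_inv_smul hθ s).differentiable (by simp)
            ((φ ∘ ψ.symm) z)).hasFDerivAt) hτ
        refine ⟨h1.differentiableAt.congr_of_eventuallyEq e1, ?_⟩
        rw [e1.fderiv_eq, h1.fderiv]
        refine ContinuousLinearMap.opNorm_le_bound _ hc.le fun a => ?_
        rw [ContinuousLinearMap.comp_apply, fderiv_smul_comp_inv_smul hθ hs0.ne']
        have hnorm : (2 - δ) * r < ‖(φ ∘ ψ.symm) z‖ := by
          by_contra! hle
          refine hzf ⟨φ (ψ.symm z), ?_, φ.left_inv hzs⟩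
          rw [mem_closedBall_zero_iff]
          refine hle.trans (le_of_eq (by ring))
        have hθz : ‖fderiv ℝ θ (s⁻¹ • (φ ∘ ψ.symm) z)‖ ≤ c / (√(2 * C) + 1) := by
          apply hδ
          rw [norm_smul, Real.norm_of_nonneg (by positivity), inv_mul_eq_div, le_div_iff₀ hs0]
          nlinarith
        have hτa := norm_fderiv_transition_le hε hε1 h hψ hzs (ψ.map_target hzt) hC0
          (a := a) (by rw [hψz]; exact hCz a)
        rw [hψz] at hτa
        calc _ ≤ ‖fderiv ℝ θ (s⁻¹ • (φ ∘ ψ.symm) z)‖ * ‖fderiv ℝ (φ ∘ ψ.symm) z a‖ :=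
              ContinuousLinearMap.le_opNorm _ _
          _ ≤ c / (√(2 * C) + 1) * ((√(2 * C) + 1) * ‖a‖) := by
              gcongr
              refine hτa.trans ?_
              gcongr
              linarith
          _ = c * ‖a‖ := by field_simp
      · obtain ⟨hcl', hcs'⟩ := hcls s hsr
        have e1 : g s =ᶠ[𝓝 z] fun _ => 0 := by
          have : ∀ᶠ y in 𝓝 z, ψ.symm y ∈ (φ.symm '' Metric.closedBall 0 (2 * s))ᶜ :=
            (ψ.symm.continuousAt hzt).eventually_mem
              (hcl'.isOpen_compl.mem_nhds fun h' => hzs (hcs' h'))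
          filter_upwards [this] with y hy
          simp only [hg, Function.comp, extendChart]
          split_ifs with hys
          · rw [hθ.eq_zero, smul_zero]
            rw [mem_ball_zero_iff, norm_smul, Real.norm_of_nonneg (by positivity), inv_mul_eq_div,
              div_lt_iff₀ hs0]
            intro hlt
            exact hy ⟨φ (ψ.symm y), mem_closedBall_zero_iff.2 hlt.le, φ.left_inv hys⟩
          · rfl
        refine ⟨(differentiableAt_const _).congr_of_eventuallyEq e1, ?_⟩
        rw [e1.fderiv_eq]
        simpa using hc.le
    filter_upwards [Metric.ball_mem_nhds z₀ hρ] with z hz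
    have hle : ∀ᶠ s in 𝓝[<] r, ‖g s z‖ ≤ c * ‖z - z₀‖ := by
      filter_upwards [Ioo_mem_nhdsLT hr] with s hs
      have := (convex_ball z₀ ρ).norm_image_sub_le_of_norm_fderiv_le (𝕜 := ℝ) (f := g s) (C := c)
        (fun y hy => (hder s hs y hy).1) (fun y hy => (hder s hs y hy).2)
        (Metric.mem_ball_self hρ) hz
      rwa [hg0, sub_zero] at this
    have := le_of_tendsto (hlim z).norm hle
    simpa [hg0] using this
  -- The chain rule moves the vanishing derivative from the chart `ψ` back to `N`, since `dψ.symm`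
  -- inverts `dψ`.
  have h1 : HasMFDerivAt (𝓡 (d + 1)) 𝓘(ℝ, EuclideanSpace ℝ (Fin (d + 1))) (extendChart θ φ r)
      (ψ.symm z₀) (mfderiv (𝓡 (d + 1)) 𝓘(ℝ, EuclideanSpace ℝ (Fin (d + 1)))
        (extendChart θ φ r) (ψ.symm z₀)) := by
    rw [hsymm]
    exact hdiff.hasMFDerivAt
  have h2 := ((OpenPartialHomeomorph.mdifferentiable_of_mem_maximalAtlas hψ).mdifferentiableAt_symm
    hz₀t).hasMFDerivAt
  have h3 := (h1.comp z₀ h2).mfderiv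
  rw [mfderiv_eq_fderiv] at h3
  have h4 : fderiv ℝ (extendChart θ φ r ∘ ψ.symm) z₀ = 0 := hmain.fderiv
  rw [h4] at h3
  have h5 := congrArg (fun L => L (mfderiv (𝓡 (d + 1)) 𝓘(ℝ, EuclideanSpace ℝ (Fin (d + 1))) ψ q v)) h3
  have h6 := mfderiv_symm_mfderiv hψ hqψ v
  rw [hsymm] at h5
  refine Eq.trans ?_ h5.symm
  exact congrArg (fun w => mfderiv (𝓡 (d + 1)) 𝓘(ℝ, EuclideanSpace ℝ (Fin (d + 1)))
    (extendChart θ φ r) q w) h6.symm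

variable {u : EuclideanSpace ℝ (Fin d) → N}
  {du : ∀ x, EuclideanSpace ℝ (Fin d) →L[ℝ] TangentSpace (𝓡 (d + 1)) (u x)}
  {ν : ∀ x, TangentSpace (𝓡 (d + 1)) (u x)}
  {dν : ∀ x, EuclideanSpace ℝ (Fin d) →L[ℝ]
    TangentSpace (𝓡 (d + 1)).tangent (⟨u x, ν x⟩ : TangentBundle (𝓡 (d + 1)) N)}

open Classical in
lemma coordNormal_eq (hθ : IsIdentityCutoff θ) (hε : 0 < ε) (hε1 : ε < 1)
    (h : IsAlmostIsometricChart ε φ) {r : ℝ} (hr : 0 < r)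
    (hrt : Metric.ball (0 : EuclideanSpace ℝ (Fin (d + 1))) (2 * r) ⊆ φ.target)
    (x : EuclideanSpace ℝ (Fin d)) :
    coordNormal θ φ r u ν x = if u x ∈ φ.source then
      normalCoord θ r (bundleCoord φ (⟨u x, ν x⟩ : TangentBundle (𝓡 (d + 1)) N)) else 0 := by
  split_ifs with hx
  · exact mfderiv_extendChart hθ h.mem_atlas hr.ne' hx (ν x)
  · exact mfderiv_extendChart_of_notMem hθ hε hε1 h hr hrt hx (ν x)

open Classical in
/-- The weak derivative of the coordinate normal. -/
noncomputable def coordNormalDeriv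
    (θ : EuclideanSpace ℝ (Fin (d + 1)) → EuclideanSpace ℝ (Fin (d + 1)))
    (φ : OpenPartialHomeomorph N (EuclideanSpace ℝ (Fin (d + 1)))) (s : ℝ)
    (dν : ∀ x, EuclideanSpace ℝ (Fin d) →L[ℝ]
      TangentSpace (𝓡 (d + 1)).tangent (⟨u x, ν x⟩ : TangentBundle (𝓡 (d + 1)) N))
    (x : EuclideanSpace ℝ (Fin d)) :
    EuclideanSpace ℝ (Fin d) →L[ℝ] EuclideanSpace ℝ (Fin (d + 1)) :=
  if u x ∈ φ.source then
    (normalCoordDeriv θ s (bundleCoord φ ⟨u x, ν x⟩)).comp (bundleVelocity φ dν x)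
  else 0

open Classical in
-- The bound is stated for all radii `s ≤ r`, since it serves both as the majorant in the limit and
-- as the final pointwise estimate. Only the connector part of `dν` enters, not its full Sasaki
-- norm.
lemma norm_coordNormalDeriv_apply_le (hθ : IsIdentityCutoff θ) {M : ℝ}
    (hM0 : 0 ≤ M) (hM : ∀ z, ‖fderiv ℝ θ z‖ ≤ M) (hM' : ∀ z, ‖fderiv ℝ (fderiv ℝ θ) z‖ ≤ M)
    (hε : 0 < ε) (hε1 : ε < 1) (h : IsAlmostIsometricChart ε φ) {s r : ℝ} (hs : 0 < s) (hsr : s ≤ r)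
    {x : EuclideanSpace ℝ (Fin d)} (hν : ‖ν x‖ ≤ 1)
    (hx : u x ∈ φ.source → ‖φ (u x)‖ < 2 * r →
      ∀ v, (bundleVelocity φ dν x v).1 = chartVelocity φ du x v) (v : EuclideanSpace ℝ (Fin d)) :
    ‖coordNormalDeriv θ φ s dν x v‖ ≤ (2 * M * (d + 1) ^ 3) *
      (((if u x ∈ φ.source ∧ ‖φ (u x)‖ < s then 0 else s⁻¹) + 1) * ‖du x v‖
        + ‖connector (⟨u x, ν x⟩ : TangentBundle (𝓡 (d + 1)) N) (dν x v)‖) := by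
  set e : TangentBundle (𝓡 (d + 1)) N := ⟨u x, ν x⟩ with he
  set c : ℝ := if u x ∈ φ.source ∧ ‖φ (u x)‖ < s then 0 else s⁻¹ with hcdef
  have hc0 : 0 ≤ c := by
    rw [hcdef]
    split_ifs <;> positivity
  have hrhs : 0 ≤ (2 * M * (d + 1) ^ 3) * ((c + 1) * ‖du x v‖ + ‖connector e (dν x v)‖) := by
    positivity
  by_cases hxs : u x ∈ φ.source
  swap
  · rw [coordNormalDeriv, if_neg hxs]
    simpa using hrhs
  -- Beyond radius `2 * s` the derivative is zero; inside, `s ≤ r` makes the identification of the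
  -- horizontal velocity available.
  by_cases hfar : 2 * s ≤ ‖φ (u x)‖
  · have : normalCoordDeriv θ s (bundleCoord φ e) = 0 := normalCoordDeriv_eq_zero hθ hs hfar
    rw [coordNormalDeriv, if_pos hxs, this]
    simpa using hrhs
  push Not at hfar
  have hY := hx hxs (hfar.trans_le (by linarith)) v
  set Y := (bundleVelocity φ dν x v).1 with hYdef
  have hYn : ‖Y‖ ≤ √2 * ‖du x v‖ := by
    rw [hY]
    exact norm_mfderiv_le_of_isAlmostIsometricChart hε hε1 h hxs (du x v)
  have hwn : ‖fiberCoord φ e‖ ≤ √2 :=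
    (norm_mfderiv_le_of_isAlmostIsometricChart hε hε1 h hxs (ν x)).trans
      (mul_le_of_le_one_right (by positivity) hν)
  have hYw : ‖Y‖ * ‖fiberCoord φ e‖ ≤ 2 * ‖du x v‖ := by
    calc ‖Y‖ * ‖fiberCoord φ e‖ ≤ (√2 * ‖du x v‖) * √2 := by gcongr
      _ = (√2 * √2) * ‖du x v‖ := by ring
      _ = _ := by rw [Real.mul_self_sqrt (by norm_num)]
  have hW : ‖(bundleVelocity φ dν x v).2‖ ≤
      √2 * ‖connector e (dν x v)‖ + (d + 1) ^ 3 * (2 * ‖du x v‖) := by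
    -- The vertical coordinate is the connector minus the Christoffel term, and the latter costs
    -- only a multiple of `‖du x v‖`.
    have h1 : (bundleVelocity φ dν x v).2 = _ := fiberVelocity_eq h.mem_atlas (e := e) hxs (dν x v)
    rw [h1]
    refine (norm_sub_le _ _).trans (add_le_add ?_ ?_)
    · exact norm_mfderiv_le_of_isAlmostIsometricChart hε hε1 h hxs _
    · refine (norm_christoffelForm_le hε1 h (φ.map_source hxs) _ _).trans ?_
      exact mul_le_mul_of_nonneg_left hYw (by positivity)
  have hmain := norm_normalCoordDeriv_le hθ hM hM' hs (bundleCoord φ e) (bundleVelocity φ dν x v)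
  have hcc : (if ‖(bundleCoord φ e).1‖ < s then 0 else s⁻¹) = c := by
    simp only [hcdef, hxs, true_and]
    rfl
  rw [hcc] at hmain
  rw [coordNormalDeriv, if_pos hxs]
  refine hmain.trans ?_
  have hsqrt2 : √2 ≤ 2 := by
    rw [Real.sqrt_le_left (by norm_num)]
    norm_num
  have hd : (1 : ℝ) ≤ (d + 1) ^ 3 := one_le_pow₀ (by linarith [Nat.cast_nonneg (α := ℝ) d])
  set D := ‖du x v‖
  set K := ‖connector e (dν x v)‖
  have hD : 0 ≤ D := norm_nonneg _
  have hK : 0 ≤ K := norm_nonneg _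
  calc c * (M * (‖Y‖ * ‖(bundleCoord φ e).2‖)) + M * ‖(bundleVelocity φ dν x v).2‖
      ≤ c * (M * (2 * D)) + M * (2 * K + (d + 1) ^ 3 * (2 * D)) := by
        have hW' : ‖(bundleVelocity φ dν x v).2‖ ≤ 2 * K + (d + 1) ^ 3 * (2 * D) :=
          hW.trans (by gcongr)
        exact add_le_add (mul_le_mul_of_nonneg_left (mul_le_mul_of_nonneg_left hYw hM0) hc0)
          (mul_le_mul_of_nonneg_left hW' hM0)
    _ = (2 * M) * (c * D * 1 + K * 1 + (d + 1) ^ 3 * D) := by ring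
    _ ≤ (2 * M) * (c * D * (d + 1) ^ 3 + K * (d + 1) ^ 3 + (d + 1) ^ 3 * D) := by gcongr
    _ = _ := by ring

end CoordNormal

/-! ## Estimates for the coordinate normal of a Sobolev immersion -/

section Estimates

variable {d : ℕ} {N : Type u} [TopologicalSpace N] [T2Space N]
  [ChartedSpace (EuclideanSpace ℝ (Fin (d + 1))) N] [IsManifold (𝓡 (d + 1)) ∞ N]
  [RiemannianBundle (fun q : N => TangentSpace (𝓡 (d + 1)) q)]
  [IsContMDiffRiemannianBundle (𝓡 (d + 1)) ∞ (EuclideanSpace ℝ (Fin (d + 1)))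
        (fun q : N => TangentSpace (𝓡 (d + 1)) q)]
  {φ : OpenPartialHomeomorph N (EuclideanSpace ℝ (Fin (d + 1)))}
  {θ : EuclideanSpace ℝ (Fin (d + 1)) → EuclideanSpace ℝ (Fin (d + 1))} {ε : ℝ}
  {Q : Set (EuclideanSpace ℝ (Fin d))} {u : EuclideanSpace ℝ (Fin d) → N}
  {du : ∀ x, EuclideanSpace ℝ (Fin d) →L[ℝ] TangentSpace (𝓡 (d + 1)) (u x)}
  {ν : ∀ x, TangentSpace (𝓡 (d + 1)) (u x)}
  {dν : ∀ x, EuclideanSpace ℝ (Fin d) →L[ℝ]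
    TangentSpace (𝓡 (d + 1)).tangent (⟨u x, ν x⟩ : TangentBundle (𝓡 (d + 1)) N)}

lemma IsOrientedUnitNormal.norm_le_one {o : ManifoldOrientation d N} {q : N}
    {L : EuclideanSpace ℝ (Fin d) →L[ℝ] TangentSpace (𝓡 (d + 1)) q}
    {n : TangentSpace (𝓡 (d + 1)) q} (h : IsOrientedUnitNormal o L n) : ‖n‖ ≤ 1 := by
  have hle : Module.finrank ℝ (LinearMap.range L.toLinearMap) ≤ d := by
    have := LinearMap.finrank_range_le L.toLinearMap
    rwa [finrank_euclideanSpace_fin] at this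
  rcases hle.eq_or_lt with h1 | h1
  · exact (h.1 h1).1.le
  · rw [h.2 h1, norm_zero]
    exact zero_le_one

lemma norm_fiberCoord_le (hε : 0 < ε) (hε1 : ε < 1) (h : IsAlmostIsometricChart ε φ)
    {e : TangentBundle (𝓡 (d + 1)) N} (he : e.proj ∈ φ.source) (hn : ‖e.snd‖ ≤ 1) :
    ‖fiberCoord φ e‖ ≤ 2 := by
  refine (norm_mfderiv_le_of_isAlmostIsometricChart hε hε1 h he e.snd).trans ?_
  refine (mul_le_of_le_one_right (by positivity) hn).trans ?_
  rw [Real.sqrt_le_left (by norm_num)]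
  norm_num

/-- The Frobenius norm of the vertical part `K ∘ dν`. -/
noncomputable def connectorNorm (dν : ∀ x, EuclideanSpace ℝ (Fin d) →L[ℝ]
      TangentSpace (𝓡 (d + 1)).tangent (⟨u x, ν x⟩ : TangentBundle (𝓡 (d + 1)) N))
    (x : EuclideanSpace ℝ (Fin d)) : ℝ :=
  frobeniusNorm (fun ξ => ‖connector (⟨u x, ν x⟩ : TangentBundle (𝓡 (d + 1)) N) ξ‖) (dν x)

lemma connectorNorm_le (x : EuclideanSpace ℝ (Fin d)) :
    connectorNorm dν x ≤ frobeniusNorm (sasakiNorm ⟨u x, ν x⟩) (dν x) := by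
  have := frobeniusNorm_le_of_forall (a := 1) (b := 0) zero_le_one le_rfl
    (n₁ := fun ξ => ‖connector (⟨u x, ν x⟩ : TangentBundle (𝓡 (d + 1)) N) ξ‖)
    (n₂ := sasakiNorm ⟨u x, ν x⟩) (n₃ := sasakiNorm ⟨u x, ν x⟩)
    (L₁ := dν x) (L₂ := dν x) (L₃ := dν x) (fun _ => norm_nonneg _) (fun i => ?_)
  · simpa [connectorNorm] using this
  · rw [one_mul, zero_mul, add_zero]
    refine Real.le_sqrt_of_sq_le ?_
    have := sq_nonneg ‖dProj (⟨u x, ν x⟩ : TangentBundle (𝓡 (d + 1)) N)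
      (dν x (EuclideanSpace.single i 1))‖
    linarith

open Classical in
lemma frobeniusNorm_coordNormalDeriv_le (hθ : IsIdentityCutoff θ) {M : ℝ}
    (hM0 : 0 ≤ M) (hM : ∀ z, ‖fderiv ℝ θ z‖ ≤ M) (hM' : ∀ z, ‖fderiv ℝ (fderiv ℝ θ) z‖ ≤ M)
    (hε : 0 < ε) (hε1 : ε < 1) (h : IsAlmostIsometricChart ε φ) {s r : ℝ} (hs : 0 < s) (hsr : s ≤ r)
    {x : EuclideanSpace ℝ (Fin d)} (hν : ‖ν x‖ ≤ 1)
    (hx : u x ∈ φ.source → ‖φ (u x)‖ < 2 * r →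
      ∀ v, (bundleVelocity φ dν x v).1 = chartVelocity φ du x v) :
    frobeniusNorm (fun t : EuclideanSpace ℝ (Fin (d + 1)) => ‖t‖) (coordNormalDeriv θ φ s dν x) ≤
      (2 * M * (d + 1) ^ 3) *
      (((if u x ∈ φ.source ∧ ‖φ (u x)‖ < s then 0 else s⁻¹) + 1) * derivNorm (du x)
        + connectorNorm dν x) := by
  set c : ℝ := if u x ∈ φ.source ∧ ‖φ (u x)‖ < s then 0 else s⁻¹ with hcdef
  have hc0 : 0 ≤ c := by
    rw [hcdef]
    split_ifs <;> positivity
  set A := 2 * M * (d + 1) ^ 3 with hA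
  have hA0 : 0 ≤ A := by positivity
  have := frobeniusNorm_le_of_forall (a := A * (c + 1)) (b := A) (by positivity) hA0
    (n₁ := fun t : EuclideanSpace ℝ (Fin (d + 1)) => ‖t‖)
    (n₂ := fun t : TangentSpace (𝓡 (d + 1)) (u x) => ‖t‖)
    (n₃ := fun ξ => ‖connector (⟨u x, ν x⟩ : TangentBundle (𝓡 (d + 1)) N) ξ‖)
    (L₁ := coordNormalDeriv θ φ s dν x) (L₂ := du x) (L₃ := dν x) (fun _ => norm_nonneg _)
    (fun i => ?_)
  · refine this.trans (le_of_eq ?_)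
    rw [derivNorm, connectorNorm]
    ring
  · refine (norm_coordNormalDeriv_apply_le hθ hM0 hM hM' hε hε1 h hs hsr hν hx _).trans
      (le_of_eq ?_)
    ring

open Classical in
/-- The coordinate normal for a smaller radius is weakly differentiable. -/
lemma hasWeakDeriv_normalCoord (hθ : IsIdentityCutoff θ) (hQ : MeasurableSet Q)
    (hdν : IsColocalWeakDeriv (𝓡 (d + 1)).tangent Q
      (fun x => (⟨u x, ν x⟩ : TangentBundle (𝓡 (d + 1)) N)) dν)
    (h : φ ∈ IsManifold.maximalAtlas (𝓡 (d + 1)) ∞ N)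
    (hw : ∀ x ∈ Q, u x ∈ φ.source →
      ‖fiberCoord φ (⟨u x, ν x⟩ : TangentBundle (𝓡 (d + 1)) N)‖ ≤ 2)
    {s r : ℝ} (hs : 0 < s) (hsr : s < r)
    (hrt : Metric.ball (0 : EuclideanSpace ℝ (Fin (d + 1))) (2 * r) ⊆ φ.target) :
    HasWeakDeriv Q (fun x => if u x ∈ φ.source then
      normalCoord θ s (bundleCoord φ (⟨u x, ν x⟩ : TangentBundle (𝓡 (d + 1)) N)) else 0)
      (coordNormalDeriv θ φ s dν) := by
  set κ := fiberCutoff (d + 1)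
  set G : EuclideanSpace ℝ (Fin (d + 1)) × EuclideanSpace ℝ (Fin (d + 1)) →
    EuclideanSpace ℝ (Fin (d + 1)) := fun z => κ z.2 • normalCoord θ s z with hG
  have c : ContDiff ℝ 1 G :=
    (κ.contDiff.comp contDiff_snd).smul ((hθ.contDiff_normalCoord s).of_le (by simp))
  -- Here `s < r` matters: the closed ball of radius `2 * s` lies in the open ball of radius `2 *
  -- r`, hence in the image of `φ`.
  obtain ⟨k, hsub⟩ := hasCompactSupport_prod_of_subset (G := G)
    (isCompact_closedBall 0 (2 * s)) κ.hasCompactSupport (fun z hz => by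
      refine ⟨?_, subset_tsupport _ fun h0 => hz (by simp [hG, h0])⟩
      rw [mem_closedBall_zero_iff]
      by_contra! hlt
      refine hz ?_
      have : 2 ≤ ‖s⁻¹ • z.1‖ := by
        rw [norm_smul, Real.norm_of_nonneg (by positivity), inv_mul_eq_div, le_div_iff₀ hs]
        exact hlt.le
      simp [hG, normalCoord, hθ.fderiv_eq_zero this])
  refine (hdν.hasWeakDeriv_bundleExtension hQ h c k (hsub.trans (prod_mono_left
    ((Metric.closedBall_subset_ball (by linarith)).trans hrt)))).congr hQ ?_ ?_
  · intro x hx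
    by_cases hxs : u x ∈ φ.source
    · have : κ (fiberCoord φ ⟨u x, ν x⟩) = 1 := (fiberCutoff_eventuallyEq (hw x hx hxs)).eq_of_nhds
      simp [bundleExtension, hxs, hG, bundleCoord, this]
    · simp [bundleExtension, hxs]
  · intro x hx
    by_cases hxs : u x ∈ φ.source
    · have e : G =ᶠ[𝓝 (bundleCoord φ ⟨u x, ν x⟩)] normalCoord θ s := by
        filter_upwards [(continuous_snd.tendsto (bundleCoord φ ⟨u x, ν x⟩)).eventually
          (fiberCutoff_eventuallyEq (hw x hx hxs))] with z hz
        simp [hG, κ, hz]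
      simp only [coordNormalDeriv, if_pos hxs]
      rw [e.fderiv_eq, hθ.fderiv_normalCoord]
    · simp [coordNormalDeriv, hxs]

/-- The set where `u` takes values in the coordinate ball of radius `r` is measurable. -/
lemma nullMeasurableSet_coordinate_ball (hQ : MeasurableSet Q)
    (hdu : IsColocalWeakDeriv (𝓡 (d + 1)) Q u du)
    (h : φ ∈ IsManifold.maximalAtlas (𝓡 (d + 1)) ∞ N) {r : ℝ} (hr : 0 < r)
    (hrt : Metric.ball (0 : EuclideanSpace ℝ (Fin (d + 1))) (2 * r) ⊆ φ.target) :
    NullMeasurableSet {x | u x ∈ φ.source ∧ ‖φ (u x)‖ < r} (volume.restrict Q) := by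
  -- No measurability of `u` is assumed; it is read off from the local integrability of a bump
  -- composed with `u`. The support of the bump is exactly the open ball of radius `r`. Its values
  -- lie in a one-dimensional Euclidean space to fit `hasWeakDeriv_chartExtension`.
  let χ : ContDiffBump (0 : EuclideanSpace ℝ (Fin (d + 1))) :=
    ⟨r / 2, r, by positivity, by linarith⟩
  set a : EuclideanSpace ℝ (Fin 1) := EuclideanSpace.single 0 1
  have ha : a ≠ 0 := by simp [a]
  set G : EuclideanSpace ℝ (Fin (d + 1)) → EuclideanSpace ℝ (Fin 1) := fun y => χ y • a with hG
  have hsub : tsupport G ⊆ Metric.closedBall 0 r := by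
    refine (closure_mono ?_).trans χ.tsupport_eq.subset
    intro y hy h0
    exact hy (by simp [hG, h0])
  have hw := hdu.hasWeakDeriv_chartExtension hQ h (G := G) (χ.contDiff.smul contDiff_const)
    ((isCompact_closedBall _ _).of_isClosed_subset (isClosed_tsupport _) hsub)
    (hsub.trans ((Metric.closedBall_subset_ball (by linarith)).trans hrt))
  have hm := hw.1.aestronglyMeasurable.aemeasurable
  have hs : {x | u x ∈ φ.source ∧ ‖φ (u x)‖ < r} =
      (fun x => chartExtension φ G (u x)) ⁻¹' {0}ᶜ := by
    ext x
    have hχ : ‖φ (u x)‖ < r ↔ χ (φ (u x)) ≠ 0 := by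
      rw [← Function.mem_support, χ.support_eq, mem_ball_zero_iff]
    by_cases hxs : u x ∈ φ.source
    · simp [chartExtension, hxs, hχ, hG, ha]
    · simp [chartExtension, hxs]
  rw [hs]
  exact hm.nullMeasurableSet_preimage (measurableSet_singleton _).compl

lemma add_three_rpow_le {p a b c : ℝ} (hp : 0 ≤ p) (ha : 0 ≤ a) (hb : 0 ≤ b) (hc : 0 ≤ c) :
    (a + b + c) ^ p ≤ 3 ^ p * (a ^ p + b ^ p + c ^ p) := by
  have h1 : a + b + c ≤ 3 * max (max a b) c := by
    linarith [le_max_left (max a b) c, le_max_right (max a b) c, le_max_left a b, le_max_right a b]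
  have hm : 0 ≤ max (max a b) c := le_max_of_le_right hc
  calc (a + b + c) ^ p ≤ (3 * max (max a b) c) ^ p := Real.rpow_le_rpow (by positivity) h1 hp
    _ = 3 ^ p * (max (max a b) c) ^ p := Real.mul_rpow (by norm_num) hm
    _ ≤ _ := by
        refine mul_le_mul_of_nonneg_left ?_ (by positivity)
        have pa := Real.rpow_nonneg ha p
        have pb := Real.rpow_nonneg hb p
        have pc := Real.rpow_nonneg hc p
        rcases max_choice (max a b) c with h | h
        · rcases max_choice a b with h' | h' <;> rw [h, h'] <;> linarith
        · rw [h]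
          linarith

end Estimates

/-! ### Passage to the limit in the radius and integration of the pointwise bound. -/

theorem lemma3p4 (d : ℕ) (p : ℝ) (hp : 1 < p)
    (θ : EuclideanSpace ℝ (Fin (d + 1)) → EuclideanSpace ℝ (Fin (d + 1)))
    (hθ : IsIdentityCutoff θ) :
    ∃ C : ℝ≥0, ∀ (N : Type u) [TopologicalSpace N] [T2Space N] [SecondCountableTopology N]
      [ChartedSpace (EuclideanSpace ℝ (Fin (d + 1))) N] [IsManifold (𝓡 (d + 1)) ∞ N]
      [RiemannianBundle (fun q : N => TangentSpace (𝓡 (d + 1)) q)]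
      [IsContMDiffRiemannianBundle (𝓡 (d + 1)) ∞ (EuclideanSpace ℝ (Fin (d + 1)))
        (fun q : N => TangentSpace (𝓡 (d + 1)) q)]
      (o : ManifoldOrientation d N)
      (ε : ℝ) (_ : 0 < ε) (_ : ε < 1)
      (φ : OpenPartialHomeomorph N (EuclideanSpace ℝ (Fin (d + 1))))
      (_ : IsAlmostIsometricChart ε φ)
      (r : ℝ) (_ : 0 < r)
      (_ : Metric.ball (0 : EuclideanSpace ℝ (Fin (d + 1))) (2 * r) ⊆ φ.target)
      (Q : Set (EuclideanSpace ℝ (Fin d))) (_ : IsOpenCube Q)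
      (u : EuclideanSpace ℝ (Fin d) → N)
      (du : ∀ x, EuclideanSpace ℝ (Fin d) →L[ℝ] TangentSpace (𝓡 (d + 1)) (u x))
      (ν : ∀ x, TangentSpace (𝓡 (d + 1)) (u x))
      (dν : ∀ x, EuclideanSpace ℝ (Fin d) →L[ℝ]
        TangentSpace (𝓡 (d + 1)).tangent (⟨u x, ν x⟩ : TangentBundle (𝓡 (d + 1)) N))
      (_ : IsSobolevImmersion p o Q u du ν dν)
      (F : Set (EuclideanSpace ℝ (Fin d)))
      (_ : F = {x ∈ Q | u x ∈ φ.source ∧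
        φ (u x) ∈ Metric.ball (0 : EuclideanSpace ℝ (Fin (d + 1))) r}),
      MemLp (coordNormal θ φ r u ν) (ENNReal.ofReal p) (volume.restrict Q) ∧
      ∃ Dn : EuclideanSpace ℝ (Fin d) →
          EuclideanSpace ℝ (Fin d) →L[ℝ] EuclideanSpace ℝ (Fin (d + 1)),
        HasWeakDeriv Q (coordNormal θ φ r u ν) Dn ∧
        MemLp Dn (ENNReal.ofReal p) (volume.restrict Q) ∧
        ∫⁻ x in Q, ENNReal.ofReal (frobeniusNorm (fun t : EuclideanSpace ℝ (Fin (d + 1)) => ‖t‖) (Dn x) ^ p) ≤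
          C * (ENNReal.ofReal (1 / r ^ p) *
                (∫⁻ x in Q \ F, ENNReal.ofReal (derivNorm (du x) ^ p))
              + (∫⁻ x in Q, ENNReal.ofReal (derivNorm (du x) ^ p))
              + bendingEnergy p Q u ν dν) := by
  classical
  obtain ⟨M, hM0, hM, hM'⟩ := hθ.exists_bound
  set A : ℝ := 2 * M * (d + 1) ^ 3 with hA
  have hA0 : 0 ≤ A := by positivity
  -- `A` is the constant of the pointwise bound; `3 ^ p` comes from the `p`-th power of a sum of
  -- three terms.
  refine ⟨((A ^ p) * 3 ^ p).toNNReal, ?_⟩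
  intro N _ _ _ _ _ _ _ o ε hε hε1 φ hφ r hr hrt Q hQ u du ν dν hu F hF
  have hp0 : 0 ≤ p := by linarith
  have hQo := hQ.isOpen
  have hQm := hQo.measurableSet
  have hfin : IsFiniteMeasure (volume.restrict Q) := ⟨by simpa using hQ.volume_lt_top⟩
  have hp1 : 1 ≤ ENNReal.ofReal p := ENNReal.one_le_ofReal.2 hp.le
  have hmem : ∀ᵐ x ∂(volume.restrict Q), x ∈ Q := ae_restrict_mem hQm
  have hν : ∀ x ∈ Q, ‖ν x‖ ≤ 1 := fun x hx => (hu.normal x hx).norm_le_one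
  have hw : ∀ x ∈ Q, u x ∈ φ.source →
      ‖fiberCoord φ (⟨u x, ν x⟩ : TangentBundle (𝓡 (d + 1)) N)‖ ≤ 2 := fun x hx hxs =>
    norm_fiberCoord_le hε hε1 hφ (e := ⟨u x, ν x⟩) hxs (hν x hx)
  have hvel := ae_bundleVelocity_fst_eq hQo hu.deriv_map hu.deriv_normal hφ.mem_atlas hw
    (R := 2 * r) (by positivity) hrt
  set D : EuclideanSpace ℝ (Fin d) → ℝ := fun x => derivNorm (du x) with hDdef
  set S : EuclideanSpace ℝ (Fin d) → ℝ := fun x => frobeniusNorm (sasakiNorm ⟨u x, ν x⟩) (dν x)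
    with hSdef
  have hD0 : ∀ x, 0 ≤ D x := fun x => frobeniusNorm_nonneg _ _
  have hK0 : ∀ x, 0 ≤ connectorNorm dν x := fun x => frobeniusNorm_nonneg _ _
  have hDint : Integrable D (volume.restrict Q) := hu.memLp_map.integrable hp1
  have hSint : Integrable S (volume.restrict Q) := hu.memLp_normal.integrable hp1
  -- pointwise bound on the derivative, for all radii
  have hbound : ∀ s, 0 < s → s ≤ r → ∀ᵐ x ∂(volume.restrict Q),
      ‖coordNormalDeriv θ φ s dν x‖ ≤ A * ((s⁻¹ + 1) * D x + S x) := by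
    intro s hs hsr
    filter_upwards [hvel, hmem] with x hx hxQ
    refine (opNorm_le_frobeniusNorm _).trans ((frobeniusNorm_coordNormalDeriv_le hθ hM0 hM hM'
      hε hε1 hφ hs hsr (hν x hxQ) hx).trans ?_)
    refine mul_le_mul_of_nonneg_left (add_le_add ?_ (connectorNorm_le x)) hA0
    refine mul_le_mul_of_nonneg_right ?_ (hD0 x)
    split_ifs
    · have := inv_pos.2 hs
      linarith
    · exact le_rfl
  have hnb : ∀ s, ∀ x ∈ Q, ‖(if u x ∈ φ.source then
      normalCoord θ s (bundleCoord φ (⟨u x, ν x⟩ : TangentBundle (𝓡 (d + 1)) N)) else 0 :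
        EuclideanSpace ℝ (Fin (d + 1)))‖ ≤ M * 2 := by
    intro s x hx
    split_ifs with hxs
    · refine (ContinuousLinearMap.le_opNorm _ _).trans ?_
      exact mul_le_mul (hM _) (hw x hx hxs) (norm_nonneg _) hM0
    · rw [norm_zero]
      positivity
  -- radii increasing to `r`
  set s : ℕ → ℝ := fun k => r - r / 2 * (1 / (k + 1)) with hsdef
  have hk : ∀ k : ℕ, 0 < 1 / ((k : ℝ) + 1) ∧ 1 / ((k : ℝ) + 1) ≤ 1 := fun k =>
    ⟨by positivity, by
      rw [div_le_one (by positivity)]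
      linarith [Nat.cast_nonneg (α := ℝ) k]⟩
  -- Staying above `r / 2` bounds `(s k)⁻¹` by `(r / 2)⁻¹`, which gives one majorant for all `k`.
  have hs2 : ∀ k, r / 2 ≤ s k := fun k => by
    have := mul_le_of_le_one_right (a := r / 2) (by positivity) (hk k).2
    simp only [hsdef]
    linarith
  have hs0 : ∀ k, 0 < s k := fun k => lt_of_lt_of_le (by positivity) (hs2 k)
  have hsr : ∀ k, s k < r := fun k => by
    have := mul_pos (half_pos hr) (hk k).1
    simp only [hsdef]
    linarith
  have hst : Filter.Tendsto s Filter.atTop (𝓝 r) := by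
    have := (tendsto_const_nhds (x := r)).sub
      ((tendsto_one_div_add_atTop_nhds_zero_nat (𝕜 := ℝ)).const_mul (r / 2))
    simpa [hsdef] using this
  have hwk := fun k => hasWeakDeriv_normalCoord hθ hQm hu.deriv_normal hφ.mem_atlas hw (hs0 k)
    (hsr k) hrt
  -- `Q` has finite measure and `p > 1`, so the `L^p` bounds give integrable majorants. Convergence
  -- holds at every point because `θ` and its derivatives are continuous.
  have hweak : HasWeakDeriv Q (coordNormal θ φ r u ν) (coordNormalDeriv θ φ r dν) := by
    refine HasWeakDeriv.of_tendsto hwk (fun k => (hwk k).1.aestronglyMeasurable)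
      (fun k => (hwk k).2.1.aestronglyMeasurable) (B := fun _ => M * 2)
      (b := fun x => A * (((r / 2)⁻¹ + 1) * D x + S x)) (integrable_const _)
      (((hDint.const_mul _).add hSint).const_mul A) ?_ ?_ ?_ ?_
    · intro k
      filter_upwards [hmem] with x hx
      exact hnb _ x hx
    · intro k
      filter_upwards [hbound (s k) (hs0 k) (hsr k).le] with x hx
      refine hx.trans (mul_le_mul_of_nonneg_left (add_le_add (mul_le_mul_of_nonneg_right
        (add_le_add ?_ le_rfl) (hD0 x)) le_rfl) hA0)
      exact inv_anti₀ (by positivity) (hs2 k)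
    · refine ae_of_all _ fun x => ?_
      rw [coordNormal_eq hθ hε hε1 hφ hr hrt]
      split_ifs
      · exact hθ.tendsto_normalCoord hr.ne' hst _
      · exact tendsto_const_nhds
    · refine ae_of_all _ fun x => ?_
      simp only [coordNormalDeriv]
      split_ifs
      · exact ((ContinuousLinearMap.compL ℝ (EuclideanSpace ℝ (Fin d)) _ _).flip
          (bundleVelocity φ dν x)).continuous.continuousAt.tendsto.comp
            (hθ.tendsto_normalCoordDeriv hr.ne' hst _)
      · exact tendsto_const_nhds
  refine ⟨?_, coordNormalDeriv θ φ r dν, hweak, ?_, ?_⟩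
  · refine MemLp.of_bound hweak.1.aestronglyMeasurable (M * 2) ?_
    filter_upwards [hmem] with x hx
    rw [coordNormal_eq hθ hε hε1 hφ hr hrt]
    exact hnb r x hx
  · refine MemLp.mono' (((hu.memLp_map.const_mul (r⁻¹ + 1)).add hu.memLp_normal).const_mul A)
      hweak.2.1.aestronglyMeasurable ?_
    exact hbound r hr le_rfl
  -- the estimate
  set T : Set (EuclideanSpace ℝ (Fin d)) := {x | u x ∈ φ.source ∧ ‖φ (u x)‖ < r} with hT
  have hTm : NullMeasurableSet T (volume.restrict Q) :=
    nullMeasurableSet_coordinate_ball hQm hu.deriv_map hφ.mem_atlas hr hrt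
  have hQF : Tᶜ ∩ Q = Q \ F := by
    ext x
    simp only [hF, hT, mem_inter_iff, mem_compl_iff, mem_ofPred_eq, mem_sdiff,
      mem_ball_zero_iff]
    tauto
  set fD : EuclideanSpace ℝ (Fin d) → ℝ≥0∞ := fun x => ENNReal.ofReal (D x ^ p) with hfD
  set fK : EuclideanSpace ℝ (Fin d) → ℝ≥0∞ := fun x => ENNReal.ofReal (connectorNorm dν x ^ p)
    with hfK
  have hfDm : AEMeasurable fD (volume.restrict Q) :=
    (hDint.aestronglyMeasurable.aemeasurable.pow_const p).ennreal_ofReal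
  have hind : ∫⁻ x in Q, Tᶜ.indicator fD x = ∫⁻ x in Q \ F, fD x := by
    rw [lintegral_indicator₀ hTm.compl, Measure.restrict_restrict₀ hTm.compl, hQF]
  have hpt : ∀ᵐ x ∂(volume.restrict Q),
      ENNReal.ofReal (frobeniusNorm (fun t : EuclideanSpace ℝ (Fin (d + 1)) => ‖t‖)
        (coordNormalDeriv θ φ r dν x) ^ p) ≤
      ENNReal.ofReal (A ^ p * 3 ^ p) *
        (ENNReal.ofReal (1 / r ^ p) * Tᶜ.indicator fD x + fD x + fK x) := by
    filter_upwards [hvel, hmem] with x hx hxQ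
    have h1 := frobeniusNorm_coordNormalDeriv_le hθ hM0 hM hM' hε hε1 hφ hr le_rfl (hν x hxQ) hx
    set c : ℝ := if u x ∈ φ.source ∧ ‖φ (u x)‖ < r then 0 else r⁻¹ with hc
    have hc0 : 0 ≤ c := by
      rw [hc]
      split_ifs <;> positivity
    -- The coefficient `c` is `0` on `T` and `r⁻¹` elsewhere, so its `p`-th power is `1 / r ^ p`
    -- times the indicator of the complement.
    have hcD : ENNReal.ofReal ((c * D x) ^ p) = ENNReal.ofReal (1 / r ^ p) * Tᶜ.indicator fD x := by
      rw [Real.mul_rpow hc0 (hD0 x)]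
      by_cases hxT : u x ∈ φ.source ∧ ‖φ (u x)‖ < r
      · have hxT' : x ∉ Tᶜ := fun h' => h' hxT
        rw [indicator_of_notMem hxT', hc, if_pos hxT, Real.zero_rpow (by linarith)]
        simp
      · have hxT' : x ∈ Tᶜ := hxT
        rw [indicator_of_mem hxT', hc, if_neg hxT, ENNReal.ofReal_mul (by positivity),
          Real.inv_rpow hr.le, one_div]
    have h2 : frobeniusNorm (fun t : EuclideanSpace ℝ (Fin (d + 1)) => ‖t‖)
        (coordNormalDeriv θ φ r dν x) ^ p ≤
        (A ^ p * 3 ^ p) * ((c * D x) ^ p + D x ^ p + connectorNorm dν x ^ p) := by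
      have hcD0 : 0 ≤ c * D x := mul_nonneg hc0 (hD0 x)
      calc _ ≤ (A * (c * D x + D x + connectorNorm dν x)) ^ p := by
            refine Real.rpow_le_rpow (frobeniusNorm_nonneg _ _) (h1.trans (le_of_eq ?_)) hp0
            simp only [hDdef]
            ring
        _ = A ^ p * (c * D x + D x + connectorNorm dν x) ^ p :=
            Real.mul_rpow hA0 (by linarith [hD0 x, hK0 x])
        _ ≤ A ^ p * (3 ^ p * ((c * D x) ^ p + D x ^ p + connectorNorm dν x ^ p)) :=
            mul_le_mul_of_nonneg_left (add_three_rpow_le hp0 hcD0 (hD0 x) (hK0 x))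
              (Real.rpow_nonneg hA0 p)
        _ = _ := by ring
    refine (ENNReal.ofReal_le_ofReal h2).trans (le_of_eq ?_)
    have e1 : 0 ≤ (c * D x) ^ p := Real.rpow_nonneg (mul_nonneg hc0 (hD0 x)) p
    have e2 : 0 ≤ D x ^ p := Real.rpow_nonneg (hD0 x) p
    have e3 : 0 ≤ connectorNorm dν x ^ p := Real.rpow_nonneg (hK0 x) p
    rw [ENNReal.ofReal_mul (by positivity), ENNReal.ofReal_add (by positivity) e3,
      ENNReal.ofReal_add e1 e2, hcD]
  refine (lintegral_mono_ae hpt).trans (le_of_eq ?_)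
  -- Additivity of the lower integral needs measurability of the left summand only, so none is
  -- required of the connector norm.
  have hindm : AEMeasurable (fun x => ENNReal.ofReal (1 / r ^ p) * Tᶜ.indicator fD x)
      (volume.restrict Q) := (hfDm.indicator₀ hTm.compl).const_mul _
  have hsum : AEMeasurable (fun x => ENNReal.ofReal (1 / r ^ p) * Tᶜ.indicator fD x + fD x)
      (volume.restrict Q) := hindm.add hfDm
  rw [lintegral_const_mul' _ _ ENNReal.ofReal_ne_top, lintegral_add_left' hsum,
    lintegral_add_left' hindm, lintegral_const_mul' _ _ ENNReal.ofReal_ne_top, hind]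
  rfl
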